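/- Work over $\mathbb{C}$. For an algebraic group $\Gamma$ (a group scheme of finite type over $\mathbb{C}$) acting on an irreducible variety $X$, let $X/\Gamma$ denote the rational quotient, i.e. a variety (defined up to birational equivalence) whose function field is the field of invariants $\mathbb{C}(X)^{\Gamma}$, and write $\sim$ for birational equivalence over $\mathbb{C}$ (isomorphism of function fields over $\mathbb{C}$). A quotient $\Gamma/\Gamma_0$ acts almost freely on $X$ if the points of some non-empty Zariski open subset of $X$ have trivial stabilizer in $\Gamma/\Gamma_0$. Let $V$, $W$ be finite-dimensional (algebraic) representations of algebraic groups $G$, $H$ respectively, put $a=\dim\mathbb{P}V$, $b=\dim\mathbb{P}W$, and assume $a<b$. Let $G_0\subset G$ and $H_0\subset H$ be the subgroups of elements acting trivially on $\mathbb{P}V$ and on $\mathbb{P}W$, and let $\overline{G}=G/G_0$, $\overline{H}=H/H_0$. Let $\mathbb{G}(a,\mathbb{P}W)$ be the Grassmannian of $a$-planes in $\mathbb{P}W$, and $\mathcal{E}$ its universal subbundle of rank $a+1$, with the induced $H$-linearization. Assume that 1. there is an $H$-linearized line bundle $\mathcal{L}$ over $\mathbb{G}(a,\mathbb{P}W)$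 such that $H_0$ acts trivially on $\mathcal{E}\otimes\mathcal{L}$; 2. $\overline{G}$ acts almost freely on $\mathbb{P}(V^{\oplus a'})$ for some integer $a'$ with $1\le a'\le a$; 3. $\overline{H}$ acts almost freely on $\mathbb{P}W$ and on $\mathbb{G}(a,\mathbb{P}W)$. Then, setting $N=(a+1)(a-a')+1+a(b-a)$, $$\mathbb{P}(V\otimes W)/(G\times H)\ \sim\ \mathbb{C}^N\times\bigl(\mathbb{P}(V^{\oplus a'})/G\bigr)\times\bigl(\mathbb{P}W/H\bigr).$$ Equivalently, $\mathbb{C}(\mathbb{P}(V\otimes W))^{G\times H}$ is isomorphic over $\mathbb{C}$ to the fraction field of the polynomial ring in $N$ variables over $\mathbb{C}(\mathbb{P}(V^{\oplus a'}))^{G}\otimes_{\mathbb{C}}\mathbb{C}(\mathbb{P}W)^{H}$. -/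

import Mathlib

open CategoryTheory AlgebraicGeometry
open scoped TensorProduct

noncomputable section

namespace InvTheory

/-! ### Algebraic groups over `ℂ` and their representations

An algebraic group over `ℂ` is a group object `G` in schemes over `Spec ℂ` that is of finite type,
that is `[GrpObj G] [LocallyOfFiniteType G.hom] [QuasiCompact G.hom]`. -/

/-- The set `G(ℂ)` of `ℂ`-points of a scheme over `ℂ`. -/
def Points (G : Over (Spec (CommRingCat.of ℂ))) : Type :=
  MonoidalCategoryStruct.tensorUnit (Over (Spec (CommRingCat.of ℂ))) ⟶ G

/-- The group structure on the `ℂ`-points of a group scheme. -/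
instance (G : Over (Spec (CommRingCat.of ℂ))) [GrpObj G] : Group (Points G) :=
  CategoryTheory.Hom.group

section Points

variable {G : Over (Spec (CommRingCat.of ℂ))}

/-- The morphism `Spec ℂ ⟶ G` underlying a `ℂ`-point. -/
def Points.hom (g : Points G) : Spec (CommRingCat.of ℂ) ⟶ G.left :=
  g.left

/-- The closed point of the scheme `G` under a `ℂ`-point. -/
def Points.pt (g : Points G) : G.left :=
  g.hom (IsLocalRing.closedPoint ℂ)

/-- Evaluation at the `ℂ`-point `g` of the sections of the structure sheaf over an open
neighbourhood `U` of `g`. -/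
def evalHom (U : G.left.Opens) (g : Points G) (hg : g.pt ∈ U) : Γ(G.left, U) →+* ℂ :=
  (Scheme.stalkClosedPointTo g.hom).hom.comp (G.left.presheaf.germ U g.pt hg).hom

open Classical in
/-- The value at the `ℂ`-point `g` of a section `f` of the structure sheaf over the open set `U`
(set to `0` if `g` does not lie in `U`). -/
def evalAt (U : G.left.Opens) (f : Γ(G.left, U)) (g : Points G) : ℂ :=
  if hg : g.pt ∈ U then evalHom U g hg f else 0

/-- A linear action of `G(ℂ)` on `E` is an algebraic representation of `G` if its matrix
coefficients are regular functions on `G`.  (`G` is reduced, so this is the same thing as a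
morphism of group schemes `G ⟶ GL(E)`.) -/
def IsAlgebraicRep [GrpObj G] {E : Type*} [AddCommGroup E] [Module ℂ E]
    (ρ : Representation ℂ (Points G) E) : Prop :=
  ∀ (v : E) (φ : Module.Dual ℂ E), ∃ f : Γ(G.left, ⊤), ∀ g : Points G,
    φ (ρ g v) = evalAt ⊤ f g

end Points

/-! ### Polynomial functions and the Zariski topology -/

section Poly

variable (E : Type*) [AddCommGroup E] [Module ℂ E]

/-- The algebra of polynomial functions on a vector space. -/
def polyFun : Subalgebra ℂ (E → ℂ) :=
  Algebra.adjoin ℂ (Set.range fun φ : Module.Dual ℂ E => (φ : E → ℂ))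

variable {E}

/-- Zariski open subsets of a vector space. -/
def IsZariskiOpen (U : Set E) : Prop :=
  ∃ S : Set (E → ℂ), S ⊆ polyFun E ∧ U = {x | ∃ p ∈ S, p x ≠ 0}

end Poly

/-! ### Grassmannians -/

section Gr

variable (k : ℕ) (E : Type*) [AddCommGroup E] [Module ℂ E]

/-- The Grassmannian of `k`-dimensional subspaces of `E`, i.e. of `(k-1)`-planes in `ℙE`.  In
particular `Gr 1 E` is `ℙE`, and `Gr (a + 1) E` is `𝔾(a, ℙE)`. -/
def Gr : Type _ := {P : Submodule ℂ E // Module.finrank ℂ P = k}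

variable {k E}

/-- The subspace spanned by a linearly independent `k`-tuple. -/
def Gr.ofFrame (w : Fin k → E) (hw : LinearIndependent ℂ w) : Gr k E :=
  ⟨Submodule.span ℂ (Set.range w), by
    rw [finrank_span_eq_card hw, Fintype.card_fin]⟩

/-- Zariski open subsets of the Grassmannian, which carries the quotient topology of the space of
linearly independent `k`-tuples. -/
def Gr.IsOpen (U : Set (Gr k E)) : Prop :=
  IsZariskiOpen {w : Fin k → E | ∃ hw : LinearIndependent ℂ w, Gr.ofFrame w hw ∈ U}

/-- `t` is a regular function on the open subset `U` of the Grassmannian: as a function of a frame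
`w` of the subspace it is locally a quotient of polynomials. -/
def Gr.IsRegularOn (U : Set (Gr k E)) (t : Gr k E → ℂ) : Prop :=
  ∀ (w₀ : Fin k → E) (hw₀ : LinearIndependent ℂ w₀), Gr.ofFrame w₀ hw₀ ∈ U →
    ∃ p ∈ polyFun (Fin k → E), ∃ q ∈ polyFun (Fin k → E), q w₀ ≠ 0 ∧
      ∀ (w : Fin k → E) (hw : LinearIndependent ℂ w), Gr.ofFrame w hw ∈ U → q w ≠ 0 →
        t (Gr.ofFrame w hw) = p w / q w

variable {Γ : Type*} [Group Γ] (ρ : Representation ℂ Γ E)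

/-- The action on the Grassmannian induced by a representation. -/
def Gr.act (g : Γ) (P : Gr k E) : Gr k E :=
  ⟨P.1.map (ρ g), by
    exact (Submodule.equivMapOfInjective (ρ g) (ρ.apply_bijective g).1 P.1).finrank_eq.symm.trans
      P.2⟩

theorem Gr.act_one (P : Gr k E) : Gr.act ρ 1 P = P := by
  apply Subtype.ext
  simp only [Gr.act, map_one, Module.End.one_eq_id, Submodule.map_id]

theorem Gr.act_mul (g h : Γ) (P : Gr k E) : Gr.act ρ (g * h) P = Gr.act ρ g (Gr.act ρ h P) := by
  apply Subtype.ext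
  simp only [Gr.act, map_mul, Module.End.mul_eq_comp, Submodule.map_comp]

/-- The subgroup of the elements which act trivially on `ℙE`. -/
def projKernel : Subgroup Γ where
  carrier := {g | ∀ P : Gr 1 E, Gr.act ρ g P = P}
  one_mem' := Gr.act_one ρ
  mul_mem' {g h} hg hh P := by rw [Gr.act_mul, hh, hg]
  inv_mem' {g} hg P := by
    conv_lhs => rw [← hg P]
    rw [← Gr.act_mul, inv_mul_cancel, Gr.act_one]

/-- The group `Γ ⧸ N` acts almost freely on the Grassmannian: a general point `P` has trivial
stabilizer in `Γ ⧸ N`, i.e. every element of `Γ` that fixes `P` lies in `N`. -/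
def ActsAlmostFreely (k : ℕ) (N : Subgroup Γ) : Prop :=
  ∃ U : Set (Gr k E), Gr.IsOpen U ∧ U.Nonempty ∧
    ∀ P ∈ U, ∀ g : Γ, Gr.act ρ g P = P → g ∈ N

end Gr

/-! ### Linearized line bundles on the Grassmannian -/

section LineBundle

variable {H : Over (Spec (CommRingCat.of ℂ))} {k : ℕ} {E : Type*} [AddCommGroup E] [Module ℂ E]

variable (E) in
/-- The functions on `H(ℂ) × E` generated by the regular functions on the open subset `U` of `H`
and the polynomial functions on `E`. -/
def prodFun (U : H.left.Opens) : Subalgebra ℂ (Points H × E → ℂ) :=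
  Algebra.adjoin ℂ
    ((Set.range fun f : Γ(H.left, U) => fun x : Points H × E => evalAt U f x.1) ∪
      (Set.range fun p : polyFun E => fun x : Points H × E => p.1 x.2))

/-- `t` is a regular function on the open subset `D` of `H × Gr k E`. -/
def IsRegularOnProd (D : Set (Points H × Gr k E)) (t : Points H → Gr k E → ℂ) : Prop :=
  ∀ (U : H.left.Opens), IsAffineOpen U →
    ∀ (h₀ : Points H) (w₀ : Fin k → E) (hw₀ : LinearIndependent ℂ w₀),
      h₀.pt ∈ U → (h₀, Gr.ofFrame w₀ hw₀) ∈ D →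
      ∃ p ∈ prodFun (H := H) (Fin k → E) U, ∃ q ∈ prodFun (H := H) (Fin k → E) U,
        q (h₀, w₀) ≠ 0 ∧
        ∀ (h : Points H) (w : Fin k → E) (hw : LinearIndependent ℂ w),
          h.pt ∈ U → (h, Gr.ofFrame w hw) ∈ D → q (h, w) ≠ 0 →
          t h (Gr.ofFrame w hw) = p (h, w) / q (h, w)

/-- An `H`-linearized algebraic line bundle on the Grassmannian `Gr k E`, where `H` acts on `E`
by `ρ`: a family of lines `fib P`, an atlas of nowhere vanishing local sections on Zariski open sets
whose transition functions are regular, and an action of `H` on the total space, linear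
on fibres and algebraic, that lifts the action on the Grassmannian. -/
structure LinearizedLineBundle [GrpObj H] (k : ℕ) (ρ : Representation ℂ (Points H) E) where
  fib : Gr k E → Type
  [addCommGroup : ∀ P, AddCommGroup (fib P)]
  [module : ∀ P, Module ℂ (fib P)]
  finrank_fib : ∀ P, Module.finrank ℂ (fib P) = 1
  /-- The pairs `(U, s)` of a trivializing open set and a frame `s` over it
  (the values of `s` outside `U` are irrelevant).  The atlas generates the algebraic structure. -/
  atlas : Set (Set (Gr k E) × (∀ P, fib P))
  isOpen_atlas : ∀ c ∈ atlas, Gr.IsOpen c.1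
  cover_atlas : ∀ P, ∃ c ∈ atlas, P ∈ c.1
  frame_ne_zero : ∀ c ∈ atlas, ∀ P ∈ c.1, c.2 P ≠ 0
  transition : ∀ c ∈ atlas, ∀ c' ∈ atlas, ∃ t : Gr k E → ℂ,
    Gr.IsRegularOn (c.1 ∩ c'.1) t ∧ ∀ P ∈ c.1 ∩ c'.1, c.2 P = t P • c'.2 P
  act : ∀ (h : Points H) (P : Gr k E), fib P →ₗ[ℂ] fib (Gr.act ρ h P)
  act_one : ∀ (P : Gr k E) (x : fib P),
    (⟨Gr.act ρ 1 P, act 1 P x⟩ : Σ P, fib P) = ⟨P, x⟩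
  act_mul : ∀ (g h : Points H) (P : Gr k E) (x : fib P),
    (⟨Gr.act ρ (g * h) P, act (g * h) P x⟩ : Σ P, fib P) =
      ⟨Gr.act ρ g (Gr.act ρ h P), act g (Gr.act ρ h P) (act h P x)⟩
  act_regular : ∀ c ∈ atlas, ∀ c' ∈ atlas, ∃ t : Points H → Gr k E → ℂ,
    IsRegularOnProd {x | x.2 ∈ c.1 ∧ Gr.act ρ x.1 x.2 ∈ c'.1} t ∧
      ∀ (h : Points H) (P : Gr k E), P ∈ c.1 → Gr.act ρ h P ∈ c'.1 →
        act h P (c.2 P) = t h P • c'.2 (Gr.act ρ h P)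

attribute [instance] LinearizedLineBundle.addCommGroup LinearizedLineBundle.module

/-- The action of `h` on the universal subbundle `ℰ`, whose fibre at `P` is `P` itself. -/
def subbundleAct {Γ : Type*} [Group Γ] (ρ : Representation ℂ Γ E) (h : Γ) (P : Gr k E) :
    P.1 →ₗ[ℂ] (Gr.act ρ h P).1 :=
  (ρ h).restrict fun _ hx => Submodule.mem_map_of_mem hx

/-- The elements of the subgroup `N` act trivially on the bundle `ℰ ⊗ L` (its total space). -/
def LinearizedLineBundle.TwistTrivialOn [GrpObj H] {ρ : Representation ℂ (Points H) E}
    (L : LinearizedLineBundle k ρ) (N : Subgroup (Points H)) : Prop :=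
  ∀ h ∈ N, ∀ (P : Gr k E) (z : P.1 ⊗[ℂ] L.fib P),
    (⟨Gr.act ρ h P, TensorProduct.map (subbundleAct ρ h P) (L.act h P) z⟩ :
      Σ P : Gr k E, P.1 ⊗[ℂ] L.fib P) = ⟨P, z⟩

end LineBundle

/-! ### Function fields of projective spaces and of their rational quotients -/

section FunctionField

/-- The fraction field of a `ℂ`-algebra that is a domain. -/
def Frac (A : Type*) [CommRing A] : Type _ := FractionRing A

instance (A : Type*) [CommRing A] : CommRing (Frac A) := inferInstanceAs (CommRing (FractionRing A))

instance (A : Type*) [CommRing A] : Algebra A (Frac A) :=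
  inferInstanceAs (Algebra A (FractionRing A))

instance (A : Type*) [CommRing A] : IsFractionRing A (Frac A) :=
  inferInstanceAs (IsFractionRing A (FractionRing A))

instance (A : Type*) [CommRing A] [Algebra ℂ A] : Algebra ℂ (Frac A) :=
  inferInstanceAs (Algebra ℂ (FractionRing A))

instance (A : Type*) [CommRing A] [Algebra ℂ A] : IsScalarTower ℂ A (Frac A) :=
  inferInstanceAs (IsScalarTower ℂ A (FractionRing A))

variable {E : Type*} [AddCommGroup E] [Module ℂ E]

/-- `p` is homogeneous of degree `d`. -/
def IsHomog (p : E → ℂ) (d : ℕ) : Prop := ∀ (c : ℂ) (v : E), p (c • v) = c ^ d * p v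

variable (E) in
/-- The field `ℂ(E)` of rational functions on the vector space `E`. -/
abbrev RatFun : Type _ := Frac (polyFun E)

variable (E) in
/-- The function field `ℂ(ℙE)`: the fractions `p / q` of homogeneous polynomials of equal degree. -/
def projFunctionField : Subalgebra ℂ (RatFun E) where
  carrier := {z | ∃ (d : ℕ) (p q : polyFun E), IsHomog p.1 d ∧ IsHomog q.1 d ∧
    q ∈ nonZeroDivisors (polyFun E) ∧ z * algebraMap _ (RatFun E) q = algebraMap _ (RatFun E) p}
  mul_mem' := by
    rintro z₁ z₂ ⟨d₁, p₁, q₁, hp₁, hq₁, h₁, e₁⟩ ⟨d₂, p₂, q₂, hp₂, hq₂, h₂, e₂⟩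
    refine ⟨d₁ + d₂, p₁ * p₂, q₁ * q₂, fun c v => ?_, fun c v => ?_, mul_mem h₁ h₂, ?_⟩
    · simp only [MulMemClass.coe_mul, Pi.mul_apply, hp₁ c v, hp₂ c v]; ring
    · simp only [MulMemClass.coe_mul, Pi.mul_apply, hq₁ c v, hq₂ c v]; ring
    · rw [map_mul, map_mul, ← e₁, ← e₂]; ring
  add_mem' := by
    rintro z₁ z₂ ⟨d₁, p₁, q₁, hp₁, hq₁, h₁, e₁⟩ ⟨d₂, p₂, q₂, hp₂, hq₂, h₂, e₂⟩
    refine ⟨d₁ + d₂, p₁ * q₂ + p₂ * q₁, q₁ * q₂, fun c v => ?_, fun c v => ?_,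
      mul_mem h₁ h₂, ?_⟩
    · simp only [MulMemClass.coe_mul, AddMemClass.coe_add, Pi.add_apply, Pi.mul_apply, hp₁ c v,
        hp₂ c v, hq₁ c v, hq₂ c v]; ring
    · simp only [MulMemClass.coe_mul, Pi.mul_apply, hq₁ c v, hq₂ c v]; ring
    · rw [map_add, map_mul, map_mul, map_mul, ← e₁, ← e₂]; ring
  algebraMap_mem' r := by
    refine ⟨0, algebraMap ℂ _ r, 1, fun c v => ?_, fun c v => ?_, one_mem _, ?_⟩
    · simp [Algebra.algebraMap_eq_smul_one]
    · simp
    · rw [map_one, mul_one, ← IsScalarTower.algebraMap_apply]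

theorem comp_mem_polyFun (f : E →ₗ[ℂ] E) {p : E → ℂ} (hp : p ∈ polyFun E) :
    p ∘ f ∈ polyFun E := by
  induction hp using Algebra.adjoin_induction with
  | mem x hx =>
    obtain ⟨φ, rfl⟩ := hx
    exact Algebra.subset_adjoin ⟨φ.comp f, rfl⟩
  | algebraMap r => exact (polyFun E).algebraMap_mem r
  | add x y _ _ hx hy => exact (polyFun E).add_mem hx hy
  | mul x y _ _ hx hy => exact (polyFun E).mul_mem hx hy

/-- The automorphism `p ↦ p ∘ f` of the algebra of polynomial functions. -/
def polyPullback (f : E ≃ₗ[ℂ] E) : polyFun E ≃ₐ[ℂ] polyFun E where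
  toFun p := ⟨p.1 ∘ f, comp_mem_polyFun f.toLinearMap p.2⟩
  invFun p := ⟨p.1 ∘ f.symm, comp_mem_polyFun f.symm.toLinearMap p.2⟩
  left_inv p := by ext x; simp
  right_inv p := by ext x; simp
  map_mul' _ _ := rfl
  map_add' _ _ := rfl
  commutes' _ := rfl

variable {Γ : Type*} [Group Γ] (ρ : Representation ℂ Γ E)

/-- The automorphism `z ↦ z ∘ ρ g` of the field of rational functions. -/
def ratPullback (g : Γ) : RatFun E ≃ₐ[ℂ] RatFun E :=
  IsFractionRing.algEquivOfAlgEquiv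
    (polyPullback (LinearEquiv.ofBijective (ρ g) (ρ.apply_bijective g)))

/-- The field of invariants `ℂ(ℙE)^Γ`, i.e. the function field of the rational quotient `ℙE / Γ`. -/
def projQuotientField : Subalgebra ℂ (RatFun E) where
  carrier := {z | z ∈ projFunctionField E ∧ ∀ g : Γ, ratPullback ρ g z = z}
  mul_mem' hx hy := ⟨mul_mem hx.1 hy.1, fun g => by rw [map_mul, hx.2 g, hy.2 g]⟩
  add_mem' hx hy := ⟨add_mem hx.1 hy.1, fun g => by rw [map_add, hx.2 g, hy.2 g]⟩
  algebraMap_mem' r := ⟨(projFunctionField E).algebraMap_mem r, fun g => AlgEquiv.commutes _ r⟩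

/-- The function field of `ℂ^N × Y × Z`, where `K` and `L` are the function fields of the
varieties `Y` and `Z`: the fraction field of the domain `(K ⊗ L)[x₁, …, x_N]`. -/
abbrev AffineProdField (N : ℕ) (K L : Type*) [CommRing K] [CommRing L] [Algebra ℂ K]
    [Algebra ℂ L] : Type _ :=
  Frac (MvPolynomial (Fin N) (K ⊗[ℂ] L))

end FunctionField

/-- The representation of `Γ × Δ` on `V ⊗ W`. -/
abbrev outerTensor {Γ Δ V W : Type*} [Group Γ] [Group Δ] [AddCommGroup V] [Module ℂ V]
    [AddCommGroup W] [Module ℂ W] (ρ : Representation ℂ Γ V) (σ : Representation ℂ Δ W) :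
    Representation ℂ (Γ × Δ) (V ⊗[ℂ] W) :=
  Representation.tprod (ρ.comp (MonoidHom.fst Γ Δ)) (σ.comp (MonoidHom.snd Γ Δ))

/-- The representation of `Γ` on the direct sum `V^{⊕ m}`. -/
abbrev copies {Γ V : Type*} [Group Γ] [AddCommGroup V] [Module ℂ V]
    (ρ : Representation ℂ Γ V) (m : ℕ) : Representation ℂ Γ (DirectSum (Fin m) fun _ => V) :=
  Representation.directSum fun _ : Fin m => ρ

end InvTheory

end

/-!
Rational functions on `V ⊗ W` are rational functions of a generic matrix `X` with `b + 1` rows and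
`n = a + 1` columns, on which `H` acts by row operations and `G`, together with the homotheties, by
column operations (`genericMatrix_map`). The proof computes the invariants inside this field, with the
no-name lemma in the following elementary form: a cocycle of a group `Γ` with values in `GL_n(K)` is
a coboundary, provided that up to a common denominator its entries are rational functions of a point
and its translate (`exists_coboundary`). If `Γ` acts almost freely modulo a subgroup on which the
cocycle is trivial, then its entries are constant on the fibres of the map sending a group element
and a point to the pair of the point and its translate, and the condition holds by the
Nullstellensatz (`exists_mem_orbitSpan`). A matrix splitting a cocycle is called a frame here.

* Almost freeness on `ℙ(V^{a'})` gives a frame `T₁` for the representation `V`, with entries in the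
  function field of `V^{a'}`, and almost freeness on `ℙW` a frame `T₃` for `W` (`exists_linear_frame`).
* Almost freeness on the Grassmannian and the linearized line bundle give a frame `T` of the column
  space of `X`, with entries in the function field of the Grassmannian, on which `H` acts by scalars
  (`exists_grassmannian_frame`, `exists_frame_of_columns`).

Multiplying the upper block of `X` by `T` gives `n` vectors on which `H` acts by scalars only. The
first `a'` of them form a generic point of `V^{a'}`, and in the frame `T₁` the remaining ones have
invariant coordinates. Hence the quotient of `ℙ(V ⊗ W)` is birational to `ℙ(V^{a'}) / G`, times the
quotient of the Grassmannian by `H`, times an affine space of dimension `n (n - a')`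
(`nonempty_frac_equiv_of_matrix`).

To trade the quotient of the Grassmannian for that of `ℙW`, consider the variety of flags formed by
the column space of `X` and a line in it. By the frame `T` its quotient by `H` is the product of the
quotient of the Grassmannian with `ℂ^a` (`nonempty_frac_equiv_of_column`). By the frame `T₃` it is the
product of `ℙW / H` with an affine space of dimension `a (b - a)`, the subspaces through a fixed point
(`nonempty_frac_equiv_of_point`). Since `n (n - a') ≥ a`, enough variables are available to replace
one by the other (`nonempty_frac_equiv_of_stably_equiv`), which leaves
`n (n - a') - a + a (b - a) = N` variables.
-/

open CategoryTheory AlgebraicGeometry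
open scoped TensorProduct

noncomputable section

namespace NoName

open InvTheory

/-! ### Functions constant on fibres -/

/-- Over a field of characteristic zero, an element `c` of a reduced algebra with
`c ⊗ 1 - 1 ⊗ c` nilpotent is a scalar: every two roots of its minimal polynomial coincide. -/
theorem mem_range_algebraMap_of_isNilpotent {κ S : Type*} [Field κ] [CharZero κ] [CommRing S]
    [Nontrivial S] [IsReduced S] [Algebra κ S] {c : S}
    (hc : IsNilpotent (c ⊗ₜ[κ] (1 : S) - 1 ⊗ₜ[κ] c)) : c ∈ Set.range (algebraMap κ S) := by
  let F := AlgebraicClosure κ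
  let A := Algebra.adjoin κ {c}
  let cA : A := ⟨c, Algebra.self_mem_adjoin_singleton κ c⟩
  have hcA : IsNilpotent (cA ⊗ₜ[κ] (1 : A) - 1 ⊗ₜ[κ] cA) := by
    have hinj : Function.Injective (Algebra.TensorProduct.map A.val A.val) :=
      TensorProduct.map_injective_of_flat_flat _ _ Subtype.val_injective Subtype.val_injective
    rw [← IsNilpotent.map_iff hinj]
    simpa using hc
  -- the homomorphism `κ[c] → F` that sends `c` to the root `y`
  have eval : ∀ (y : F) (hy : Polynomial.aeval y (minpoly κ c) = 0),
      Algebra.adjoin.liftSingleton κ c y hy cA = y := by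
    intro y hy
    have : AlgEquiv.adjoinSingletonEquivAdjoinRootMinpoly κ c cA
        = AdjoinRoot.root (minpoly κ c) := by
      rw [← AlgEquiv.eq_symm_apply]
      apply Subtype.ext
      simp [cA, AlgEquiv.adjoinSingletonEquivAdjoinRootMinpoly]
    simp only [Algebra.adjoin.liftSingleton, AlgHom.comp_apply, AlgEquiv.toAlgHom_apply, this]
    exact AdjoinRoot.liftAlgHom_root _ _ _ hy
  have key : ∀ y z : F, Polynomial.aeval y (minpoly κ c) = 0 →
      Polynomial.aeval z (minpoly κ c) = 0 → y = z := by
    intro y z hy hz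
    let f := Algebra.adjoin.liftSingleton κ c y hy
    let g := Algebra.adjoin.liftSingleton κ c z hz
    have hf : f cA = y := eval y hy
    have hg : g cA = z := eval z hz
    have h := hcA.map (Algebra.TensorProduct.lift f g fun _ _ => Commute.all _ _)
    simp only [map_sub, Algebra.TensorProduct.lift_tmul, map_one, mul_one, one_mul, hf, hg] at h
    exact sub_eq_zero.mp h.eq_zero
  set P := minpoly κ c with hP
  -- in particular `P ≠ 0`, as every element would be a root of `0`
  have hP0 : P ≠ 0 := by
    intro h
    simp [h] at key
    exact zero_ne_one (key 0 1)
  have hint : IsIntegral κ c := by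
    by_contra h
    exact hP0 (minpoly.eq_zero h)
  have hmonic := minpoly.monic hint
  have hdeg : P.natDegree ≠ 0 := (minpoly.natDegree_pos hint).ne'
  have hsplit := IsAlgClosed.splits (P.map (algebraMap κ F))
  obtain ⟨l, hl⟩ : ∃ l, l ∈ (P.map (algebraMap κ F)).roots := by
    apply Multiset.exists_mem_of_ne_zero
    intro h0
    have := hsplit.natDegree_eq_card_roots
    rw [h0, Polynomial.natDegree_map] at this
    simp at this
    exact hdeg this
  have hroots : (P.map (algebraMap κ F)).roots = Multiset.replicate P.natDegree l := by
    rw [Multiset.eq_replicate, ← hsplit.natDegree_eq_card_roots, Polynomial.natDegree_map]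
    refine ⟨rfl, fun y hy => key _ _ ?_ ?_⟩
    · simpa [Polynomial.aeval_def, Polynomial.eval_map] using (Polynomial.mem_roots'.mp hy).2
    · simpa [Polynomial.aeval_def, Polynomial.eval_map] using (Polynomial.mem_roots'.mp hl).2
  have hpow : P.map (algebraMap κ F) = (Polynomial.X - Polynomial.C l) ^ P.natDegree := by
    have := hsplit.eq_prod_roots
    rw [hroots, Polynomial.leadingCoeff_map, hmonic.leadingCoeff] at this
    simpa using this
  -- the trace `P.natDegree * l` lies in `κ`
  have hnext : algebraMap κ F P.nextCoeff = - (P.natDegree : F) * l := by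
    rw [← Polynomial.nextCoeff_map (algebraMap κ F).injective, hpow,
      (Polynomial.monic_X_sub_C l).nextCoeff_pow, Polynomial.nextCoeff_X_sub_C, nsmul_eq_mul,
      mul_neg, neg_mul]
  have hdF : (P.natDegree : F) ≠ 0 := by exact_mod_cast hdeg
  let l₀ : κ := - P.nextCoeff / P.natDegree
  have hl₀ : algebraMap κ F l₀ = l := by
    simp only [l₀, map_div₀, map_neg, hnext, map_natCast]
    rw [neg_mul, neg_neg, mul_div_cancel_left₀ _ hdF]
  have hP' : P = (Polynomial.X - Polynomial.C l₀) ^ P.natDegree := by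
    apply Polynomial.map_injective _ (algebraMap κ F).injective
    simp only [Polynomial.map_pow, Polynomial.map_sub, Polynomial.map_X, Polynomial.map_C, hl₀]
    exact hpow
  have h0 := minpoly.aeval κ c
  rw [← hP, hP'] at h0
  simp only [map_pow, map_sub, Polynomial.aeval_X, Polynomial.aeval_C] at h0
  exact ⟨l₀, (sub_eq_zero.mp (pow_eq_zero_iff hdeg |>.mp h0)).symm⟩

/-- The Nullstellensatz: an element of a finitely generated `ℂ`-algebra that vanishes at all
`ℂ`-points is nilpotent. -/
theorem isNilpotent_of_forall_algHom {R : Type*} [CommRing R] [Algebra ℂ R]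
    [Algebra.FiniteType ℂ R] {x : R} (hx : ∀ χ : R →ₐ[ℂ] ℂ, χ x = 0) : IsNilpotent x := by
  have : IsJacobsonRing R := by
    obtain ⟨n, f, hf⟩ := Algebra.FiniteType.iff_quotient_mvPolynomial''.mp
      ‹Algebra.FiniteType ℂ R›
    exact isJacobsonRing_of_surjective ⟨f.toRingHom, hf⟩
  rw [← mem_nilradical, nilradical, Ideal.radical_eq_jacobson, Ideal.jacobson, Ideal.mem_sInf]
  rintro I ⟨-, hI⟩
  let _ := Ideal.Quotient.field I
  have : Module.Finite ℂ (R ⧸ I) := finite_of_finite_type_of_isJacobsonRing ℂ (R ⧸ I)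
  have hb := IsAlgClosed.algebraMap_bijective_of_isIntegral (k := ℂ) (K := R ⧸ I)
  let e := AlgEquiv.ofBijective (Algebra.ofId ℂ (R ⧸ I)) hb
  have := hx (e.symm.toAlgHom.comp (Ideal.Quotient.mkₐ ℂ I))
  simpa [Ideal.Quotient.eq_zero_iff_mem] using this

/-- A finite product of finitely generated algebras is finitely generated. -/
theorem finiteType_pi {J : Type*} [Finite J] (B : J → Type*) [∀ j, CommRing (B j)]
    [∀ j, Algebra ℂ (B j)] [∀ j, Algebra.FiniteType ℂ (B j)] :
    Algebra.FiniteType ℂ (∀ j, B j) := by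
  classical
  cases nonempty_fintype J
  choose s hs using fun j => (inferInstance : Algebra.FiniteType ℂ (B j)).out
  let T : Set (∀ j, B j) := ⋃ j, Pi.single j '' (insert 1 (s j : Set (B j)))
  have hT : T.Finite := Set.finite_iUnion fun j => ((s j).finite_toSet.insert 1).image _
  have hmem : ∀ j (b : B j), Pi.single j b ∈ Algebra.adjoin ℂ T := by
    intro j b
    have hb : b ∈ Algebra.adjoin ℂ (s j : Set (B j)) := by rw [hs]; trivial
    induction hb using Algebra.adjoin_induction with
    | mem x hx =>
      exact Algebra.subset_adjoin (Set.mem_iUnion.mpr ⟨j, x, Set.mem_insert_of_mem _ hx, rfl⟩)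
    | algebraMap r =>
      rw [Algebra.algebraMap_eq_smul_one, Pi.single_smul]
      have h1 : Pi.single j 1 ∈ T := Set.mem_iUnion.mpr ⟨j, 1, Set.mem_insert _ _, rfl⟩
      exact Subalgebra.smul_mem _ (Algebra.subset_adjoin h1) r
    | add x y _ _ hx hy => rw [Pi.single_add]; exact add_mem hx hy
    | mul x y _ _ hx hy => rw [Pi.single_mul]; exact mul_mem hx hy
  refine (Subalgebra.fg_def.mpr ⟨T, hT, ?_⟩ : (⊤ : Subalgebra ℂ (∀ j, B j)).FG) |> Algebra.FiniteType.mk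
  rw [eq_top_iff]
  intro f _
  rw [← Finset.univ_sum_single f]
  exact sum_mem fun j _ => hmem j _

/-- The localization of `A` at a minimal prime is a field `κ`, over which `c i` becomes a scalar.
Clearing denominators gives `p i / q`. -/
theorem exists_fraction_of_isNilpotent {A B : Type*} [CommRing A] [CommRing B] [Algebra ℂ A]
    [Algebra A B] [FaithfulSMul A B] [Nontrivial B] [IsReduced B] {s : Type*} [Finite s]
    {c : s → B} (hc : ∀ i, IsNilpotent (c i ⊗ₜ[A] (1 : B) - 1 ⊗ₜ[A] c i)) :
    ∃ (q : A) (p : s → A), q ≠ 0 ∧ ∀ i, algebraMap A B q * c i = algebraMap A B (p i) := by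
  have hAB : Function.Injective (algebraMap A B) := FaithfulSMul.algebraMap_injective A B
  have : Nontrivial A := (algebraMap A B).domain_nontrivial
  have : IsReduced A := isReduced_of_injective (algebraMap A B) hAB
  obtain ⟨m, hm⟩ := Ideal.exists_maximal A
  obtain ⟨p, hp, -⟩ := Ideal.exists_minimalPrimes_le (bot_le (a := m))
  have : p.IsPrime := hp.1.1
  let κ := Localization.AtPrime p
  have hred : _root_.IsReduced κ :=
    isReduced_localizationPreserves (R := A) p.primeCompl κ inferInstance
  have := Ring.KrullDimLE.of_isLocalization p hp κ
  have hfield : IsField κ := Ring.KrullDimLE.isField_of_isReduced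
  let _ : Field κ := hfield.toField
  let M := Algebra.algebraMapSubmonoid B p.primeCompl
  let S := Localization M
  let _ : Algebra κ S := localizationAlgebra p.primeCompl B
  have hSred : _root_.IsReduced S :=
    isReduced_localizationPreserves (R := B) M S inferInstance
  have hM0 : (0 : B) ∉ M := by
    rintro ⟨a, ha, ha0⟩
    exact ha (by rw [(map_eq_zero_iff _ hAB).mp ha0]; exact p.zero_mem)
  have hS : Nontrivial S := by
    refine ⟨⟨0, 1, fun h => hM0 ?_⟩⟩
    rw [← map_zero (algebraMap B S), ← map_one (algebraMap B S),
      IsLocalization.eq_iff_exists M S] at h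
    obtain ⟨m, hm⟩ := h
    have : (m : B) = 0 := by simpa using hm.symm
    exact this ▸ m.2
  have : CharZero κ := by
    exact charZero_of_injective_algebraMap (algebraMap ℂ κ).injective
  have htower : (algebraMap κ S).comp (algebraMap A κ) = (algebraMap B S).comp (algebraMap A B) :=
    IsLocalization.map_comp _
  have key (i : s) : ∃ v ∈ p.primeCompl, ∃ u : A, algebraMap A B v * c i = algebraMap A B u := by
    have hc' : IsNilpotent (algebraMap B S (c i) ⊗ₜ[κ] (1 : S) - 1 ⊗ₜ[κ] algebraMap B S (c i)) := by
      have := (hc i).map (Algebra.TensorProduct.mapRingHom (algebraMap A κ) (algebraMap B S)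
        (algebraMap B S) htower.symm htower.symm)
      simpa using this
    obtain ⟨l, hl⟩ := mem_range_algebraMap_of_isNilpotent hc'
    obtain ⟨⟨u, v⟩, huv⟩ := IsLocalization.surj p.primeCompl l
    have h1 : algebraMap B S (algebraMap A B v * c i) = algebraMap B S (algebraMap A B u) := by
      have e (x : A) : algebraMap B S (algebraMap A B x) = algebraMap κ S (algebraMap A κ x) :=
        (RingHom.congr_fun htower x).symm
      rw [map_mul, e, e, ← hl, ← map_mul, ← huv, mul_comm]
    obtain ⟨⟨_, w, hw, rfl⟩, hw'⟩ := (IsLocalization.eq_iff_exists M S).mp h1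
    refine ⟨w * v, p.primeCompl.mul_mem hw v.2, w * u, ?_⟩
    simp only at hw'
    rw [map_mul, map_mul, mul_assoc, hw']
  cases nonempty_fintype s
  classical
  choose v hv u hu using key
  refine ⟨∏ i, v i, fun i => (∏ j ∈ Finset.univ.erase i, v j) * u i, fun h => ?_, fun i => ?_⟩
  · exact (prod_mem (S := p.primeCompl) fun i _ => hv i) (by rw [h]; exact p.zero_mem)
  · rw [← Finset.prod_erase_mul _ _ (Finset.mem_univ i), map_mul, map_mul, mul_assoc, hu]

/-- A `ℂ`-point of a finite product of algebras is a `ℂ`-point of one of the factors. -/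
theorem exists_algHom_of_pi {J : Type*} [Finite J] {B : J → Type*} [∀ j, CommRing (B j)]
    [∀ j, Algebra ℂ (B j)] (χ : (∀ j, B j) →ₐ[ℂ] ℂ) :
    ∃ (j : J) (χ' : B j →ₐ[ℂ] ℂ), ∀ f, χ f = χ' (f j) := by
  classical
  cases nonempty_fintype J
  have h1 : ∑ j, χ (Pi.single j 1) = 1 := by
    rw [← map_sum, Finset.univ_sum_single (fun j => (1 : B j))]; exact map_one χ
  obtain ⟨j, -, hj⟩ := Finset.exists_ne_zero_of_sum_ne_zero (h1.trans_ne one_ne_zero)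
  have hj1 : χ (Pi.single j 1) = 1 := by
    have : χ (Pi.single j 1) * χ (Pi.single j 1) = χ (Pi.single j 1) := by
      rw [← map_mul, ← Pi.single_mul, one_mul]
    exact mul_right_cancel₀ hj (by rw [this, one_mul])
  refine ⟨j, AlgHom.ofLinearMap (χ.toLinearMap ∘ₗ LinearMap.single ℂ B j) hj1 fun x y => ?_,
    fun f => ?_⟩
  · exact (congrArg χ (Pi.single_mul j x y)).trans (map_mul χ _ _)
  · have : Pi.single j (f j) = f * Pi.single j 1 := by
      ext i
      by_cases h : i = j
      · subst h; simp
      · simp [h]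
    exact (((congrArg χ this).trans (map_mul χ _ _)).trans (by rw [hj1, mul_one])).symm

/-- A regular function on a reduced variety that is constant on the fibres of a morphism becomes a
pullback after multiplication by a nonzero pullback. -/
theorem exists_fraction_of_reduced {A R : Type*} [CommRing A] [Algebra ℂ A] [CommRing R]
    [Algebra ℂ R] [Algebra.FiniteType ℂ R] [_root_.IsReduced R] [Nontrivial R] (f : A →ₐ[ℂ] R)
    {s : Type*} [Finite s] (c : s → R)
    (h : ∀ i (χ χ' : R →ₐ[ℂ] ℂ), (∀ a, χ (f a) = χ' (f a)) → χ (c i) = χ' (c i)) :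
    ∃ (q : A) (p : s → A), f q ≠ 0 ∧ ∀ i, f q * c i = f (p i) := by
  -- a `ℂ`-point of `R ⊗ R` over the image of `A` is a pair of points in the same fibre
  have hnil (i : s) : IsNilpotent (c i ⊗ₜ[f.range] (1 : R) - (1 : R) ⊗ₜ[f.range] c i) := by
    have : Algebra.FiniteType f.range R :=
      Algebra.FiniteType.of_restrictScalars_finiteType ℂ f.range R
    have : Algebra.FiniteType ℂ (R ⊗[f.range] R) := Algebra.FiniteType.trans
      (S := R) inferInstance inferInstance
    apply isNilpotent_of_forall_algHom
    intro ψ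
    have e := h i (ψ.comp Algebra.TensorProduct.includeLeft)
      (ψ.comp (Algebra.TensorProduct.includeRight.restrictScalars ℂ)) fun a => by
        have : (f a) ⊗ₜ[f.range] (1 : R) = 1 ⊗ₜ[f.range] (f a) := by
          have h1 : f a = (⟨f a, a, rfl⟩ : f.range) • (1 : R) := by
            rw [Algebra.smul_def, mul_one]; rfl
          rw [h1, TensorProduct.smul_tmul]
        exact congrArg ψ this
    rw [map_sub, sub_eq_zero]
    exact e
  obtain ⟨⟨_, q, rfl⟩, p, hq, hqp⟩ := exists_fraction_of_isNilpotent hnil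
  choose p' hp' using fun i => (p i).2
  exact ⟨q, p', fun h0 => hq (Subtype.ext h0), fun i => (hqp i).trans (hp' i).symm⟩

/-- A function on a variety, given by functions `c j` on finitely many affine pieces, that is
constant on the fibres of a morphism `φ` is generically the pullback of a rational function.
By the Nullstellensatz `c ⊗ 1 - 1 ⊗ c` is nilpotent on the fibre product. -/
theorem exists_fraction_of_constant_on_fibers {A : Type*} [CommRing A] [Algebra ℂ A] {J : Type*}
    [Finite J] {B : J → Type*} [∀ j, CommRing (B j)] [∀ j, Algebra ℂ (B j)]
    [∀ j, Algebra.FiniteType ℂ (B j)] (φ : ∀ j, A →ₐ[ℂ] B j) {s : Type*} [Finite s]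
    (c : s → ∀ j, B j) (hne : ∃ j, Nontrivial (B j))
    (h : ∀ i j j' (χ : B j →ₐ[ℂ] ℂ) (χ' : B j' →ₐ[ℂ] ℂ), (∀ a, χ (φ j a) = χ' (φ j' a)) →
      χ (c i j) = χ' (c i j')) :
    ∃ (q : A) (p : s → A), (∀ i j, IsNilpotent (φ j q * c i j - φ j (p i))) ∧
      ∃ j, ¬ IsNilpotent (φ j q) := by
  classical
  -- the coordinate ring of the disjoint union of the pieces, made reduced
  let N := nilradical (∀ j, B j)
  let R := (∀ j, B j) ⧸ N
  have hft := finiteType_pi B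
  have : Algebra.FiniteType ℂ R := Algebra.FiniteType.of_surjective (Ideal.Quotient.mkₐ ℂ N)
    (Ideal.Quotient.mkₐ_surjective ℂ N)
  have : Nontrivial R := by
    obtain ⟨j, hj⟩ := hne
    apply Ideal.Quotient.nontrivial_iff.mpr
    intro h1
    have : (1 : ∀ j, B j) ∈ N := by rw [h1]; trivial
    obtain ⟨n, hn⟩ := this
    have := congrFun hn j
    simp at this
  have : _root_.IsReduced R := (Ideal.isRadical_iff_quotient_reduced N).mp (Ideal.radical_isRadical _)
  let f : A →ₐ[ℂ] R := (Ideal.Quotient.mkₐ ℂ N).comp (AlgHom.pi φ)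
  obtain ⟨q, p, hq, hqp⟩ := exists_fraction_of_reduced f
    (fun i => Ideal.Quotient.mkₐ ℂ N (c i)) fun i χ₁ χ₂ hχ => by
      obtain ⟨j, χ, hχ₁⟩ := exists_algHom_of_pi (χ₁.comp (Ideal.Quotient.mkₐ ℂ N))
      obtain ⟨j', χ', hχ₂⟩ := exists_algHom_of_pi (χ₂.comp (Ideal.Quotient.mkₐ ℂ N))
      refine ((hχ₁ _).trans (h i j j' χ χ' fun a => ?_)).trans (hχ₂ _).symm
      exact ((hχ₁ fun j => φ j a).symm.trans (hχ a)).trans (hχ₂ fun j => φ j a)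
  have hN (x : ∀ j, B j) : Ideal.Quotient.mkₐ ℂ N x = 0 ↔ IsNilpotent x := by
    rw [← mem_nilradical]; exact Ideal.Quotient.eq_zero_iff_mem
  refine ⟨q, p, fun i j => ?_, ?_⟩
  · have h1 : Ideal.Quotient.mkₐ ℂ N ((fun j => φ j q) * c i - fun j => φ j (p i)) = 0 := by
      rw [map_sub, map_mul, sub_eq_zero]
      exact hqp i
    exact ((hN _).mp h1).map (Pi.evalRingHom B j)
  · by_contra! hall
    apply hq
    refine (hN _).mpr ?_
    cases nonempty_fintype J
    choose n hn using hall
    refine ⟨∑ j, n j, funext fun j => ?_⟩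
    exact pow_eq_zero_of_le (Finset.single_le_sum (fun _ _ => Nat.zero_le _) (Finset.mem_univ j))
      (hn j)

/-! ### Descent for semilinear actions -/

section Descent

variable {K M Γ : Type*} [Field K] [AddCommGroup M] [Module K M]

/-- The functions `Γ → M` spanned by the functions `g ↦ τ g h • x`. For an action of `Γ` on `K`
this is the image of `K ⊗ M`. -/
def orbitSpan (τ : Γ → K →+* K) (M : Type*) [AddCommGroup M] [Module K M] : Submodule K (Γ → M) :=
  Submodule.span K (Set.range fun y : K × M => fun g => τ g y.1 • y.2)

theorem mem_orbitSpan_iff {τ : Γ → K →+* K} {F : Γ → M} :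
    F ∈ orbitSpan τ M ↔ ∃ (n : ℕ) (h : Fin n → K) (x : Fin n → M), ∀ g,
      F g = ∑ i, τ g (h i) • x i := by
  constructor
  · intro hF
    induction hF using Submodule.span_induction with
    | mem F hF =>
      obtain ⟨y, rfl⟩ := hF
      exact ⟨1, fun _ => y.1, fun _ => y.2, fun g => by simp⟩
    | zero => exact ⟨0, Fin.elim0, Fin.elim0, fun g => by simp⟩
    | add F F' _ _ hF hF' =>
      obtain ⟨n, h, x, hx⟩ := hF
      obtain ⟨n', h', x', hx'⟩ := hF'
      refine ⟨n + n', Fin.append h h', Fin.append x x', fun g => ?_⟩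
      simp [Fin.sum_univ_add, hx, hx']
    | smul k F _ hF =>
      obtain ⟨n, h, x, hx⟩ := hF
      refine ⟨n, h, fun i => k • x i, fun g => ?_⟩
      simp [hx, Finset.smul_sum, smul_comm k]
  · rintro ⟨n, h, x, hx⟩
    have : F = ∑ i, fun g => τ g (h i) • x i := by
      ext g; simp [hx]
    rw [this]
    exact sum_mem fun i _ => Submodule.subset_span ⟨(h i, x i), rfl⟩

theorem orbitSpan_apply_mul_mem {τ : Γ → K →+* K} {F : Γ → M} (hF : F ∈ orbitSpan τ M) (k : K) :
    (fun g => τ g k • F g) ∈ orbitSpan τ M := by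
  rw [mem_orbitSpan_iff] at hF ⊢
  obtain ⟨n, h, x, hx⟩ := hF
  exact ⟨n, fun i => k * h i, x, fun g => by simp [hx, Finset.smul_sum, mul_smul]⟩

/-- In an expression `act g m = ∑ i, τ g (h i) • x i` of minimal length the vectors `x i` are
invariant: applying `u` to the expression at `g * u⁻¹` yields one with `act u (x i)` instead of `x i`, and the
functions `g ↦ τ g (h i)` are linearly independent. -/
theorem mem_span_invariants_of_orbit [Group Γ] {τ : Γ → K →+* K} {act : Γ → M →+ M}
    (hτ : ∀ g h x, τ (g * h) x = τ h (τ g x))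
    (ha1 : ∀ m, act 1 m = m) (ha : ∀ g h m, act (g * h) m = act h (act g m))
    (has : ∀ g k m, act g (k • m) = τ g k • act g m)
    {m : M} (n : ℕ) (h : Fin n → K) (x : Fin n → M)
    (H : ∀ g, act g m = ∑ i, τ g (h i) • x i) :
    m ∈ Submodule.span K {x | ∀ u, act u x = x} := by
  induction n with
  | zero =>
    have := H 1
    rw [ha1] at this
    simp [this]
  | succ n ih =>
    by_cases hJ : ∃ y : Fin (n + 1) → K, y ≠ 0 ∧ ∀ g, ∑ i, τ g (h i) * y i = 0
    · -- a linear relation between the functions `g ↦ τ g (h i)` shortens the expression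
      obtain ⟨y, hy, hy0⟩ := hJ
      obtain ⟨j, hj⟩ := Function.ne_iff.mp hy
      rw [Pi.zero_apply] at hj
      refine ih (fun i => h (j.succAbove i))
        (fun i => x (j.succAbove i) - (y (j.succAbove i) / y j) • x j) fun g => ?_
      have e := hy0 g
      rw [Fin.sum_univ_succAbove _ j] at e
      have e' : τ g (h j) = - ∑ i, τ g (h (j.succAbove i)) * (y (j.succAbove i) / y j) := by
        rw [← mul_left_inj' hj, eq_neg_of_add_eq_zero_left e, neg_mul, Finset.sum_mul]
        congr 1
        exact Finset.sum_congr rfl fun i _ => by field_simp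
      rw [H, Fin.sum_univ_succAbove _ j, e', neg_smul, Finset.sum_smul]
      simp only [smul_sub, Finset.sum_sub_distrib, mul_smul]
      abel
    · push Not at hJ
      have hinv (u : Γ) (i) : act u (x i) = x i := by
        rw [eq_comm, ← sub_eq_zero]
        apply (Module.forall_dual_apply_eq_zero_iff K _).mp
        intro φ
        by_contra hne
        obtain ⟨g, hg⟩ := hJ (fun i => φ (x i - act u (x i))) (Function.ne_iff.mpr ⟨i, hne⟩)
        apply hg
        have h1 := H g
        have h2 : act g m = act u (act (g * u⁻¹) m) := by rw [← ha, inv_mul_cancel_right]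
        rw [H (g * u⁻¹), map_sum] at h2
        simp only [has, ← hτ, inv_mul_cancel_right] at h2
        rw [h1] at h2
        simp only [map_sub, mul_sub, Finset.sum_sub_distrib, sub_eq_zero]
        simpa using congrArg φ h2
      have := H 1
      rw [ha1] at this
      rw [this]
      exact sum_mem fun i _ => Submodule.smul_mem _ _ (Submodule.subset_span fun u => hinv u i)

/-- Denominators can be removed: the functions `q` in the image of `K ⊗ K` for which `q g • act g m`
lies in the image of `K ⊗ M` form a subspace stable under translation, and a translation-invariant
one is of the form `g ↦ τ g h`. -/
theorem mem_span_invariants [Group Γ] {τ : Γ → K →+* K} {act : Γ → M →+ M}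
    (hτ : ∀ g h x, τ (g * h) x = τ h (τ g x))
    (ha1 : ∀ m, act 1 m = m) (ha : ∀ g h m, act (g * h) m = act h (act g m))
    (has : ∀ g k m, act g (k • m) = τ g k • act g m)
    {m : M} {q : Γ → K} (hq : q ∈ orbitSpan τ K) (hq0 : q ≠ 0)
    (H : (fun g => q g • act g m) ∈ orbitSpan τ M) :
    m ∈ Submodule.span K {x | ∀ u, act u x = x} := by
  -- the translation by `u` of functions `Γ → M`
  have htwist (u : Γ) {F : Γ → M} (hF : F ∈ orbitSpan τ M) :
      (fun g => act u (F (g * u⁻¹))) ∈ orbitSpan τ M := by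
    rw [mem_orbitSpan_iff] at hF ⊢
    obtain ⟨n, h, x, hx⟩ := hF
    exact ⟨n, h, fun i => act u (x i), fun g => by
      simp [hx, has, ← hτ, inv_mul_cancel_right]⟩
  -- induction on the number of terms of `q`; after normalizing the first coefficient to `1`, the
  -- difference of `q` and a translate has fewer terms
  have main : ∀ (n : ℕ) (f h : Fin n → K) (q : Γ → K), (∀ g, q g = ∑ i, τ g (h i) * f i) → q ≠ 0 →
      (fun g => q g • act g m) ∈ orbitSpan τ M →
      ∃ k : K, k ≠ 0 ∧ (fun g => τ g k • act g m) ∈ orbitSpan τ M := by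
    intro n
    induction n with
    | zero =>
      intro f h q hq hq0
      exact absurd (funext fun g => by simp [hq]) hq0
    | succ n ih =>
      intro f h q hq hq0 H
      by_cases hf : f 0 = 0
      · refine ih (fun i => f i.succ) (fun i => h i.succ) q (fun g => ?_) hq0 H
        rw [hq, Fin.sum_univ_succ, hf, mul_zero, zero_add]
      let q' : Γ → K := (f 0)⁻¹ • q
      have hq' (g : Γ) : q' g = τ g (h 0) + ∑ i : Fin n, τ g (h i.succ) * (f i.succ / f 0) := by
        simp only [q', Pi.smul_apply, smul_eq_mul, hq, Fin.sum_univ_succ, mul_add, Finset.mul_sum]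
        congr 1
        · field_simp
        · exact Finset.sum_congr rfl fun i _ => by field_simp
      have hq'0 : q' ≠ 0 := smul_ne_zero (inv_ne_zero hf) hq0
      have H' : (fun g => q' g • act g m) ∈ orbitSpan τ M := by
        have := Submodule.smul_mem _ (f 0)⁻¹ H
        convert this using 1
        ext g
        simp [q', mul_smul]
      by_cases hinv : ∀ u g, τ u (q' (g * u⁻¹)) = q' g
      · have e (g : Γ) : q' g = τ g (q' 1) := by
          rw [← hinv g g, mul_inv_cancel]
        refine ⟨q' 1, fun h0 => hq'0 (funext fun g => ?_), ?_⟩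
        · rw [e, h0, map_zero]; rfl
        · simpa only [← e] using H'
      · push Not at hinv
        obtain ⟨u, g₀, hg₀⟩ := hinv
        refine ih (fun i => τ u (f i.succ / f 0) - f i.succ / f 0) (fun i => h i.succ)
          (fun g => τ u (q' (g * u⁻¹)) - q' g) (fun g => ?_)
          (Function.ne_iff.mpr ⟨g₀, sub_ne_zero.mpr hg₀⟩) ?_
        · simp only [hq', map_add, map_sum, map_mul, ← hτ, inv_mul_cancel_right, mul_sub,
            Finset.sum_sub_distrib]
          ring
        · have := sub_mem (htwist u H') H'
          convert this using 1
          ext g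
          simp [has, ← ha, sub_smul]
  obtain ⟨n, h, f, hq⟩ := mem_orbitSpan_iff.mp hq
  obtain ⟨k, hk, hk'⟩ := main n f h q (by simpa using hq) hq0 H
  obtain ⟨n, h, x, hx⟩ := mem_orbitSpan_iff.mp (orbitSpan_apply_mul_mem hk' k⁻¹)
  refine mem_span_invariants_of_orbit hτ ha1 ha has n h x fun g => ?_
  rw [← hx g, smul_smul, ← map_mul, inv_mul_cancel₀ hk, map_one, one_smul]

end Descent

/-- A cocycle `c` of `Γ` with values in `GL_ι(K)` whose entries become elements of the image of
`K ⊗ K` after multiplication by one such function `q ≠ 0` is a coboundary. -/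
theorem exists_coboundary {K Γ ι : Type*} [Field K] [Group Γ] [Fintype ι] [DecidableEq ι]
    {τ : Γ → K →+* K} (hτ1 : ∀ x, τ 1 x = x) (hτ : ∀ g h x, τ (g * h) x = τ h (τ g x))
    {c : Γ → Matrix ι ι K} (hc1 : c 1 = 1) (hc : ∀ g h, c (g * h) = (c g).map (τ h) * c h)
    {q : Γ → K} (hq : q ∈ orbitSpan τ K) (hq0 : q ≠ 0)
    (H : ∀ i j, (fun g => q g * c g i j) ∈ orbitSpan τ K) :
    ∃ T : Matrix ι ι K, IsUnit T.det ∧ ∀ g, T.map (τ g) * c g = T := by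
  -- vectors `v` with `τ g v * c g = v` are the invariants of a semilinear action on row vectors
  let act (g : Γ) : (ι → K) →+ (ι → K) :=
    { toFun := fun v => Matrix.vecMul (fun i => τ g (v i)) (c g)
      map_zero' := by
        ext; simp [Matrix.vecMul, dotProduct]
      map_add' := fun v w => by
        ext; simp [Matrix.vecMul, dotProduct, add_mul, Finset.sum_add_distrib] }
  have hact (g v) : act g v = Matrix.vecMul (fun i => τ g (v i)) (c g) := rfl
  have ha1 (v) : act 1 v = v := by
    simp [hact, hτ1, hc1]
  have ha (g h v) : act (g * h) v = act h (act g v) := by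
    simp only [hact, hc, ← Matrix.vecMul_vecMul, hτ]
    congr 1
    ext i
    simp [Matrix.vecMul, dotProduct]
  have has (g k v) : act g (k • v) = τ g k • act g v := by
    ext i
    simp [hact, Matrix.vecMul, dotProduct, Finset.mul_sum, mul_assoc]
  have hspan : Submodule.span K {x | ∀ u, act u x = x} = ⊤ := by
    rw [eq_top_iff, ← (Pi.basisFun K ι).span_eq, Submodule.span_le]
    rintro _ ⟨i, rfl⟩
    refine mem_span_invariants hτ ha1 ha has hq hq0 ?_
    have : (fun g => q g • act g (Pi.basisFun K ι i)) =
        ∑ j, fun g => (q g * c g i j) • (Pi.single j 1 : ι → K) := by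
      ext g j
      have : (fun k => τ g ((Pi.basisFun K ι i) k)) = Pi.single i 1 := by
        ext k
        simp only [Pi.basisFun_apply, Pi.single_apply]
        split_ifs <;> simp
      have h2 : act g (Pi.basisFun K ι i) j = c g i j := by rw [hact, this]; simp
      simp [Pi.single_apply, ← h2]
    rw [this]
    refine sum_mem fun j _ => ?_
    obtain ⟨n, h, f, hf⟩ := mem_orbitSpan_iff.mp (H i j)
    refine mem_orbitSpan_iff.mpr ⟨n, h, fun l => f l • Pi.single j 1, fun g => ?_⟩
    rw [hf, Finset.sum_smul]
    simp [mul_smul]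
  -- the rows of `T` are an invariant basis
  let b := Module.Basis.ofSpan hspan.ge
  let e := b.indexEquiv (Pi.basisFun K ι)
  let b' := b.reindex e
  have hb' (u i) : act u (b' i) = b' i := by
    have : b' i ∈ Set.range b := ⟨e.symm i, by simp [b']⟩
    exact Module.Basis.ofSpan_subset hspan.ge this u
  refine ⟨Matrix.of fun i => b' i, ?_, fun g => ?_⟩
  · have h1 := (Pi.basisFun K ι).isUnit_det b'
    rw [Module.Basis.det_apply, ← Matrix.det_transpose] at h1
    exact h1
  · ext i j
    have := congrFun (hb' g i) j
    rw [hact] at this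
    simpa [Matrix.mul_apply, Matrix.vecMul, dotProduct] using this

/-! ### Invariant vectors -/

/-- A nonzero subspace of `I →₀ K` that is stable under endomorphisms of the field `K` contains a
nonzero vector with invariant entries: normalize a vector of minimal support. -/
theorem exists_invariant_vector {K I Γ : Type*} [Field K] (τ : Γ → K →+* K)
    (J : Submodule K (I →₀ K)) (hJ : ∀ u, ∀ x ∈ J, x.mapRange (τ u) (map_zero _) ∈ J)
    (hJ0 : J ≠ ⊥) : ∃ x ∈ J, x ≠ 0 ∧ ∀ u i, τ u (x i) = x i := by
  have hex : ∃ n, ∃ x ∈ J, x ≠ 0 ∧ x.support.card = n := by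
    obtain ⟨x, hx, hx0⟩ := Submodule.exists_mem_ne_zero_of_ne_bot hJ0
    exact ⟨_, x, hx, hx0, rfl⟩
  classical
  obtain ⟨x, hx, hx0, hn⟩ := Nat.find_spec hex
  obtain ⟨i₀, hi₀⟩ := Finsupp.support_nonempty_iff.mpr hx0
  have hi₀' : x i₀ ≠ 0 := Finsupp.mem_support_iff.mp hi₀
  let y := (x i₀)⁻¹ • x
  have hy : y ∈ J := J.smul_mem _ hx
  have hysupp : y.support = x.support := Finsupp.support_smul_eq (inv_ne_zero hi₀')
  have hyi₀ : y i₀ = 1 := by simp [y, hi₀']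
  refine ⟨y, hy, smul_ne_zero (inv_ne_zero hi₀') hx0, fun u i => ?_⟩
  have hz : y.mapRange (τ u) (map_zero _) - y = 0 := by
    by_contra hz
    refine Nat.find_min hex ?_ ⟨_, J.sub_mem (hJ u y hy) hy, hz, rfl⟩
    rw [← hn]
    apply Finset.card_lt_card
    refine (Finset.ssubset_iff_of_subset fun i hi => ?_).mpr ⟨i₀, hi₀, ?_⟩
    · rw [← hysupp, Finsupp.mem_support_iff]
      intro h0
      simp [h0] at hi
    · simp [hyi₀]
  simpa [sub_eq_zero] using DFunLike.congr_fun hz i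

/-! ### Rational functions of a point and its translate -/

section OrbitFraction

variable {ι Γ s J : Type*} {O : J → Type*} {K : Type*} [Field K] [Algebra ℂ K]

theorem aeval_mem_orbitSpan {σ : Type*} (τ : Γ → K →ₐ[ℂ] K) (x : ι → K)
    (a : MvPolynomial (ι ⊕ σ) ℂ) (y : σ → K) :
    (fun g => MvPolynomial.aeval (Sum.elim x fun i => τ g (y i)) a) ∈
      orbitSpan (fun g => (τ g : K →+* K)) K := by
  induction a using MvPolynomial.induction_on with
  | C r =>
    have : (fun g => MvPolynomial.aeval (Sum.elim x fun i => τ g (y i)) (MvPolynomial.C r)) =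
        fun g => (fun g => (τ g : K →+* K)) g 1 • algebraMap ℂ K r := by
      ext g; simp
    rw [this]
    exact Submodule.subset_span ⟨(1, algebraMap ℂ K r), rfl⟩
  | add p q hp hq =>
    have := add_mem hp hq
    convert this using 1
    ext g; simp
  | mul_X p i hp =>
    rcases i with i | i
    · have := Submodule.smul_mem _ (x i) hp
      convert this using 1
      ext g; simp [mul_comm]
    · have := orbitSpan_apply_mul_mem hp (y i)
      convert this using 1
      ext g; simp [mul_comm]

variable [Algebra (MvPolynomial ι ℂ) K] [IsFractionRing (MvPolynomial ι ℂ) K]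
  [IsScalarTower ℂ (MvPolynomial ι ℂ) K] [∀ j, CommRing (O j)] [∀ j, Algebra ℂ (O j)]
  [Finite ι] [Finite s] [Finite J] [∀ j, Algebra.FiniteType ℂ (O j)]

/-- Let `Γ` act on affine space with coordinates `ι` by rational maps `P / D` whose coefficients
are regular functions on finitely many affine pieces covering `Γ`. If the functions `C / D` on
`Γ × 𝔸` depend only on the pair formed by a general point and its translate, then they
become elements of the image of `K ⊗ K` after multiplication with one such element `q ≠ 0`. -/
theorem exists_mem_orbitSpan [Nonempty Γ] (τ : Γ → K →ₐ[ℂ] K) (π : ∀ j, (O j →ₐ[ℂ] ℂ) → Γ)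
    (P : ∀ j, ι → MvPolynomial ι (O j)) (D : ∀ j, MvPolynomial ι (O j))
    (C : s → ∀ j, MvPolynomial ι (O j)) {d : MvPolynomial ι ℂ} (hd : d ≠ 0) (c : s → Γ → K)
    (hP : ∀ j (y : O j →ₐ[ℂ] ℂ), MvPolynomial.map (y : O j →+* ℂ) (D j) ≠ 0 → ∀ i,
      τ (π j y) (algebraMap (MvPolynomial ι ℂ) K (.X i)) *
        algebraMap (MvPolynomial ι ℂ) K (.map (y : O j →+* ℂ) (D j)) =
          algebraMap (MvPolynomial ι ℂ) K (.map (y : O j →+* ℂ) (P j i)))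
    (hC : ∀ j (y : O j →ₐ[ℂ] ℂ), MvPolynomial.map (y : O j →+* ℂ) (D j) ≠ 0 → ∀ i,
      c i (π j y) * algebraMap (MvPolynomial ι ℂ) K (.map (y : O j →+* ℂ) (D j)) =
          algebraMap (MvPolynomial ι ℂ) K (.map (y : O j →+* ℂ) (C i j)))
    (hcov : ∀ g, ∃ (j : J) (y : O j →ₐ[ℂ] ℂ), π j y = g ∧
      MvPolynomial.map (y : O j →+* ℂ) (D j) ≠ 0)
    (hfib : ∀ j j' (y : O j →ₐ[ℂ] ℂ) (y' : O j' →ₐ[ℂ] ℂ) (z : ι → ℂ), MvPolynomial.eval z d ≠ 0 →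
      MvPolynomial.eval₂ (y : O j →+* ℂ) z (D j) ≠ 0 →
      MvPolynomial.eval₂ (y' : O j' →+* ℂ) z (D j') ≠ 0 →
      (∀ k, MvPolynomial.eval₂ (y : O j →+* ℂ) z (P j k) / MvPolynomial.eval₂ (y : O j →+* ℂ) z (D j)
        = MvPolynomial.eval₂ (y' : O j' →+* ℂ) z (P j' k) /
          MvPolynomial.eval₂ (y' : O j' →+* ℂ) z (D j')) →
      ∀ i, MvPolynomial.eval₂ (y : O j →+* ℂ) z (C i j) / MvPolynomial.eval₂ (y : O j →+* ℂ) z (D j)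
        = MvPolynomial.eval₂ (y' : O j' →+* ℂ) z (C i j') /
          MvPolynomial.eval₂ (y' : O j' →+* ℂ) z (D j')) :
    ∃ q ∈ orbitSpan (fun g => (τ g : K →+* K)) K, q ≠ 0 ∧
      ∀ i, (fun g => q g * c i g) ∈ orbitSpan (fun g => (τ g : K →+* K)) K := by
  let dO (j : J) : MvPolynomial ι (O j) := MvPolynomial.map (algebraMap ℂ (O j)) d
  -- the open subset of `Spec O j × 𝔸` where neither `D j` nor `d` vanishes
  let B (j : J) := Localization.Away (D j * dO j)
  have hft (j : J) : Algebra.FiniteType ℂ (B j) := by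
    have h1 : Algebra.FiniteType (MvPolynomial ι (O j)) (B j) :=
      IsLocalization.finiteType_of_monoid_fg (Submonoid.powers (D j * dO j)) (B j)
    have h2 : Algebra.FiniteType (O j) (MvPolynomial ι (O j)) := inferInstance
    have h3 : Algebra.FiniteType ℂ (MvPolynomial ι (O j)) := Algebra.FiniteType.trans
      (S := O j) inferInstance h2
    exact Algebra.FiniteType.trans h3 h1
  let am (j : J) : MvPolynomial ι (O j) →ₐ[ℂ] B j :=
    (Algebra.ofId (MvPolynomial ι (O j)) (B j)).restrictScalars ℂ
  let invD (j : J) : B j := am j (dO j) * IsLocalization.Away.invSelf (D j * dO j)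
  have hinvD (j : J) : am j (D j) * invD j = 1 := by
    rw [← mul_assoc, ← map_mul]
    exact IsLocalization.Away.mul_invSelf _
  let A := MvPolynomial (ι ⊕ ι) ℂ
  -- the morphism which sends a group element and a point to the pair of the point and its translate
  let φ (j : J) : A →ₐ[ℂ] B j := MvPolynomial.aeval
    (Sum.elim (fun i => am j (.X i)) fun i => am j (P j i) * invD j)
  have hφl (j : J) (i : ι) : φ j (.X (.inl i)) = am j (.X i) := MvPolynomial.aeval_X _ _
  have hφr (j : J) (i : ι) : φ j (.X (.inr i)) = am j (P j i) * invD j := MvPolynomial.aeval_X _ _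
  let cB (i : s) (j : J) : B j := am j (C i j) * invD j
  let x (i : ι) : K := algebraMap (MvPolynomial ι ℂ) K (.X i)
  have hmapd (j : J) (y : O j →ₐ[ℂ] ℂ) : MvPolynomial.map (y : O j →+* ℂ) (dO j) = d := by
    have : (y : O j →+* ℂ).comp (algebraMap ℂ (O j)) = RingHom.id ℂ := by ext r; simp
    simp only [dO, MvPolynomial.map_map, this, MvPolynomial.map_id]
  -- specialization of `B j` to `K` at a point `y`
  have hε (j : J) (y : O j →ₐ[ℂ] ℂ) (hy : MvPolynomial.map (y : O j →+* ℂ) (D j) ≠ 0) :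
      ∃ ε : B j →ₐ[ℂ] K, ∀ p, ε (am j p) =
        algebraMap (MvPolynomial ι ℂ) K (.map (y : O j →+* ℂ) p) := by
    let f : MvPolynomial ι (O j) →ₐ[ℂ] K :=
      ((Algebra.ofId (MvPolynomial ι ℂ) K).restrictScalars ℂ).comp (MvPolynomial.mapAlgHom y)
    have hf (p) : f p = algebraMap (MvPolynomial ι ℂ) K (.map (y : O j →+* ℂ) p) := rfl
    refine ⟨IsLocalization.liftAlgHom (M := Submonoid.powers (D j * dO j)) (f := f) ?_, fun p => ?_⟩
    · rintro ⟨_, n, rfl⟩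
      simp only [map_pow, hf, map_mul, hmapd]
      apply IsUnit.pow
      rw [isUnit_iff_ne_zero, ← map_mul]
      exact (map_ne_zero_iff _ (IsFractionRing.injective _ _)).mpr (mul_ne_zero hy hd)
    · exact IsLocalization.lift_eq _ p
  choose ε hε using hε
  have hεinv (j y hy) : ε j y hy (invD j) =
      (algebraMap (MvPolynomial ι ℂ) K (.map (y : O j →+* ℂ) (D j)))⁻¹ := by
    apply eq_inv_of_mul_eq_one_right
    rw [← hε j y hy, ← map_mul, hinvD, map_one]
  have hDK (j) (y : O j →ₐ[ℂ] ℂ) (hy : MvPolynomial.map (y : O j →+* ℂ) (D j) ≠ 0) :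
      algebraMap (MvPolynomial ι ℂ) K (.map (y : O j →+* ℂ) (D j)) ≠ 0 :=
    (map_ne_zero_iff _ (IsFractionRing.injective _ _)).mpr hy
  have hεφ (j y hy) (a : A) : ε j y hy (φ j a) =
      MvPolynomial.aeval (Sum.elim x fun i => τ (π j y) (x i)) a := by
    have : (ε j y hy).comp (φ j) = MvPolynomial.aeval (Sum.elim x fun i => τ (π j y) (x i)) := by
      apply MvPolynomial.algHom_ext
      rintro (i | i)
      · simp [φ, hε, x]
      · simp only [φ, AlgHom.comp_apply, MvPolynomial.aeval_X, Sum.elim_inr, map_mul, hε, hεinv, x]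
        rw [← hP j y hy, mul_inv_cancel_right₀ (hDK j y hy)]
    exact DFunLike.congr_fun this a
  have hεc (j y hy) (i : s) : ε j y hy (cB i j) = c i (π j y) := by
    simp only [cB, map_mul, hε, hεinv]
    rw [← hC j y hy, mul_inv_cancel_right₀ (hDK j y hy)]
  have hunit (j : J) (χ : B j →ₐ[ℂ] ℂ) : χ (am j (D j * dO j)) ≠ 0 :=
    ((IsLocalization.Away.algebraMap_isUnit (D j * dO j)).map χ).ne_zero
  -- `ℂ`-points of `B j`
  have hpt (j : J) (χ : B j →ₐ[ℂ] ℂ) : ∃ (y : O j →ₐ[ℂ] ℂ) (z : ι → ℂ),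
      ∀ p, χ (am j p) = MvPolynomial.eval₂ (y : O j →+* ℂ) z p := by
    refine ⟨(χ.comp (am j)).comp ((Algebra.ofId (O j) (MvPolynomial ι (O j))).restrictScalars ℂ),
      fun i => χ (am j (.X i)), fun p => ?_⟩
    induction p using MvPolynomial.induction_on with
    | C r => simp [Algebra.ofId_apply]
    | add p q hp hq => simp [hp, hq]
    | mul_X p i hp => simp [hp]
  have hevd (j : J) (y : O j →ₐ[ℂ] ℂ) (z : ι → ℂ) (p) :
      MvPolynomial.eval₂ (y : O j →+* ℂ) z p =
        MvPolynomial.eval z (MvPolynomial.map (y : O j →+* ℂ) p) := by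
    rw [MvPolynomial.eval_map]
  obtain ⟨q, p, hqp, j₀, hq⟩ := exists_fraction_of_constant_on_fibers φ cB
    (by
      obtain ⟨j, y, -, hy⟩ := hcov (Classical.arbitrary Γ)
      exact ⟨j, (ε j y hy : B j →+* K).domain_nontrivial⟩)
    (by
      intro i j j' χ χ' hχ
      obtain ⟨y, z, hyz⟩ := hpt j χ
      obtain ⟨y', z', hyz'⟩ := hpt j' χ'
      have hzz : z = z' := by
        ext k
        have := hχ (.X (.inl k))
        simpa only [hφl, hyz, hyz', MvPolynomial.eval₂_X] using this
      subst hzz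
      have hu := hunit j χ
      have hu' := hunit j' χ'
      rw [hyz, MvPolynomial.eval₂_mul, hevd, hevd, hmapd] at hu
      rw [hyz', MvPolynomial.eval₂_mul, hevd, hevd, hmapd] at hu'
      have hD : χ (invD j) = (MvPolynomial.eval₂ (y : O j →+* ℂ) z (D j))⁻¹ := by
        apply eq_inv_of_mul_eq_one_right
        rw [← hyz, ← map_mul, hinvD, map_one]
      have hD' : χ' (invD j') = (MvPolynomial.eval₂ (y' : O j' →+* ℂ) z (D j'))⁻¹ := by
        apply eq_inv_of_mul_eq_one_right
        rw [← hyz', ← map_mul, hinvD, map_one]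
      simp only [cB, map_mul, hyz, hyz', hD, hD', ← div_eq_mul_inv]
      refine hfib j j' y y' z (right_ne_zero_of_mul hu) ?_ ?_ (fun k => ?_) i
      · rw [hevd]; exact left_ne_zero_of_mul hu
      · rw [hevd]; exact left_ne_zero_of_mul hu'
      · have := hχ (.X (.inr k))
        simpa only [hφr, map_mul, hyz, hyz', hD, hD', div_eq_mul_inv] using this)
  refine ⟨fun g => MvPolynomial.aeval (Sum.elim x fun i => τ g (x i)) q,
    aeval_mem_orbitSpan τ x q x, ?_, fun i => ?_⟩
  · obtain ⟨χ, hχ⟩ : ∃ χ : B j₀ →ₐ[ℂ] ℂ, χ (φ j₀ q) ≠ 0 := by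
      by_contra! hall
      exact hq (isNilpotent_of_forall_algHom hall)
    obtain ⟨y, z, hyz⟩ := hpt j₀ χ
    have hu := hunit j₀ χ
    rw [hyz, hevd, map_mul, map_mul] at hu
    have hy : MvPolynomial.map (y : O j₀ →+* ℂ) (D j₀) ≠ 0 := by
      intro h0
      simp [h0] at hu
    intro h0
    have h1 := congrFun h0 (π j₀ y)
    simp only [Pi.zero_apply] at h1
    rw [← hεφ j₀ y hy] at h1
    -- if `q` vanished at the generic point of the slice over `y`, it would vanish on the whole slice
    obtain ⟨⟨u, v⟩, huv⟩ := IsLocalization.surj (Submonoid.powers (D j₀ * dO j₀)) (φ j₀ q)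
    have h2 : MvPolynomial.map (y : O j₀ →+* ℂ) u = 0 := by
      apply IsFractionRing.injective (MvPolynomial ι ℂ) K
      rw [← hε j₀ y hy, map_zero]
      refine (congrArg (ε j₀ y hy) huv).symm.trans ?_
      rw [map_mul, h1, zero_mul]
    have h3 := congrArg χ huv
    rw [map_mul] at h3
    have h4 : χ (algebraMap _ (B j₀) u) = 0 := (hyz u).trans (by rw [hevd, h2, map_zero])
    rw [h4] at h3
    exact (mul_ne_zero hχ ((IsLocalization.map_units (B j₀) v).map χ).ne_zero) h3
  · have : (fun g => MvPolynomial.aeval (Sum.elim x fun i => τ g (x i)) q * c i g) =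
        fun g => MvPolynomial.aeval (Sum.elim x fun i => τ g (x i)) (p i) := by
      ext g
      obtain ⟨j, y, rfl, hy⟩ := hcov g
      have := (hqp i j).map (ε j y hy)
      rw [map_sub, map_mul, hεφ, hεφ, hεc] at this
      exact sub_eq_zero.mp this.eq_zero
    rw [this]
    exact aeval_mem_orbitSpan τ x (p i) x

end OrbitFraction

/-! ### Invariants of tensor products -/

section Invariants

variable {T K S Ω Γ : Type*} [Field K] [Algebra ℂ K] [CommRing S] [Algebra ℂ S] [CommRing Ω]
  [Algebra ℂ Ω]

/-- The inclusion of `(k ⊗ S)[T]` into `(K ⊗ S)[T]`. -/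
def inclPoly (T S : Type*) [CommRing S] [Algebra ℂ S] (k : Subalgebra ℂ K) :
    MvPolynomial T (k ⊗[ℂ] S) →ₐ[ℂ] MvPolynomial T (K ⊗[ℂ] S) :=
  MvPolynomial.mapAlgHom (Algebra.TensorProduct.map k.val (AlgHom.id ℂ S))

theorem inclPoly_injective (k : Subalgebra ℂ K) : Function.Injective (inclPoly T S k) :=
  MvPolynomial.map_injective _ (Module.Flat.rTensor_preserves_injective_linearMap (M := S)
    k.val.toLinearMap Subtype.val_injective)

/-- If `Ω` contains `(K ⊗ S)[T]` and automorphisms `w u` of `Ω` act on it through `K`, then an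
invariant fraction of elements of `(K ⊗ S)[T]` is a fraction of elements of `(k ⊗ S)[T]`, where `k`
contains the invariants of `K`: the denominators form a stable `K`-subspace, which contains an
invariant vector. -/
theorem exists_invariant_fraction (j : MvPolynomial T (K ⊗[ℂ] S) →ₐ[ℂ] Ω)
    (hj : Function.Injective j) (γ : Γ → K →ₐ[ℂ] K) (w : Γ → Ω →ₐ[ℂ] Ω)
    (hw : ∀ u p, w u (j p) =
      j (MvPolynomial.mapAlgHom (Algebra.TensorProduct.map (γ u) (AlgHom.id ℂ S)) p))
    {ω : Ω} (hω : ∀ u, w u ω = ω) {u₀ v₀ : MvPolynomial T (K ⊗[ℂ] S)} (hv₀ : v₀ ≠ 0)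
    (h₀ : ω * j v₀ = j u₀) (k : Subalgebra ℂ K) (hk : ∀ x, (∀ u, γ u x = x) → x ∈ k) :
    ∃ u v : MvPolynomial T (k ⊗[ℂ] S), v ≠ 0 ∧ ω * j (inclPoly T S k v) = j (inclPoly T S k u) := by
  -- a basis of `(K ⊗ S)[T]` over `K` on which the automorphisms `G u` act through the coordinates
  let e := Module.Basis.ofVectorSpace ℂ S
  let b := (Algebra.TensorProduct.basis K e).smulTower
    (MvPolynomial.basisMonomials T (K ⊗[ℂ] S))
  let G (u : Γ) : MvPolynomial T (K ⊗[ℂ] S) →ₐ[ℂ] MvPolynomial T (K ⊗[ℂ] S) :=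
    MvPolynomial.mapAlgHom (Algebra.TensorProduct.map (γ u) (AlgHom.id ℂ S))
  have hb (i) (x : K) : x • b i = MvPolynomial.monomial i.2 (x ⊗ₜ[ℂ] e i.1) := by
    simp [b, Module.Basis.smulTower_apply, MvPolynomial.smul_monomial, TensorProduct.smul_tmul',
      Algebra.TensorProduct.basis_apply]
  have hG (u : Γ) (r) : b.repr (G u r) = (b.repr r).mapRange (γ u) (map_zero _) := by
    have key : ∀ r, G u (b.repr.symm r) = b.repr.symm (r.mapRange (γ u) (map_zero _)) := by
      intro r
      induction r using Finsupp.induction_linear with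
      | zero => simp
      | add f g hf hg =>
        rw [map_add, map_add, hf, hg, Finsupp.mapRange_add (fun x y => map_add (γ u) x y), map_add]
      | single i x =>
        simp only [Module.Basis.repr_symm_single, Finsupp.mapRange_single, hb]
        simp [G]
    rw [← b.repr.symm_apply_apply r, key]
    simp
  have hrange (r : MvPolynomial T (K ⊗[ℂ] S)) (hr : ∀ u i, γ u (b.repr r i) = b.repr r i) :
      r ∈ (inclPoly T S k).range := by
    rw [← b.linearCombination_repr r, Finsupp.linearCombination_apply]
    refine sum_mem fun i _ => ?_
    change b.repr r i • b i ∈ _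
    rw [hb]
    refine ⟨MvPolynomial.monomial i.2 (⟨_, hk _ fun u => hr u i⟩ ⊗ₜ[ℂ] e i.1), ?_⟩
    simp [inclPoly]
  -- the denominators of `ω`
  let N : Submodule K (MvPolynomial T (K ⊗[ℂ] S)) :=
    { carrier := {r | ∃ r', ω * j r = j r'}
      zero_mem' := ⟨0, by simp⟩
      add_mem' := by
        rintro _ _ ⟨x, hx⟩ ⟨y, hy⟩
        exact ⟨x + y, by rw [map_add, map_add, mul_add, hx, hy]⟩
      smul_mem' := by
        rintro c r ⟨x, hx⟩
        have hc (y : MvPolynomial T (K ⊗[ℂ] S)) : c • y = MvPolynomial.C (c ⊗ₜ 1) * y :=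
          Algebra.smul_def c y
        exact ⟨c • x, by rw [hc, hc, map_mul, map_mul, mul_left_comm, hx]⟩ }
  obtain ⟨x, hx, hx0, hxinv⟩ := exists_invariant_vector (fun u => (γ u : K →+* K))
    (N.map b.repr.toLinearMap) (by
      rintro u _ ⟨r, ⟨r', hr'⟩, rfl⟩
      refine ⟨G u r, ⟨G u r', ?_⟩, hG u r⟩
      rw [← hω u, ← hw, ← hw, ← map_mul, hr'])
    (by
      intro hbot
      have : b.repr v₀ ∈ N.map b.repr.toLinearMap := ⟨v₀, ⟨u₀, h₀⟩, rfl⟩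
      rw [hbot, Submodule.mem_bot, LinearEquiv.map_eq_zero_iff] at this
      exact hv₀ this)
  obtain ⟨v, ⟨u, huv⟩, rfl⟩ := hx
  have hv : v ≠ 0 := by rintro rfl; simp at hx0
  have hvinv (g i) : γ g (b.repr v i) = b.repr v i := hxinv g i
  obtain ⟨v', rfl⟩ := hrange v hvinv
  -- the numerator `u = ω v` is invariant along with `ω` and `v`
  obtain ⟨u', rfl⟩ := hrange u fun g i => by
    have : G g u = u := by
      apply hj
      have hGv : G g (inclPoly T S k v') = inclPoly T S k v' := by
        apply b.repr.injective
        ext i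
        rw [hG]
        exact hvinv g i
      rw [← hw, ← huv, map_mul, hω]
      exact congrArg (ω * ·) ((hw g _).trans (congrArg j hGv))
    conv_rhs => rw [← this, hG]
    rfl
  exact ⟨u', v', fun h => hv (by rw [h]; exact map_zero _), huv⟩

end Invariants

/-! ### Algebraic independence -/

/-- A finite family that generates a field containing an algebraically independent family of the
same cardinality is algebraically independent. -/
theorem algebraicIndependent_of_card {ι ι' L : Type*} [Field L] [Algebra ℂ L] [Fintype ι]
    [Fintype ι'] {x : ι → L} {y : ι' → L} (hx : AlgebraicIndependent ℂ x)
    (hcard : Fintype.card ι' = Fintype.card ι)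
    (h : ∀ i, x i ∈ IntermediateField.adjoin ℂ (Set.range y)) : AlgebraicIndependent ℂ y := by
  let F := IntermediateField.adjoin ℂ (Set.range y)
  let x' (i : ι) : F := ⟨x i, h i⟩
  let y' (i : ι') : F := ⟨y i, IntermediateField.subset_adjoin ℂ _ ⟨i, rfl⟩⟩
  have hx' : AlgebraicIndependent ℂ x' := AlgebraicIndependent.of_comp F.val hx
  have halg : Algebra.IsAlgebraic (Algebra.adjoin ℂ (Set.range y')) F := by
    refine ⟨fun ⟨a, ha⟩ => ?_⟩
    induction ha using IntermediateField.adjoin_induction with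
    | mem a ha =>
      obtain ⟨i, rfl⟩ := ha
      exact isAlgebraic_algebraMap
        (⟨y' i, Algebra.subset_adjoin ⟨i, rfl⟩⟩ : Algebra.adjoin ℂ (Set.range y'))
    | algebraMap r =>
      exact isAlgebraic_algebraMap (algebraMap ℂ (Algebra.adjoin ℂ (Set.range y')) r)
    | add a b ha hb iha ihb => exact iha.add ihb
    | inv a ha iha => exact iha.inv
    | mul a b ha hb iha ihb => exact iha.mul ihb
  have hle := hx'.lift_cardinalMk_le_trdeg
  have := (Algebra.IsAlgebraic.isTranscendenceBasis_of_lift_le_trdeg_of_finite ℂ y' (by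
    simpa [hcard] using hle)).1
  exact this.map' (f := F.val) Subtype.val_injective

/-- `x` generates the field `L` over `ℂ`: every element is a fraction of polynomials in `x`. -/
def Generates {ι L : Type*} [Field L] [Algebra ℂ L] (x : ι → L) : Prop :=
  ∀ k : L, ∃ p q : MvPolynomial ι ℂ, MvPolynomial.aeval x q ≠ 0 ∧
    k * MvPolynomial.aeval x q = MvPolynomial.aeval x p

theorem isFractionRing_of_generates {ι L : Type*} [Field L] [Algebra ℂ L] {x : ι → L}
    (hind : AlgebraicIndependent ℂ x) (hgen : Generates x) :
    let _ := (MvPolynomial.aeval (R := ℂ) x).toRingHom.toAlgebra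
    IsFractionRing (MvPolynomial ι ℂ) L := by
  intro _
  have : FaithfulSMul (MvPolynomial ι ℂ) L :=
    (faithfulSMul_iff_algebraMap_injective _ _).mpr hind
  refine IsFractionRing.of_field _ _ fun z => ?_
  obtain ⟨p, q, hq, h⟩ := hgen z
  exact ⟨p, q, eq_div_of_mul_eq hq h⟩

/-- If coordinates of the fields `K₁` and `K₂` and the elements `t` of the field `Ω` are
algebraically independent, then `Ω` contains `(K₁ ⊗ K₂)[t]`. -/
theorem aevalTower_productMap_injective {ι₁ ι₂ T K₁ K₂ Ω : Type*} [Field K₁] [Field K₂]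
    [Field Ω] [Algebra ℂ K₁] [Algebra ℂ K₂] [Algebra ℂ Ω] {x : ι₁ → K₁} {z : ι₂ → K₂}
    (hx : Generates x) (hz : Generates z) (j₁ : K₁ →ₐ[ℂ] Ω) (j₂ : K₂ →ₐ[ℂ] Ω) (t : T → Ω)
    (h : AlgebraicIndependent ℂ (Sum.elim (fun i => j₁ (x i)) (Sum.elim (fun i => j₂ (z i)) t))) :
    Function.Injective (MvPolynomial.aevalTower (Algebra.TensorProduct.productMap j₁ j₂) t) := by
  let j := MvPolynomial.aevalTower (Algebra.TensorProduct.productMap j₁ j₂) t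
  let Θ : MvPolynomial (ι₁ ⊕ (ι₂ ⊕ T)) ℂ →ₐ[ℂ] MvPolynomial T (K₁ ⊗[ℂ] K₂) :=
    MvPolynomial.aeval (Sum.elim (fun i => MvPolynomial.C (x i ⊗ₜ 1))
      (Sum.elim (fun i => MvPolynomial.C (1 ⊗ₜ z i)) MvPolynomial.X))
  have hΘ (r) : j (Θ r) =
      MvPolynomial.aeval (Sum.elim (fun i => j₁ (x i)) (Sum.elim (fun i => j₂ (z i)) t)) r := by
    have : j.comp Θ = MvPolynomial.aeval
        (Sum.elim (fun i => j₁ (x i)) (Sum.elim (fun i => j₂ (z i)) t)) := by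
      apply MvPolynomial.algHom_ext
      rintro (i | i | i) <;> simp [Θ, j]
    exact DFunLike.congr_fun this r
  have hΘ₁ (p : MvPolynomial ι₁ ℂ) : Θ (MvPolynomial.rename Sum.inl p) =
      MvPolynomial.C (MvPolynomial.aeval x p ⊗ₜ 1) := by
    induction p using MvPolynomial.induction_on with
    | C r => simp [MvPolynomial.algebraMap_eq, Algebra.TensorProduct.algebraMap_apply]
    | add p q hp hq => simp [hp, hq, TensorProduct.add_tmul]
    | mul_X p i hp =>
      rw [map_mul, map_mul, hp, MvPolynomial.rename_X]
      simp [Θ, ← MvPolynomial.C_mul]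
  have hΘ₂ (p : MvPolynomial ι₂ ℂ) : Θ (MvPolynomial.rename (Sum.inr ∘ Sum.inl) p) =
      MvPolynomial.C (1 ⊗ₜ MvPolynomial.aeval z p) := by
    induction p using MvPolynomial.induction_on with
    | C r =>
      have : (1 : K₁) ⊗ₜ[ℂ] algebraMap ℂ K₂ r = algebraMap ℂ (K₁ ⊗[ℂ] K₂) r :=
        (Algebra.TensorProduct.includeRight : K₂ →ₐ[ℂ] K₁ ⊗[ℂ] K₂).commutes r
      rw [MvPolynomial.rename_C, MvPolynomial.aeval_C, MvPolynomial.aeval_C, this,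
        MvPolynomial.algebraMap_apply]
    | add p q hp hq => simp [hp, hq, TensorProduct.tmul_add]
    | mul_X p i hp =>
      rw [map_mul, map_mul, hp, MvPolynomial.rename_X]
      simp [Θ, ← MvPolynomial.C_mul]
  -- multiplication by denominators takes an element into the polynomial ring in all coordinates
  have key : ∀ r : MvPolynomial T (K₁ ⊗[ℂ] K₂), ∃ (d : MvPolynomial ι₁ ℂ) (e : MvPolynomial ι₂ ℂ)
      (s : _), MvPolynomial.aeval x d ≠ 0 ∧ MvPolynomial.aeval z e ≠ 0 ∧
      MvPolynomial.C (MvPolynomial.aeval x d ⊗ₜ MvPolynomial.aeval z e) * r = Θ s := by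
    have hadd : ∀ r r' : MvPolynomial T (K₁ ⊗[ℂ] K₂),
      (∃ (d : MvPolynomial ι₁ ℂ) (e : MvPolynomial ι₂ ℂ)
      (s : _), MvPolynomial.aeval x d ≠ 0 ∧ MvPolynomial.aeval z e ≠ 0 ∧
      MvPolynomial.C (MvPolynomial.aeval x d ⊗ₜ MvPolynomial.aeval z e) * r = Θ s) →
      (∃ (d : MvPolynomial ι₁ ℂ) (e : MvPolynomial ι₂ ℂ)
      (s : _), MvPolynomial.aeval x d ≠ 0 ∧ MvPolynomial.aeval z e ≠ 0 ∧
      MvPolynomial.C (MvPolynomial.aeval x d ⊗ₜ MvPolynomial.aeval z e) * r' = Θ s) →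
      (∃ (d : MvPolynomial ι₁ ℂ) (e : MvPolynomial ι₂ ℂ)
      (s : _), MvPolynomial.aeval x d ≠ 0 ∧ MvPolynomial.aeval z e ≠ 0 ∧
      MvPolynomial.C (MvPolynomial.aeval x d ⊗ₜ MvPolynomial.aeval z e) * (r + r') = Θ s) := by
      rintro r r' ⟨d, e, s, hd, he, hs⟩ ⟨d', e', s', hd', he', hs'⟩
      refine ⟨d * d', e * e', MvPolynomial.rename Sum.inl d' *
        MvPolynomial.rename (Sum.inr ∘ Sum.inl) e' * s + MvPolynomial.rename Sum.inl d *
        MvPolynomial.rename (Sum.inr ∘ Sum.inl) e * s', ?_, ?_, ?_⟩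
      · rw [map_mul]; exact mul_ne_zero hd hd'
      · rw [map_mul]; exact mul_ne_zero he he'
      · simp only [map_add, map_mul, hΘ₁, hΘ₂, ← hs, ← hs']
        simp only [← mul_assoc, ← map_mul, Algebra.TensorProduct.tmul_mul_tmul, mul_add, one_mul,
          mul_one]
        rw [mul_comm d' d, mul_comm e' e]
    intro r
    induction r using MvPolynomial.induction_on with
    | C a =>
      induction a using TensorProduct.induction_on with
      | zero => exact ⟨1, 1, 0, by simp, by simp, by simp⟩
      | add a a' ha ha' => rw [map_add]; exact hadd _ _ ha ha'
      | tmul k₁ k₂ =>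
        obtain ⟨p, d, hd, hp⟩ := hx k₁
        obtain ⟨p', e, he, hp'⟩ := hz k₂
        refine ⟨d, e, MvPolynomial.rename Sum.inl p * MvPolynomial.rename (Sum.inr ∘ Sum.inl) p',
          hd, he, ?_⟩
        rw [map_mul, hΘ₁, hΘ₂, ← map_mul, ← map_mul]
        simp [Algebra.TensorProduct.tmul_mul_tmul, ← hp, ← hp', mul_comm]
    | add r r' hr hr' => exact hadd _ _ hr hr'
    | mul_X r i hr =>
      obtain ⟨d, e, s, hd, he, hs⟩ := hr
      refine ⟨d, e, s * .X (.inr (.inr i)), hd, he, ?_⟩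
      rw [map_mul, ← hs, mul_assoc]
      simp [Θ]
  rw [injective_iff_map_eq_zero]
  intro r hr
  obtain ⟨d, e, s, hd, he, hs⟩ := key r
  have h1 : s = 0 := by
    apply h
    rw [map_zero, ← hΘ, ← hs, map_mul, show j r = 0 from hr, mul_zero]
  rw [h1, map_zero] at hs
  have hu : IsUnit (MvPolynomial.C (σ := T)
      (MvPolynomial.aeval x d ⊗ₜ[ℂ] MvPolynomial.aeval z e)) := by
    refine IsUnit.map MvPolynomial.C (IsUnit.of_mul_eq_one
      ((MvPolynomial.aeval x d)⁻¹ ⊗ₜ (MvPolynomial.aeval z e)⁻¹) ?_)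
    rw [Algebra.TensorProduct.tmul_mul_tmul, mul_inv_cancel₀ hd, mul_inv_cancel₀ he]
    rfl
  exact (hu.mul_right_eq_zero).mp hs

/-! ### Coordinates on vector spaces -/

section Coordinates

variable {E ι : Type*} [AddCommGroup E] [Module ℂ E] (b : Module.Basis ι ℂ E)

/-- The polynomial function with the given expression in the coordinates of a basis. -/
def polyOfCoord : MvPolynomial ι ℂ →ₐ[ℂ] polyFun E :=
  MvPolynomial.aeval fun i => ⟨fun v => b.repr v i, Algebra.subset_adjoin ⟨b.coord i, rfl⟩⟩

theorem polyOfCoord_apply (p : MvPolynomial ι ℂ) (v : E) :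
    (polyOfCoord b p).1 v = MvPolynomial.eval (fun i => b.repr v i) p := by
  induction p using MvPolynomial.induction_on with
  | C r => simp [polyOfCoord, Algebra.algebraMap_eq_smul_one]
  | add p q hp hq => simp [hp, hq]
  | mul_X p i hp => simp [hp]; simp [polyOfCoord]

variable [Finite ι]

theorem polyOfCoord_bijective : Function.Bijective (polyOfCoord b) := by
  constructor
  · intro p q h
    apply MvPolynomial.funext
    intro x
    have := congrFun (congrArg Subtype.val h) (b.equivFun.symm x)
    rw [polyOfCoord_apply, polyOfCoord_apply] at this
    have hx : (fun i => b.repr (b.equivFun.symm x) i) = x := b.equivFun.apply_symm_apply x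
    rwa [hx] at this
  · rintro ⟨f, hf⟩
    suffices f ∈ ((polyFun E).val.comp (polyOfCoord b)).range by
      obtain ⟨p, hp⟩ := this
      exact ⟨p, Subtype.ext hp⟩
    induction hf using Algebra.adjoin_induction with
    | mem f hf =>
      obtain ⟨φ, rfl⟩ := hf
      cases nonempty_fintype ι
      refine ⟨∑ i, MvPolynomial.C (φ (b i)) * .X i, ?_⟩
      ext v
      change (polyOfCoord b _).1 v = φ v
      conv_rhs => rw [← b.sum_repr v, map_sum]
      rw [polyOfCoord_apply]
      simp [mul_comm]
    | algebraMap r => exact Subalgebra.algebraMap_mem _ r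
    | add x y _ _ hx hy => exact add_mem hx hy
    | mul x y _ _ hx hy => exact mul_mem hx hy

/-- Polynomial functions are polynomials in the coordinates of a basis. -/
def polyEquiv : MvPolynomial ι ℂ ≃ₐ[ℂ] polyFun E :=
  AlgEquiv.ofBijective _ (polyOfCoord_bijective b)

theorem polyEquiv_apply (p : MvPolynomial ι ℂ) (v : E) :
    (polyEquiv b p).1 v = MvPolynomial.eval (fun i => b.repr v i) p :=
  polyOfCoord_apply b p v

instance [FiniteDimensional ℂ E] : IsDomain (polyFun E) :=
  (polyEquiv (Module.finBasis ℂ E)).symm.toMulEquiv.isDomain _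

instance [FiniteDimensional ℂ E] : Field (RatFun E) := IsFractionRing.toField (polyFun E)

/-- The coordinate functions of a basis, as rational functions. -/
def ratCoord (i : ι) : RatFun E := algebraMap (polyFun E) (RatFun E) (polyEquiv b (.X i))

theorem aeval_ratCoord (p : MvPolynomial ι ℂ) : MvPolynomial.aeval (ratCoord b) p =
    algebraMap (polyFun E) (RatFun E) (polyEquiv b p) := by
  have : MvPolynomial.aeval (ratCoord b) =
      ((Algebra.ofId (polyFun E) (RatFun E)).restrictScalars ℂ).comp (polyEquiv b).toAlgHom := by
    apply MvPolynomial.algHom_ext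
    intro i
    simp [ratCoord]
  exact DFunLike.congr_fun this p

theorem algebraicIndependent_ratCoord : AlgebraicIndependent ℂ (ratCoord b) := by
  intro p q h
  rw [aeval_ratCoord, aeval_ratCoord] at h
  exact (polyEquiv b).injective (IsFractionRing.injective (polyFun E) (RatFun E) h)

variable [FiniteDimensional ℂ E]

theorem generates_ratCoord : Generates (ratCoord b) := by
  intro k
  obtain ⟨⟨p, q⟩, h⟩ := IsLocalization.surj (nonZeroDivisors (polyFun E)) k
  refine ⟨(polyEquiv b).symm p, (polyEquiv b).symm q, ?_, ?_⟩
  · rw [aeval_ratCoord, AlgEquiv.apply_symm_apply]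
    exact IsFractionRing.to_map_ne_zero_of_mem_nonZeroDivisors q.2
  · rw [aeval_ratCoord, aeval_ratCoord, AlgEquiv.apply_symm_apply, AlgEquiv.apply_symm_apply]
    exact h

end Coordinates

/-! ### Pullbacks of rational functions -/

section Pullback

variable {E ι Γ : Type*} [AddCommGroup E] [Module ℂ E] [Group Γ] (ρ : Representation ℂ Γ E)

theorem ratPullback_algebraMap (g : Γ) (p : polyFun E) :
    ratPullback ρ g (algebraMap _ _ p) = algebraMap _ _
      (polyPullback (LinearEquiv.ofBijective (ρ g) (ρ.apply_bijective g)) p) :=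
  IsFractionRing.algEquivOfAlgEquiv_algebraMap _ _

theorem ratPullback_congr {Δ : Type*} [Group Δ] (ρ' : Representation ℂ Δ E) {g : Γ} {g' : Δ}
    (h : ρ g = ρ' g') : ratPullback ρ g = ratPullback ρ' g' := by
  simp only [ratPullback, h]

/-- The representation of `ℂˣ × Γ` in which `ℂˣ` acts by homotheties. Its invariants in `ℂ(E)` are
the invariants of `Γ` in `ℂ(ℙE)`. -/
def scaled : Representation ℂ (ℂˣ × Γ) E where
  toFun x := (x.1 : ℂ) • ρ x.2
  map_one' := by simp
  map_mul' x y := by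
    ext v
    simp only [Prod.fst_mul, Prod.snd_mul, Units.val_mul, map_mul, LinearMap.smul_apply,
      Module.End.mul_apply, map_smul, mul_smul]
    exact smul_comm _ _ _

theorem scaled_apply (x : ℂˣ × Γ) (v : E) : scaled ρ x v = (x.1 : ℂ) • ρ x.2 v := rfl

theorem ratPullback_scaled_algebraMap (c : ℂˣ) (p : polyFun E) :
    ratPullback (scaled ρ) (c, 1) (algebraMap _ _ p) =
      algebraMap _ _ (polyPullback (LinearEquiv.smulOfUnit c) p) := by
  rw [ratPullback_algebraMap]
  refine congrArg _ (Subtype.ext (funext fun v => ?_))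
  change p.1 (scaled ρ (c, 1) v) = p.1 ((c : ℂ) • v)
  simp [scaled_apply]

theorem ratPullback_scaled_one (g : Γ) : ratPullback (scaled ρ) (1, g) = ratPullback ρ g :=
  ratPullback_congr _ _ (by ext v; simp [scaled_apply])

variable [FiniteDimensional ℂ E]

theorem ratPullback_ratCoord_of_repr {κ : Type*} [Finite ι] [Fintype κ] (b : Module.Basis ι ℂ E)
    {g : Γ} {i : ι} {s : κ → ℂ} {f : κ → ι}
    (h : ∀ v, b.repr (ρ g v) i = ∑ k, s k * b.repr v (f k)) :
    ratPullback ρ g (ratCoord b i) = ∑ k, algebraMap ℂ (RatFun E) (s k) * ratCoord b (f k) := by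
  have : polyPullback (LinearEquiv.ofBijective (ρ g) (ρ.apply_bijective g)) (polyEquiv b (.X i)) =
      polyEquiv b (∑ k, MvPolynomial.C (s k) * .X (f k)) := by
    apply Subtype.ext
    ext v
    change (polyEquiv b _).1 (ρ g v) = _
    rw [polyEquiv_apply, polyEquiv_apply, MvPolynomial.eval_X, h]
    simp
  rw [ratCoord, ratPullback_algebraMap, this, ← aeval_ratCoord]
  simp

theorem ratPullback_ratCoord [Fintype ι] [DecidableEq ι] (b : Module.Basis ι ℂ E) (g : Γ) (i : ι) :
    ratPullback ρ g (ratCoord b i) =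
      ∑ j, algebraMap ℂ (RatFun E) (LinearMap.toMatrix b b (ρ g) i j) * ratCoord b j :=
  ratPullback_ratCoord_of_repr ρ b (f := id) fun v => by
    rw [← LinearMap.toMatrix_mulVec_repr b b (ρ g) v]
    rfl

theorem ratPullback_one (z : RatFun E) : ratPullback ρ 1 z = z := by
  have : (ratPullback ρ 1 : RatFun E →+* RatFun E) = RingHom.id _ := by
    refine IsLocalization.ringHom_ext (nonZeroDivisors (polyFun E)) (RingHom.ext fun p => ?_)
    refine (ratPullback_algebraMap ρ 1 p).trans (congrArg _ (Subtype.ext (funext fun v => ?_)))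
    change p.1 (ρ 1 v) = p.1 v
    rw [map_one]; rfl
  exact DFunLike.congr_fun this z

theorem ratPullback_mul (g h : Γ) (z : RatFun E) :
    ratPullback ρ (g * h) z = ratPullback ρ h (ratPullback ρ g z) := by
  have : (ratPullback ρ (g * h) : RatFun E →+* RatFun E) =
      (ratPullback ρ h : RatFun E →+* RatFun E).comp (ratPullback ρ g : RatFun E →+* RatFun E) := by
    refine IsLocalization.ringHom_ext (nonZeroDivisors (polyFun E)) (RingHom.ext fun p => ?_)
    refine (ratPullback_algebraMap ρ _ p).trans (Eq.trans ?_
      ((congrArg (ratPullback ρ h) (ratPullback_algebraMap ρ g p)).trans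
        (ratPullback_algebraMap ρ h _)).symm)
    refine congrArg _ (Subtype.ext (funext fun v => ?_))
    change p.1 (ρ (g * h) v) = p.1 (ρ g (ρ h v))
    rw [map_mul]; rfl
  exact DFunLike.congr_fun this z

theorem aeval_smul_of_isHomogeneous {R : Type*} [CommRing R] [Algebra ℂ R]
    {p : MvPolynomial ι ℂ} {n : ℕ} (hp : p.IsHomogeneous n) (c : R) (x : ι → R) :
    MvPolynomial.aeval (fun i => c * x i) p = c ^ n * MvPolynomial.aeval x p := by
  rw [MvPolynomial.aeval_def, MvPolynomial.aeval_def, MvPolynomial.eval₂_eq, MvPolynomial.eval₂_eq,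
    Finset.mul_sum]
  refine Finset.sum_congr rfl fun m hm => ?_
  have hdeg : ∑ i ∈ m.support, m i = n := by
    have := hp (MvPolynomial.mem_support_iff.mp hm)
    rw [Finsupp.weight_apply] at this
    simpa [Finsupp.sum] using this
  simp only [mul_pow, Finset.prod_mul_distrib, Finset.prod_pow_eq_pow_sum, hdeg]
  ring

theorem eval_smul_of_isHomogeneous {p : MvPolynomial ι ℂ} {n : ℕ} (hp : p.IsHomogeneous n) (c : ℂ)
    (x : ι → ℂ) : MvPolynomial.eval (fun i => c * x i) p = c ^ n * MvPolynomial.eval x p := by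
  simpa [MvPolynomial.aeval_eq_eval] using aeval_smul_of_isHomogeneous hp c x

theorem eval_smul_eq_sum (p : MvPolynomial ι ℂ) {N : ℕ} (hN : p.totalDegree < N) (c : ℂ)
    (x : ι → ℂ) : MvPolynomial.eval (fun i => c * x i) p =
      ∑ n ∈ Finset.range N, c ^ n * MvPolynomial.eval x (p.homogeneousComponent n) := by
  have hp : p = ∑ n ∈ Finset.range N, p.homogeneousComponent n := by
    conv_lhs => rw [← MvPolynomial.sum_homogeneousComponent p]
    refine Finset.sum_subset (Finset.range_subset_range.mpr hN) fun n _ hn => ?_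
    exact MvPolynomial.homogeneousComponent_eq_zero _ _ (by simpa using hn)
  conv_lhs => rw [hp]
  rw [map_sum]
  exact Finset.sum_congr rfl fun n _ => eval_smul_of_isHomogeneous
    (MvPolynomial.homogeneousComponent_isHomogeneous n p) c x

/-- A fraction `p / q` invariant under homotheties equals the fraction of the components of
`p` and `q` of any degree in which `q` does not vanish. -/
theorem exists_homogeneous_fraction {p q : MvPolynomial ι ℂ} (hq : q ≠ 0)
    (h : ∀ (c : ℂˣ) (x : ι → ℂ), MvPolynomial.eval (fun i => c * x i) p * MvPolynomial.eval x q =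
      MvPolynomial.eval x p * MvPolynomial.eval (fun i => c * x i) q) :
    ∃ (n : ℕ) (p' q' : MvPolynomial ι ℂ), p'.IsHomogeneous n ∧ q'.IsHomogeneous n ∧ q' ≠ 0 ∧
      p' * q = p * q' := by
  obtain ⟨n, hn⟩ : ∃ n, q.homogeneousComponent n ≠ 0 := by
    by_contra! hall
    apply hq
    rw [← MvPolynomial.sum_homogeneousComponent q]
    exact Finset.sum_eq_zero fun n _ => hall n
  refine ⟨n, p.homogeneousComponent n, q.homogeneousComponent n,
    MvPolynomial.homogeneousComponent_isHomogeneous _ _,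
    MvPolynomial.homogeneousComponent_isHomogeneous _ _, hn, ?_⟩
  apply MvPolynomial.funext
  intro x
  let N := max p.totalDegree q.totalDegree + 1
  have hp (c : ℂ) := eval_smul_eq_sum p (N := N) (Nat.lt_succ_of_le (le_max_left _ _)) c x
  have hq (c : ℂ) := eval_smul_eq_sum q (N := N) (Nat.lt_succ_of_le (le_max_right _ _)) c x
  -- compare the coefficients of the powers of the ratio `c` of the homothety
  let r : Polynomial ℂ := ∑ n ∈ Finset.range N,
    Polynomial.monomial n (MvPolynomial.eval x (p.homogeneousComponent n) * MvPolynomial.eval x q -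
      MvPolynomial.eval x p * MvPolynomial.eval x (q.homogeneousComponent n))
  have hr : r = 0 := by
    apply Polynomial.eq_zero_of_infinite_isRoot
    refine (Set.Infinite.mono (s := {0}ᶜ) ?_ (Set.finite_singleton (0 : ℂ)).infinite_compl)
    intro c hc
    have hc' : c ≠ 0 := hc
    have := h (Units.mk0 c hc') x
    simp only [Units.val_mk0] at this
    rw [hp, hq, Finset.sum_mul, Finset.mul_sum, ← sub_eq_zero,
      ← Finset.sum_sub_distrib] at this
    change Polynomial.eval c r = 0
    simp only [r, Polynomial.eval_finsetSum, Polynomial.eval_monomial]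
    rw [← this]
    exact Finset.sum_congr rfl fun n _ => by ring
  rw [map_mul, map_mul]
  by_cases hnN : n ∈ Finset.range N
  · have := congrArg (fun r => Polynomial.coeff r n) hr
    simp only [r, Polynomial.finsetSum_coeff, Polynomial.coeff_monomial, Polynomial.coeff_zero,
      Finset.sum_ite_eq', hnN, if_true] at this
    exact sub_eq_zero.mp this
  · rw [Finset.mem_range, not_lt] at hnN
    rw [MvPolynomial.homogeneousComponent_eq_zero _ p (by omega),
      MvPolynomial.homogeneousComponent_eq_zero _ q (by omega)]
    simp

/-- A rational function invariant under homotheties is a fraction of two forms of equal degree. -/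
theorem exists_homogeneous_fraction_of_invariant [Finite ι] (b : Module.Basis ι ℂ E)
    {z : RatFun E} (hz : ∀ c, ratPullback (scaled ρ) (c, 1) z = z) :
    ∃ (n : ℕ) (p q : MvPolynomial ι ℂ), p.IsHomogeneous n ∧ q.IsHomogeneous n ∧ q ≠ 0 ∧
      z * MvPolynomial.aeval (ratCoord b) q = MvPolynomial.aeval (ratCoord b) p := by
  cases nonempty_fintype ι
  obtain ⟨p, q, hq, h⟩ := generates_ratCoord b z
  have hq0 : q ≠ 0 := by rintro rfl; simp at hq
  obtain ⟨n, p', q', hp', hq', hq'0, e⟩ := exists_homogeneous_fraction (p := p) hq0 (by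
    intro c x
    have h2 := congrArg (ratPullback (scaled ρ) (c, 1)) h
    rw [aeval_ratCoord, aeval_ratCoord, map_mul, ratPullback_scaled_algebraMap,
      ratPullback_scaled_algebraMap, hz] at h2
    rw [aeval_ratCoord, aeval_ratCoord] at h
    have h3 : algebraMap (polyFun E) (RatFun E)
        (polyPullback (LinearEquiv.smulOfUnit c) (polyEquiv b p) * polyEquiv b q) =
        algebraMap (polyFun E) (RatFun E)
        (polyEquiv b p * polyPullback (LinearEquiv.smulOfUnit c) (polyEquiv b q)) := by
      rw [map_mul, map_mul, ← h, ← h2]; ring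
    have h4 := congrFun (congrArg Subtype.val (IsFractionRing.injective _ _ h3))
      (b.equivFun.symm x)
    change (polyEquiv b p).1 ((c : ℂ) • b.equivFun.symm x) * (polyEquiv b q).1 _ =
      (polyEquiv b p).1 _ * (polyEquiv b q).1 ((c : ℂ) • b.equivFun.symm x) at h4
    have hx : (fun i => b.repr (b.equivFun.symm x) i) = x := b.equivFun.apply_symm_apply x
    have hcx : (fun i => b.repr ((c : ℂ) • b.equivFun.symm x) i) = fun i => c * x i := by
      ext i
      rw [map_smul, Finsupp.smul_apply, smul_eq_mul, congrFun hx i]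
    simpa only [polyEquiv_apply, hx, hcx] using h4)
  refine ⟨n, p', q', hp', hq', hq'0, ?_⟩
  apply mul_right_cancel₀ hq
  rw [← map_mul, e, map_mul, mul_right_comm, h]

theorem mem_projQuotientField_iff (z : RatFun E) :
    z ∈ projQuotientField ρ ↔ ∀ x, ratPullback (scaled ρ) x z = z := by
  constructor
  · rintro ⟨⟨d, p, q, hp, hq, hq0, h⟩, hinv⟩ ⟨c, g⟩
    have h1 : ratPullback (scaled ρ) (c, 1) z = z := by
      have h2 := congrArg (ratPullback (scaled ρ) (c, 1)) h
      have hpc (r : polyFun E) (hr : IsHomog r.1 d) :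
          polyPullback (LinearEquiv.smulOfUnit c) r = (c : ℂ) ^ d • r :=
        Subtype.ext (funext fun v => hr c v)
      rw [map_mul, ratPullback_scaled_algebraMap, ratPullback_scaled_algebraMap, hpc p hp,
        hpc q hq, Algebra.smul_def, Algebra.smul_def, map_mul, map_mul, ← h, mul_left_comm] at h2
      have hinj := IsFractionRing.injective (polyFun E) (RatFun E)
      have hc : algebraMap (polyFun E) (RatFun E) (algebraMap ℂ _ ((c : ℂ) ^ d)) ≠ 0 :=
        (map_ne_zero_iff _ hinj).mpr ((map_ne_zero_iff _ (algebraMap ℂ (polyFun E)).injective).mpr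
          (pow_ne_zero _ c.ne_zero))
      exact mul_right_cancel₀ (IsFractionRing.to_map_ne_zero_of_mem_nonZeroDivisors hq0)
        (mul_left_cancel₀ hc h2)
    have : ((c, g) : ℂˣ × Γ) = (c, 1) * (1, g) := by simp
    rw [this, ratPullback_mul, h1, ratPullback_scaled_one, hinv]
  · intro hinv
    refine ⟨?_, fun g => by rw [← ratPullback_scaled_one, hinv]⟩
    let b := Module.finBasis ℂ E
    obtain ⟨n, p, q, hp, hq, hq0, e⟩ := exists_homogeneous_fraction_of_invariant ρ b
      (fun c => hinv (c, 1))
    refine ⟨n, polyEquiv b p, polyEquiv b q, fun c v => ?_, fun c v => ?_, ?_, ?_⟩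
    · rw [polyEquiv_apply, polyEquiv_apply, ← eval_smul_of_isHomogeneous hp]
      simp
    · rw [polyEquiv_apply, polyEquiv_apply, ← eval_smul_of_isHomogeneous hq]
      simp
    · rw [mem_nonZeroDivisors_iff_ne_zero]
      exact (map_ne_zero_iff _ (polyEquiv b).injective).mpr hq0
    · rw [← aeval_ratCoord, ← aeval_ratCoord, e]

end Pullback

/-! ### Points of group schemes of finite type -/

section Points

variable {G : Over (Spec (CommRingCat.of ℂ))}

/-- The structure of a `ℂ`-algebra on the ring of sections of a `ℂ`-scheme over an open set. -/
def structHom (U : G.left.Opens) : ℂ →+* Γ(G.left, U) :=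
  ((Scheme.ΓSpecIso (.of ℂ)).inv ≫ G.hom.appLE ⊤ U le_top).hom

instance (U : G.left.Opens) : Algebra ℂ Γ(G.left, U) := (structHom U).toAlgebra

theorem finiteType_sections [LocallyOfFiniteType G.hom] {U : G.left.Opens} (hU : IsAffineOpen U) :
    Algebra.FiniteType ℂ Γ(G.left, U) := by
  have h := G.hom.finiteType_appLE (isAffineOpen_top _) hU le_top
  have : (structHom U).FiniteType := by
    rw [structHom, CommRingCat.hom_comp]
    refine h.comp (RingHom.FiniteType.of_surjective _ ?_)
    exact (ConcreteCategory.bijective_of_isIso (Scheme.ΓSpecIso (.of ℂ)).inv).2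
  exact this

theorem Points.le_preimage {U : G.left.Opens} {g : Points G} (hg : g.pt ∈ U) :
    ⊤ ≤ g.hom ⁻¹ᵁ U :=
  (IsLocalRing.closed_point_mem_iff.mp hg).ge

theorem ofHom_evalHom (U : G.left.Opens) (g : Points G) (hg : g.pt ∈ U) :
    CommRingCat.ofHom (evalHom U g hg) =
      g.hom.appLE U ⊤ (Points.le_preimage hg) ≫ (Scheme.ΓSpecIso (.of ℂ)).hom := by
  have := Scheme.germ_stalkClosedPointTo g.hom U hg
  ext x
  have h2 := congrArg (fun f => f.hom x) this
  refine h2.trans ?_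
  simp [Scheme.Hom.app_eq_appLE]

theorem Points.hom_comp (g : Points G) : g.hom ≫ G.hom = 𝟙 _ := Over.w g

theorem evalHom_structHom (U : G.left.Opens) (g : Points G) (hg : g.pt ∈ U) (c : ℂ) :
    evalHom U g hg (structHom U c) = c := by
  have h : (Scheme.ΓSpecIso (.of ℂ)).inv ≫ G.hom.appLE ⊤ U le_top ≫
      CommRingCat.ofHom (evalHom U g hg) = 𝟙 _ := by
    have h1 := Scheme.Hom.appLE_comp_appLE g.hom G.hom ⊤ U ⊤ le_top (Points.le_preimage hg)
    rw [ofHom_evalHom, ← Category.assoc (G.hom.appLE ⊤ U le_top), h1]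
    have h2 : Scheme.Hom.appLE (𝟙 (Spec (CommRingCat.of ℂ))) ⊤ ⊤ le_top = 𝟙 _ := by
      simp only [Scheme.Hom.appLE, Scheme.Hom.id_app]
      exact (Category.id_comp _).trans (CategoryTheory.Functor.map_id _ _)
    simp only [Points.hom_comp]
    rw [h2, Category.id_comp, Iso.inv_hom_id]
  exact congrArg (fun f => f.hom c) h

/-- Evaluation at a point, as a homomorphism of `ℂ`-algebras. -/
def evalAlgHom (U : G.left.Opens) (g : Points G) (hg : g.pt ∈ U) : Γ(G.left, U) →ₐ[ℂ] ℂ :=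
  { evalHom U g hg with commutes' := evalHom_structHom U g hg }

theorem evalHom_res {U V : G.left.Opens} (h : U ≤ V) (g : Points G) (hg : g.pt ∈ U)
    (f : Γ(G.left, V)) :
    evalHom U g hg (G.left.presheaf.map (homOfLE h).op f) = evalHom V g (h hg) f := by
  exact congrArg (Scheme.stalkClosedPointTo g.hom).hom
    (TopCat.Presheaf.germ_res_apply _ (homOfLE h) g.pt hg f)

theorem Spec_map_evalHom {U : G.left.Opens} (hU : IsAffineOpen U) (g : Points G) (hg : g.pt ∈ U) :
    Spec.map (CommRingCat.ofHom (evalHom U g hg)) ≫ hU.fromSpec = g.hom := by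
  have h1 := IsAffineOpen.SpecMap_appLE_fromSpec g.hom hU (isAffineOpen_top _)
    (Points.le_preimage hg)
  rw [ofHom_evalHom, Spec.map_comp, Category.assoc, h1, IsAffineOpen.fromSpec_top,
    Scheme.isoSpec_Spec_inv, ← Spec.map_comp_assoc]
  simp

/-- On an affine open set every homomorphism from the regular functions to `ℂ` is the evaluation at
a `ℂ`-point. -/
theorem exists_point {U : G.left.Opens} (hU : IsAffineOpen U) (y : Γ(G.left, U) →ₐ[ℂ] ℂ) :
    ∃ (g : Points G) (hg : g.pt ∈ U), evalAlgHom U g hg = y := by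
  let Y : Γ(G.left, U) ⟶ CommRingCat.of ℂ := CommRingCat.ofHom y.toRingHom
  have hw : (Spec.map Y ≫ hU.fromSpec) ≫ G.hom = 𝟙 _ := by
    have h1 := IsAffineOpen.SpecMap_appLE_fromSpec G.hom (isAffineOpen_top _) hU le_top
    have h2 : (Scheme.ΓSpecIso (.of ℂ)).inv ≫ G.hom.appLE ⊤ U le_top ≫ Y = 𝟙 _ := by
      ext c
      exact y.commutes c
    rw [Category.assoc, ← h1, ← Spec.map_comp_assoc, IsAffineOpen.fromSpec_top]
    rw [← IsIso.eq_inv_comp, IsIso.Iso.inv_inv, Category.comp_id] at h2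
    rw [h2, Scheme.isoSpec_Spec_inv, ← Spec.map_comp]
    simp
  let g : Points G := Over.homMk (Spec.map Y ≫ hU.fromSpec) hw
  have hgh : g.hom = Spec.map Y ≫ hU.fromSpec := rfl
  have hg : g.pt ∈ U := by
    change hU.fromSpec (Spec.map Y (IsLocalRing.closedPoint ℂ)) ∈ (U : Set G.left)
    have : hU.fromSpec (Spec.map Y (IsLocalRing.closedPoint ℂ)) ∈ Set.range hU.fromSpec := ⟨_, rfl⟩
    rwa [hU.range_fromSpec] at this
  refine ⟨g, hg, ?_⟩
  have h3 : Spec.map (CommRingCat.ofHom (evalHom U g hg)) ≫ hU.fromSpec =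
      Spec.map Y ≫ hU.fromSpec := by
    rw [Spec_map_evalHom, hgh]
  have h4 := Spec.map_injective ((cancel_mono _).mp h3)
  ext x
  exact congrArg (fun f => f.hom x) h4

/-- The point with given values of the regular functions on an affine open set. -/
def pointOf {U : G.left.Opens} (hU : IsAffineOpen U) (y : Γ(G.left, U) →ₐ[ℂ] ℂ) : Points G :=
  (exists_point hU y).choose

theorem pointOf_pt_mem {U : G.left.Opens} (hU : IsAffineOpen U) (y : Γ(G.left, U) →ₐ[ℂ] ℂ) :
    (pointOf hU y).pt ∈ U :=
  (exists_point hU y).choose_spec.choose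

theorem evalAlgHom_pointOf {U : G.left.Opens} (hU : IsAffineOpen U) (y : Γ(G.left, U) →ₐ[ℂ] ℂ) :
    evalAlgHom U (pointOf hU y) (pointOf_pt_mem hU y) = y :=
  (exists_point hU y).choose_spec.choose_spec

theorem pointOf_evalAlgHom {U : G.left.Opens} (hU : IsAffineOpen U) (g : Points G)
    (hg : g.pt ∈ U) : pointOf hU (evalAlgHom U g hg) = g := by
  have h := evalAlgHom_pointOf hU (evalAlgHom U g hg)
  have h2 : evalHom U _ (pointOf_pt_mem hU (evalAlgHom U g hg)) = evalHom U g hg :=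
    congrArg (fun f : Γ(G.left, U) →ₐ[ℂ] ℂ => (f : Γ(G.left, U) →+* ℂ)) h
  refine Over.OverMorphism.ext ?_
  change Points.hom _ = Points.hom _
  rw [← Spec_map_evalHom hU _ (pointOf_pt_mem hU (evalAlgHom U g hg)), h2, Spec_map_evalHom]

theorem evalAt_pointOf {U : G.left.Opens} (hU : IsAffineOpen U) (y : Γ(G.left, U) →ₐ[ℂ] ℂ)
    (f : Γ(G.left, U)) : evalAt U f (pointOf hU y) = y f := by
  rw [evalAt, dif_pos (pointOf_pt_mem hU y)]
  exact DFunLike.congr_fun (evalAlgHom_pointOf hU y) f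

theorem evalAt_top_pointOf {U : G.left.Opens} (hU : IsAffineOpen U) (y : Γ(G.left, U) →ₐ[ℂ] ℂ)
    (f : Γ(G.left, ⊤)) : evalAt ⊤ f (pointOf hU y) =
      y (G.left.presheaf.map (homOfLE (le_top : U ≤ ⊤)).op f) := by
  rw [evalAt, dif_pos (show (pointOf hU y).pt ∈ (⊤ : G.left.Opens) from trivial), ← evalHom_res le_top _ (pointOf_pt_mem hU y)]
  exact DFunLike.congr_fun (evalAlgHom_pointOf hU y) _

theorem exists_affine_cover (G : Over (Spec (CommRingCat.of ℂ))) [QuasiCompact G.hom] :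
    ∃ s : Finset G.left.Opens, (∀ U ∈ s, IsAffineOpen U) ∧ ∀ x : G.left, ∃ U ∈ s, x ∈ U := by
  have : CompactSpace G.left := by
    have h := QuasiCompact.isCompact_preimage (f := G.hom) Set.univ isOpen_univ isCompact_univ
    rw [Set.preimage_univ] at h
    exact ⟨h⟩
  obtain ⟨t, ht⟩ := CompactSpace.elim_nhds_subcover (X := G.left)
    (fun x => ((G.left.isBasis_affineOpens.exists_subset_of_mem_open (Set.mem_univ x)
      isOpen_univ).choose)) (by
      intro x
      have := (G.left.isBasis_affineOpens.exists_subset_of_mem_open (Set.mem_univ x)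
        isOpen_univ).choose_spec
      obtain ⟨⟨U, hU, e⟩, hx, -⟩ := this
      rw [← e] at hx ⊢
      exact U.2.mem_nhds hx)
  classical
  have hx (x : G.left) : ∃ U : G.left.Opens, IsAffineOpen U ∧ (U : Set G.left) =
      ((G.left.isBasis_affineOpens.exists_subset_of_mem_open (Set.mem_univ x)
      isOpen_univ).choose) := by
    obtain ⟨⟨U, hU, e⟩, hx, -⟩ := (G.left.isBasis_affineOpens.exists_subset_of_mem_open
      (Set.mem_univ x) isOpen_univ).choose_spec
    exact ⟨U, hU, e⟩
  choose U hU hUe using hx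
  refine ⟨t.image U, by simpa using fun x _ => hU x, fun x => ?_⟩
  have : x ∈ (⊤ : Set G.left) := trivial
  rw [← ht] at this
  simp only [Set.mem_iUnion] at this
  obtain ⟨z, hz, hxz⟩ := this
  refine ⟨U z, Finset.mem_image_of_mem _ hz, ?_⟩
  rw [← hUe] at hxz
  exact hxz

end Points

/-! ### Linearizations over projective spaces -/

section Linear

variable {E F : Type*} [AddCommGroup E] [Module ℂ E] [AddCommGroup F] [Module ℂ F]

theorem comp_mem_polyFun' (f : E →ₗ[ℂ] F) {p : F → ℂ} (hp : p ∈ polyFun F) :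
    p ∘ f ∈ polyFun E := by
  induction hp using Algebra.adjoin_induction with
  | mem x hx =>
    obtain ⟨φ, rfl⟩ := hx
    exact Algebra.subset_adjoin ⟨φ.comp f, rfl⟩
  | algebraMap r => exact (polyFun E).algebraMap_mem r
  | add x y _ _ hx hy => exact (polyFun E).add_mem hx hy
  | mul x y _ _ hx hy => exact (polyFun E).mul_mem hx hy

theorem exists_frame {k : ℕ} (hk : 0 < k) (P : Gr k E) :
    ∃ (w : Fin k → E) (hw : LinearIndependent ℂ w), Gr.ofFrame w hw = P := by
  have : FiniteDimensional ℂ P.1 := Module.finite_of_finrank_pos (P.2.symm ▸ hk)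
  let b := Module.finBasisOfFinrankEq ℂ P.1 P.2
  have hw : LinearIndependent ℂ (fun i => (b i : E)) :=
    b.linearIndependent.map' P.1.subtype P.1.ker_subtype
  refine ⟨_, hw, Subtype.ext ?_⟩
  change Submodule.span ℂ (Set.range (P.1.subtype ∘ b)) = P.1
  rw [Set.range_comp, Submodule.span_image, b.span_eq, Submodule.map_subtype_top]

variable {Γ : Type*} [Group Γ]

theorem exists_scalar_of_mem_projKernel {ρ : Representation ℂ Γ E} {g : Γ}
    (hg : g ∈ projKernel ρ) : ∃ μ : ℂ, ρ g = μ • LinearMap.id := by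
  apply LinearMap.exists_eq_smul_id_of_forall_notLinearIndependent
  intro v hv
  have hv0 : v ≠ 0 := by simpa using hv.ne_zero 0
  have hw : LinearIndependent ℂ ![v] := LinearIndependent.of_subsingleton (i := 0) (by simpa)
  have h := congrArg Subtype.val (hg (Gr.ofFrame ![v] hw))
  have h2 : ρ g v ∈ (Gr.ofFrame ![v] hw).1 := by
    rw [← h]
    exact Submodule.mem_map_of_mem (Submodule.subset_span ⟨0, rfl⟩)
  simp only [Gr.ofFrame, Matrix.range_cons, Matrix.range_empty, Set.union_empty,
    Submodule.mem_span_singleton] at h2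
  obtain ⟨c, hc⟩ := h2
  have := (LinearIndependent.pair_iff.mp hv) c (-1) (by simp [hc])
  simp at this

/-- A nonzero polynomial in the frames, whose nonvanishing forces the stabilizer to be trivial. -/
theorem exists_polyFun_of_actsAlmostFreely {ρ : Representation ℂ Γ E} {k : ℕ} (hk : 0 < k)
    {N : Subgroup Γ} (h : ActsAlmostFreely ρ k N) :
    ∃ d : polyFun (Fin k → E), d ≠ 0 ∧ ∀ w, d.1 w ≠ 0 → ∃ hw : LinearIndependent ℂ w,
      ∀ g, Gr.act ρ g (Gr.ofFrame w hw) = Gr.ofFrame w hw → g ∈ N := by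
  obtain ⟨U, ⟨S, hS, hU⟩, ⟨P, hP⟩, hfree⟩ := h
  obtain ⟨w, hw, rfl⟩ := exists_frame hk P
  have hwU : w ∈ {w : Fin k → E | ∃ hw : LinearIndependent ℂ w, Gr.ofFrame w hw ∈ U} := ⟨hw, hP⟩
  rw [hU] at hwU
  obtain ⟨p, hp, hpw⟩ := hwU
  refine ⟨⟨p, hS hp⟩, fun h => hpw (congrFun (congrArg Subtype.val h) w), fun w hw => ?_⟩
  have : w ∈ {w : Fin k → E | ∃ hw : LinearIndependent ℂ w, Gr.ofFrame w hw ∈ U} := by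
    rw [hU]
    exact ⟨p, hp, hw⟩
  obtain ⟨hw', hwU⟩ := this
  exact ⟨hw', hfree _ hwU⟩

/-- The same for lines, in terms of their nonzero vectors. -/
theorem exists_polyFun_of_actsAlmostFreely_one {ρ : Representation ℂ Γ E}
    {N : Subgroup Γ} (h : ActsAlmostFreely ρ 1 N) :
    ∃ d : polyFun E, d ≠ 0 ∧ ∀ v, d.1 v ≠ 0 → v ≠ 0 ∧
      ∀ g, ∀ c : ℂ, ρ g v = c • v → g ∈ N := by
  obtain ⟨d, hd0, hd⟩ := exists_polyFun_of_actsAlmostFreely one_pos h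
  let f : E →ₗ[ℂ] (Fin 1 → E) := LinearMap.pi fun _ => LinearMap.id
  refine ⟨⟨d.1 ∘ f, comp_mem_polyFun' f d.2⟩, fun h => hd0 (Subtype.ext (funext fun w => ?_)),
    fun v hv => ?_⟩
  · have : w = f (w 0) := by
      ext i
      rw [Subsingleton.elim i 0]; rfl
    rw [this]
    exact congrFun (congrArg Subtype.val h) (w 0)
  · obtain ⟨hw, hfree⟩ := hd (f v) hv
    have hv0 : v ≠ 0 := hw.ne_zero 0
    refine ⟨hv0, fun g c hg => hfree g ?_⟩
    have hc : c ≠ 0 := by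
      rintro rfl
      rw [zero_smul] at hg
      exact hv0 ((ρ.apply_bijective g).1 (hg.trans (map_zero _).symm))
    apply Subtype.ext
    change Submodule.map (ρ g) (Submodule.span ℂ (Set.range (f v))) =
      Submodule.span ℂ (Set.range (f v))
    have : Set.range (f v) = {v} := by
      ext x; simp [f, eq_comm]
    rw [this, Submodule.map_span, Set.image_singleton, hg,
      Submodule.span_singleton_smul_eq (IsUnit.mk0 c hc)]

variable {G : Over (Spec (CommRingCat.of ℂ))} [GrpObj G]

theorem exists_toMatrix_eq_evalAt {κ : Type*} [Fintype κ] [DecidableEq κ]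
    {σ : Representation ℂ (Points G) F}
    (hσ : IsAlgebraicRep σ) (b : Module.Basis κ ℂ F) :
    ∃ f : κ → κ → Γ(G.left, ⊤), ∀ g i j, LinearMap.toMatrix b b (σ g) i j = evalAt ⊤ (f i j) g := by
  have h (i j) := hσ (b j) (b.coord i)
  choose f hf using h
  refine ⟨f, fun g i j => ?_⟩
  rw [← hf, LinearMap.toMatrix_apply]
  rfl

variable {ι κ : Type*} [Fintype ι] [DecidableEq ι] [Fintype κ] [DecidableEq κ]

/-- A generic frame of the trivial bundle `F` over `ℙE` that is invariant under the group, which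
exists since the stabilizers of general points act trivially on `F ⊗ 𝒪(-1)`. -/
theorem exists_linear_frame [FiniteDimensional ℂ E] [LocallyOfFiniteType G.hom] [QuasiCompact G.hom]
    {ρ : Representation ℂ (Points G) E} (hρ : IsAlgebraicRep ρ)
    {σ : Representation ℂ (Points G) F} (hσ : IsAlgebraicRep σ)
    {N : Subgroup (Points G)} (hfree : ActsAlmostFreely ρ 1 N)
    (hN : ∀ g ∈ N, ∃ μ : ℂ, ρ g = μ • LinearMap.id ∧ σ g = μ • LinearMap.id)
    (b : Module.Basis ι ℂ E) (b' : Module.Basis κ ℂ F) :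
    ∃ T : Matrix κ κ (RatFun E), IsUnit T.det ∧ ∀ x : ℂˣ × Points G,
      T.map (ratPullback (scaled ρ) x) *
        (LinearMap.toMatrix b' b' (scaled σ x)).map (algebraMap ℂ (RatFun E)) = T := by
  let _ := (MvPolynomial.aeval (R := ℂ) (ratCoord b)).toRingHom.toAlgebra
  have : IsFractionRing (MvPolynomial ι ℂ) (RatFun E) := isFractionRing_of_generates
    (algebraicIndependent_ratCoord b) (generates_ratCoord b)
  have hX (i : ι) : algebraMap (MvPolynomial ι ℂ) (RatFun E) (.X i) = ratCoord b i :=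
    MvPolynomial.aeval_X _ _
  have hCc (r : ℂ) : algebraMap (MvPolynomial ι ℂ) (RatFun E) (.C r) = algebraMap ℂ (RatFun E) r :=
    MvPolynomial.aeval_C _ _
  have : IsScalarTower ℂ (MvPolynomial ι ℂ) (RatFun E) := .of_algebraMap_eq fun r => (hCc r).symm
  obtain ⟨f, hf⟩ := exists_toMatrix_eq_evalAt hρ b
  obtain ⟨f', hf'⟩ := exists_toMatrix_eq_evalAt hσ b'
  obtain ⟨s, hs, hcov⟩ := exists_affine_cover G
  obtain ⟨d, hd0, hd⟩ := exists_polyFun_of_actsAlmostFreely_one hfree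
  let J := {U // U ∈ s}
  -- affine pieces of `𝔾ₘ × G`, or rather of `𝔸¹ × G`: polynomials in the homothety factor `lam`
  let O (j : J) : Type := Polynomial Γ(G.left, j.1)
  let _ (j : J) : CommRing (O j) := inferInstanceAs (CommRing (Polynomial _))
  let _ (j : J) : Algebra ℂ (O j) := inferInstanceAs (Algebra ℂ (Polynomial _))
  have (j : J) : Algebra.FiniteType ℂ (O j) := by
    have := finiteType_sections (hs j.1 j.2)
    exact Algebra.FiniteType.trans (S := Γ(G.left, j.1)) inferInstance
      (inferInstanceAs (Algebra.FiniteType _ (Polynomial _)))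
  let lam (j : J) : O j := Polynomial.X
  let cst (j : J) : Γ(G.left, j.1) →ₐ[ℂ] O j := (Algebra.ofId _ (Polynomial _)).restrictScalars ℂ
  let r (j : J) (u : Γ(G.left, ⊤)) : O j :=
    cst j (G.left.presheaf.map (homOfLE (le_top : j.1 ≤ ⊤)).op u)
  let pt (j : J) (y : O j →ₐ[ℂ] ℂ) : Points G := pointOf (hs j.1 j.2) (y.comp (cst j))
  have hr (j : J) (y : O j →ₐ[ℂ] ℂ) (u) : y (r j u) = evalAt ⊤ u (pt j y) :=
    (evalAt_top_pointOf (hs j.1 j.2) (y.comp (cst j)) u).symm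
  open Classical in
  let π (j : J) (y : O j →ₐ[ℂ] ℂ) : ℂˣ × Points G :=
    if h : y (lam j) ≠ 0 then (Units.mk0 _ h, pt j y) else 1
  have hπ (j : J) (y : O j →ₐ[ℂ] ℂ) (h : y (lam j) ≠ 0) : π j y = (Units.mk0 _ h, pt j y) :=
    dif_pos h
  let c (x : ℂˣ × Points G) : Matrix κ κ (RatFun E) :=
    (LinearMap.toMatrix b' b' (scaled σ x)).map (algebraMap ℂ (RatFun E))
  have hc1 : c 1 = 1 := by
    simp only [c, map_one, LinearMap.toMatrix_one]
    exact Matrix.map_one _ (map_zero _) (map_one _)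
  have hcmul (x y) : c (x * y) = (c x).map (ratPullback (scaled ρ) y) * c y := by
    simp only [c, map_mul, LinearMap.toMatrix_mul, Matrix.map_map]
    rw [Matrix.map_mul]
    congr 2
    ext i
    simp
  have hmat (x : ℂˣ × Points G) (i j) : LinearMap.toMatrix b' b' (scaled σ x) i j =
      (x.1 : ℂ) * LinearMap.toMatrix b' b' (σ x.2) i j := by
    rw [LinearMap.toMatrix_apply, scaled_apply]
    simp [LinearMap.toMatrix_apply]
  have hmat' (x : ℂˣ × Points G) (i j) : LinearMap.toMatrix b b (scaled ρ x) i j =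
      (x.1 : ℂ) * LinearMap.toMatrix b b (ρ x.2) i j := by
    rw [LinearMap.toMatrix_apply, scaled_apply]
    simp [LinearMap.toMatrix_apply]
  -- the denominator `lam` excludes the value zero of the homothety factor
  have key := exists_mem_orbitSpan (s := κ × κ)
    (fun x => (ratPullback (scaled ρ) x : RatFun E →ₐ[ℂ] RatFun E)) π
    (fun j i => ∑ k, .C (lam j * (lam j * r j (f i k))) * .X k) (fun j => .C (lam j))
    (fun i j => .C (lam j * (lam j * r j (f' i.1 i.2)))) (d := (polyEquiv b).symm d)
    (by simpa using hd0) (fun i x => c x i.1 i.2) ?_ ?_ ?_ ?_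
  · obtain ⟨q, hq, hq0, H⟩ := key
    exact exists_coboundary (τ := fun x => (ratPullback (scaled ρ) x : RatFun E →+* RatFun E))
      (ratPullback_one _) (ratPullback_mul _) hc1 hcmul hq hq0 fun i j => H (i, j)
  · intro j y hy i
    have hy' : y (lam j) ≠ 0 := by simpa using hy
    rw [hX, hπ j y hy']
    change ratPullback (scaled ρ) _ _ * _ = _
    rw [ratPullback_ratCoord]
    simp only [hmat', hf, MvPolynomial.map_C, RingHom.coe_coe, hCc, map_sum, map_mul, hr,
      MvPolynomial.map_X, hX, Finset.sum_mul, Units.val_mk0]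
    exact Finset.sum_congr rfl fun k _ => by ring
  · intro j y hy i
    have hy' : y (lam j) ≠ 0 := by simpa using hy
    simp only [c, Matrix.map_apply, hmat, hf', hπ j y hy', MvPolynomial.map_C, RingHom.coe_coe, hCc,
      map_mul, hr, Units.val_mk0]
    ring
  · rintro ⟨l, g⟩
    obtain ⟨U, hU, hgU⟩ := hcov g.pt
    let y : O ⟨U, hU⟩ →ₐ[ℂ] ℂ :=
      { Polynomial.eval₂RingHom (evalAlgHom U g hgU : Γ(G.left, U) →+* ℂ) l with
        commutes' := fun r => by
          have : algebraMap ℂ (O ⟨U, hU⟩) r = Polynomial.C (algebraMap ℂ Γ(G.left, U) r) := rfl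
          simp [this] }
    have hyl : y (lam ⟨U, hU⟩) = l := Polynomial.eval₂_X _ _
    have hyc : y.comp (cst ⟨U, hU⟩) = evalAlgHom U g hgU := by
      ext u
      exact Polynomial.eval₂_C _ _
    have hne : y (lam ⟨U, hU⟩) ≠ 0 := by simp [hyl]
    refine ⟨⟨U, hU⟩, y, ?_, by simpa using hne⟩
    rw [hπ _ _ hne]
    refine Prod.ext (Units.ext hyl) ?_
    change pointOf (hs U hU) (y.comp (cst ⟨U, hU⟩)) = _
    rw [hyc, pointOf_evalAlgHom]
  · intro j j' y y' z hdz hD hD' hP i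
    simp only [MvPolynomial.eval₂_C, RingHom.coe_coe] at hD hD' ⊢
    have hv := polyEquiv_apply b ((polyEquiv b).symm d) (b.equivFun.symm z)
    rw [AlgEquiv.apply_symm_apply] at hv
    have hz : (fun i => b.repr (b.equivFun.symm z) i) = z := b.equivFun.apply_symm_apply z
    rw [hz] at hv
    obtain ⟨hv0, hvf⟩ := hd _ (hv ▸ hdz)
    set v := b.equivFun.symm z with hvdef
    -- the two group elements have the same effect on the vector `v`
    have key : y (lam j) • ρ (pt j y) v = y' (lam j') • ρ (pt j' y') v := by
      apply b.repr.injective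
      ext k
      have := hP k
      simp only [MvPolynomial.eval₂_sum, MvPolynomial.eval₂_mul, MvPolynomial.eval₂_C,
        MvPolynomial.eval₂_X, RingHom.coe_coe, map_mul, hr, ← hf, mul_assoc, ← Finset.mul_sum,
        mul_div_cancel_left₀ _ hD, mul_div_cancel_left₀ _ hD'] at this
      rw [map_smul, map_smul, Finsupp.smul_apply, Finsupp.smul_apply,
        ← LinearMap.toMatrix_mulVec_repr b b, ← LinearMap.toMatrix_mulVec_repr b b]
      simpa [Matrix.mulVec, dotProduct, hz] using this
    -- `g` fixes the line through `v`, hence acts by the same scalar `μ` on `E` and `F`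
    let g := (pt j' y')⁻¹ * pt j y
    have hg : ρ g v = (y' (lam j') / y (lam j)) • v := by
      have h2 : ρ (pt j y) v = (y' (lam j') / y (lam j)) • ρ (pt j' y') v := by
        rw [div_eq_inv_mul, mul_smul, ← key, smul_smul, inv_mul_cancel₀ hD, one_smul]
      rw [map_mul, Module.End.mul_apply, h2, map_smul, ← Module.End.mul_apply, ← map_mul]
      simp
    obtain ⟨μ, h1, h2⟩ := hN g (hvf g _ hg)
    have hμ : y' (lam j') = μ * y (lam j) := by
      rw [h1] at hg
      have : (μ - y' (lam j') / y (lam j)) • v = 0 := by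
        rw [sub_smul, ← hg]; simp
      rcases smul_eq_zero.mp this with h | h
      · rw [sub_eq_zero] at h
        rw [h, div_mul_cancel₀ _ hD]
      · exact absurd h hv0
    have hσg : σ (pt j y) = μ • σ (pt j' y') := by
      have : pt j y = pt j' y' * g := by simp [g]
      rw [this, map_mul, h2]
      ext v
      simp
    simp only [map_mul, hr, ← hf', mul_div_cancel_left₀ _ hD, mul_div_cancel_left₀ _ hD']
    rw [hσg, hμ, map_smul, Matrix.smul_apply, smul_eq_mul]
    ring

end Linear

/-! ### Values of rational functions at general points -/

section Generic

variable (ι : Type*)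

/-- The filter of the sets of points of affine space that contain a nonempty Zariski open set. -/
def generic : Filter (ι → ℂ) where
  sets := {S | ∃ d : MvPolynomial ι ℂ, d ≠ 0 ∧ ∀ z, MvPolynomial.eval z d ≠ 0 → z ∈ S}
  univ_sets := ⟨1, one_ne_zero, fun _ _ => trivial⟩
  sets_of_superset := fun ⟨d, hd, h⟩ hST => ⟨d, hd, fun z hz => hST (h z hz)⟩
  inter_sets := fun ⟨d, hd, h⟩ ⟨d', hd', h'⟩ => ⟨d * d', mul_ne_zero hd hd', fun z hz => by
    rw [map_mul] at hz
    exact ⟨h z (left_ne_zero_of_mul hz), h' z (right_ne_zero_of_mul hz)⟩⟩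

variable {ι}

theorem eventually_generic_iff {S : (ι → ℂ) → Prop} : (∀ᶠ z in generic ι, S z) ↔
    ∃ d : MvPolynomial ι ℂ, d ≠ 0 ∧ ∀ z, MvPolynomial.eval z d ≠ 0 → S z := Iff.rfl

theorem eventually_eval_ne_zero {q : MvPolynomial ι ℂ} (hq : q ≠ 0) :
    ∀ᶠ z in generic ι, MvPolynomial.eval z q ≠ 0 := ⟨q, hq, fun _ h => h⟩

theorem eq_of_eventually_eval_eq [Finite ι] {p q : MvPolynomial ι ℂ}
    (h : ∀ᶠ z in generic ι, MvPolynomial.eval z p = MvPolynomial.eval z q) : p = q := by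
  obtain ⟨d, hd, h⟩ := h
  rw [← sub_eq_zero]
  refine (mul_eq_zero.mp (?_ : d * (p - q) = 0)).resolve_left hd
  apply MvPolynomial.funext
  intro z
  by_cases hz : MvPolynomial.eval z d = 0
  · simp [hz]
  · have : MvPolynomial.eval z p = MvPolynomial.eval z q := h z hz
    simp [this]

instance [Finite ι] : (generic ι).NeBot := by
  refine ⟨fun h => ?_⟩
  have : ∀ᶠ z in generic ι, MvPolynomial.eval z (0 : MvPolynomial ι ℂ) = MvPolynomial.eval z 1 := by
    simp [h]
  exact zero_ne_one (eq_of_eventually_eval_eq this)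

variable {K : Type*} [Field K] [Algebra ℂ K] (x : ι → K)

/-- The element `u` of the field generated by the coordinates `x` takes at a general point `z` the
value `f z`. -/
def HasVal (u : K) (f : (ι → ℂ) → ℂ) : Prop :=
  ∃ p q : MvPolynomial ι ℂ, q ≠ 0 ∧ u * MvPolynomial.aeval x q = MvPolynomial.aeval x p ∧
    ∀ᶠ z in generic ι, f z * MvPolynomial.eval z q = MvPolynomial.eval z p

variable {x} {u u' : K} {f f' : (ι → ℂ) → ℂ}

theorem HasVal.poly (p : MvPolynomial ι ℂ) :
    HasVal x (MvPolynomial.aeval x p) (fun z => MvPolynomial.eval z p) :=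
  ⟨p, 1, one_ne_zero, by simp, by simp⟩

theorem HasVal.congr (h : HasVal x u f) (h' : ∀ᶠ z in generic ι, f z = f' z) : HasVal x u f' := by
  obtain ⟨p, q, hq, h1, h2⟩ := h
  refine ⟨p, q, hq, h1, ?_⟩
  filter_upwards [h', h2] with z hz hz'
  rwa [← hz]

theorem HasVal.add (h : HasVal x u f) (h' : HasVal x u' f') :
    HasVal x (u + u') (fun z => f z + f' z) := by
  obtain ⟨p, q, hq, h1, h2⟩ := h
  obtain ⟨p', q', hq', h1', h2'⟩ := h'
  refine ⟨p * q' + p' * q, q * q', mul_ne_zero hq hq', ?_, ?_⟩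
  · simp only [map_mul, map_add, ← h1, ← h1']; ring
  · filter_upwards [h2, h2'] with z hz hz'
    simp only [map_mul, map_add, ← hz, ← hz']; ring

theorem HasVal.mul (h : HasVal x u f) (h' : HasVal x u' f') :
    HasVal x (u * u') (fun z => f z * f' z) := by
  obtain ⟨p, q, hq, h1, h2⟩ := h
  obtain ⟨p', q', hq', h1', h2'⟩ := h'
  refine ⟨p * p', q * q', mul_ne_zero hq hq', ?_, ?_⟩
  · simp only [map_mul, ← h1, ← h1']; ring
  · filter_upwards [h2, h2'] with z hz hz'
    simp only [map_mul, ← hz, ← hz']; ring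

theorem HasVal.unique [Finite ι] (hx : AlgebraicIndependent ℂ x) (h : HasVal x u f) (h' : HasVal x u' f) :
    u = u' := by
  obtain ⟨p, q, hq, h1, h2⟩ := h
  obtain ⟨p', q', hq', h1', h2'⟩ := h'
  have hne {q : MvPolynomial ι ℂ} (hq : q ≠ 0) : MvPolynomial.aeval x q ≠ 0 := fun h0 =>
    hq (hx (h0.trans (map_zero _).symm))
  have : p * q' = p' * q := by
    apply eq_of_eventually_eval_eq
    filter_upwards [h2, h2'] with z hz hz'
    rw [map_mul, map_mul, ← hz, ← hz']; ring
  apply mul_right_cancel₀ (mul_ne_zero (hne hq) (hne hq'))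
  calc u * (MvPolynomial.aeval x q * MvPolynomial.aeval x q') =
      MvPolynomial.aeval x (p * q') := by rw [map_mul, ← h1]; ring
    _ = _ := by rw [this, map_mul, ← h1']; ring

theorem HasVal.eventually_ne_zero (h : HasVal x u f) (hu : u ≠ 0)
    (hx : AlgebraicIndependent ℂ x) : ∀ᶠ z in generic ι, f z ≠ 0 := by
  obtain ⟨p, q, hq, h1, h2⟩ := h
  have hp : p ≠ 0 := by
    rintro rfl
    rw [map_zero] at h1
    rcases mul_eq_zero.mp h1 with h | h
    · exact hu h
    · exact hq (hx (h.trans (map_zero _).symm))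
  filter_upwards [h2, eventually_eval_ne_zero hp] with z hz hz' h0
  rw [h0, zero_mul] at hz
  exact hz' hz.symm

theorem HasVal.inv (h : HasVal x u f) (hu : u ≠ 0) (hx : AlgebraicIndependent ℂ x) :
    HasVal x u⁻¹ (fun z => (f z)⁻¹) := by
  have h0 := h.eventually_ne_zero hu hx
  obtain ⟨p, q, hq, h1, h2⟩ := h
  have hp : p ≠ 0 := by
    rintro rfl
    rw [map_zero] at h1
    rcases mul_eq_zero.mp h1 with h | h
    · exact hu h
    · exact hq (hx (h.trans (map_zero _).symm))
  refine ⟨q, p, hp, ?_, ?_⟩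
  · rw [← h1, inv_mul_cancel_left₀ hu]
  · filter_upwards [h2, h0] with z hz hz'
    rw [← hz, inv_mul_cancel_left₀ hz']

theorem HasVal.aeval {κ : Type*} {y : κ → K} {φ : (ι → ℂ) → κ → ℂ}
    (h : ∀ i, HasVal x (y i) (fun z => φ z i)) (p : MvPolynomial κ ℂ) :
    HasVal x (MvPolynomial.aeval y p) (fun z => MvPolynomial.eval (φ z) p) := by
  induction p using MvPolynomial.induction_on with
  | C r => simpa using HasVal.poly (x := x) (.C r)
  | add p q hp hq => simpa using hp.add hq
  | mul_X p i hp => simpa using hp.mul (h i)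

/-- Values are compatible with substitutions. -/
theorem HasVal.comp (hx : AlgebraicIndependent ℂ x) {φ : (ι → ℂ) → ι → ℂ} {τ : K →ₐ[ℂ] K}
    (h : ∀ i, HasVal x (τ (x i)) (fun z => φ z i)) (hu : HasVal x u f) :
    HasVal x (τ u) (fun z => f (φ z)) := by
  obtain ⟨p, q, hq, h1, d, hd, h2⟩ := hu
  have hτ (p : MvPolynomial ι ℂ) :
      MvPolynomial.aeval (fun i => τ (x i)) p = τ (MvPolynomial.aeval x p) :=
    (MvPolynomial.comp_aeval_apply x τ p).symm
  have hne {q : MvPolynomial ι ℂ} (hq : q ≠ 0) : τ (MvPolynomial.aeval x q) ≠ 0 := fun h0 =>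
    hq (hx (((map_eq_zero τ).mp h0).trans (map_zero _).symm))
  have hp := HasVal.aeval h p
  have hq' := HasVal.aeval h q
  have hd' := HasVal.aeval h d
  rw [hτ] at hp hq' hd'
  have e : τ u = τ (MvPolynomial.aeval x p) * (τ (MvPolynomial.aeval x q))⁻¹ := by
    rw [eq_mul_inv_iff_mul_eq₀ (hne hq), ← map_mul, h1]
  rw [e]
  refine (hp.mul (hq'.inv (hne hq) hx)).congr ?_
  filter_upwards [hq'.eventually_ne_zero (hne hq) hx, hd'.eventually_ne_zero (hne hd) hx]
    with z hz hz'
  rw [← h2 _ hz', mul_inv_cancel_right₀ hz]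

end Generic

/-! ### The big cell of the Grassmannian -/

section Cell

variable {I M R : Type*} [Fintype M] [CommRing R]

/-- The upper block of the product of `S` and `(1; Z)`. -/
def topM (S : Matrix (I ⊕ M) (I ⊕ M) R) (Z : Matrix M I R) : Matrix I I R :=
  S.toBlocks₁₁ + S.toBlocks₁₂ * Z

/-- The lower block of the product of `S` and `(1; Z)`. -/
def botM (S : Matrix (I ⊕ M) (I ⊕ M) R) (Z : Matrix M I R) : Matrix M I R :=
  S.toBlocks₂₁ + S.toBlocks₂₂ * Z

theorem topM_map {R' : Type*} [CommRing R'] (f : R →+* R') (S : Matrix (I ⊕ M) (I ⊕ M) R)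
    (Z : Matrix M I R) : (topM S Z).map f = topM (S.map f) (Z.map f) := by
  ext i j
  simp [topM, Matrix.mul_apply, Matrix.toBlocks₁₁, Matrix.toBlocks₁₂]

theorem botM_map {R' : Type*} [CommRing R'] (f : R →+* R') (S : Matrix (I ⊕ M) (I ⊕ M) R)
    (Z : Matrix M I R) : (botM S Z).map f = botM (S.map f) (Z.map f) := by
  ext i j
  simp [botM, Matrix.mul_apply, Matrix.toBlocks₂₁, Matrix.toBlocks₂₂]

theorem topM_apply (S : Matrix (I ⊕ M) (I ⊕ M) R) (Z : Matrix M I R) (i k : I) :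
    topM S Z i k = S (.inl i) (.inl k) + ∑ μ, S (.inl i) (.inr μ) * Z μ k := rfl

theorem botM_apply (S : Matrix (I ⊕ M) (I ⊕ M) R) (Z : Matrix M I R) (μ : M) (k : I) :
    botM S Z μ k = S (.inr μ) (.inl k) + ∑ ν, S (.inr μ) (.inr ν) * Z ν k := rfl

theorem topM_mul [Fintype I] (S S' : Matrix (I ⊕ M) (I ⊕ M) R) (Z Z' : Matrix M I R)
    (h : Z' * topM S' Z = botM S' Z) : topM (S * S') Z = topM S Z' * topM S' Z := by
  have e : (S * S').toBlocks₁₁ = S.toBlocks₁₁ * S'.toBlocks₁₁ + S.toBlocks₁₂ * S'.toBlocks₂₁ := by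
    ext i j; simp [Matrix.toBlocks₁₁, Matrix.toBlocks₁₂, Matrix.toBlocks₂₁, Matrix.mul_apply]
  have e' : (S * S').toBlocks₁₂ = S.toBlocks₁₁ * S'.toBlocks₁₂ + S.toBlocks₁₂ * S'.toBlocks₂₂ := by
    ext i j; simp [Matrix.toBlocks₁₁, Matrix.toBlocks₁₂, Matrix.toBlocks₂₂, Matrix.mul_apply]
  rw [topM.eq_1 S, Matrix.add_mul, Matrix.mul_assoc S.toBlocks₁₂, h, topM, e, e', topM, botM]
  simp only [Matrix.mul_add, Matrix.add_mul, Matrix.mul_assoc]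
  abel

theorem topM_one [DecidableEq I] [DecidableEq M] (Z : Matrix M I R) : topM 1 Z = 1 := by
  ext i j
  simp [topM_apply, Matrix.one_apply]

end Cell

section Frame

variable {n : ℕ} {M W : Type*} [Fintype M] [AddCommGroup W] [Module ℂ W]
  (b : Module.Basis (Fin n ⊕ M) ℂ W)

/-- The frame `(1; z)` of a subspace in the big cell of the Grassmannian. -/
def cellFrame (z : M × Fin n → ℂ) (k : Fin n) : W :=
  b (.inl k) + ∑ μ, z (μ, k) • b (.inr μ)

theorem repr_cellFrame_inl (z : M × Fin n → ℂ) (k i : Fin n) :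
    b.repr (cellFrame b z k) (.inl i) = if i = k then 1 else 0 := by
  classical
  simp [cellFrame, Finsupp.single_apply, eq_comm]

theorem repr_cellFrame_inr (z : M × Fin n → ℂ) (k : Fin n) (μ : M) :
    b.repr (cellFrame b z k) (.inr μ) = z (μ, k) := by
  classical
  simp [cellFrame, Finsupp.single_apply, eq_comm]

theorem linearIndependent_cellFrame (z : M × Fin n → ℂ) :
    LinearIndependent ℂ (cellFrame b z) := by
  rw [Fintype.linearIndependent_iff]
  intro g hg i
  have := congrArg (fun v => b.repr v (.inl i)) hg
  simpa [repr_cellFrame_inl] using this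

/-- The points of the big cell of the Grassmannian. -/
def cell (z : M × Fin n → ℂ) : Gr n W :=
  Gr.ofFrame (cellFrame b z) (linearIndependent_cellFrame b z)

/-- The upper block of the coordinate matrix of a tuple of vectors. -/
def frameTop (w : Fin n → W) : Matrix (Fin n) (Fin n) ℂ :=
  Matrix.of fun i k => b.repr (w k) (.inl i)

/-- The lower block of the coordinate matrix of a tuple of vectors. -/
def frameBot (w : Fin n → W) : Matrix M (Fin n) ℂ :=
  Matrix.of fun μ k => b.repr (w k) (.inr μ)

theorem ofFrame_eq_of_mul {w w' : Fin n → W} (hw : LinearIndependent ℂ w)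
    (hw' : LinearIndependent ℂ w') (A : Matrix (Fin n) (Fin n) ℂ)
    (h : ∀ k, w k = ∑ i, A i k • w' i) : Gr.ofFrame w hw = Gr.ofFrame w' hw' := by
  apply Subtype.ext
  have : FiniteDimensional ℂ (Gr.ofFrame w' hw').1 :=
    FiniteDimensional.span_of_finite ℂ (Set.finite_range w')
  apply Submodule.eq_of_le_of_finrank_eq
  · refine Submodule.span_le.mpr ?_
    rintro _ ⟨k, rfl⟩
    change w k ∈ Submodule.span ℂ (Set.range w')
    rw [h]
    exact Submodule.sum_mem _ fun i _ => Submodule.smul_mem _ _ (Submodule.subset_span ⟨i, rfl⟩)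
  · exact (Gr.ofFrame w hw).2.trans (Gr.ofFrame w' hw').2.symm

theorem ofFrame_eq_cell {w : Fin n → W} (hw : LinearIndependent ℂ w) {z : M × Fin n → ℂ}
    (h : (Matrix.of fun μ k => z (μ, k)) * frameTop b w = frameBot b w) :
    Gr.ofFrame w hw = cell b z := by
  refine ofFrame_eq_of_mul hw _ (frameTop b w) fun k => ?_
  apply b.repr.injective
  ext i
  rcases i with i | μ
  · simp [repr_cellFrame_inl, frameTop]
  · have := congrFun (congrFun h μ) k
    rw [Matrix.mul_apply] at this
    simpa [repr_cellFrame_inr, frameTop, frameBot, mul_comm] using this.symm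

variable {Γ : Type*} [Group Γ] (σ : Representation ℂ Γ W)

theorem frameTop_act [DecidableEq M] (g : Γ) (z : M × Fin n → ℂ) :
    frameTop b (fun k => σ g (cellFrame b z k)) =
      topM (LinearMap.toMatrix b b (σ g)) (Matrix.of fun μ k => z (μ, k)) := by
  ext i k
  rw [frameTop, Matrix.of_apply, ← LinearMap.toMatrix_mulVec_repr b b, topM_apply]
  simp [Matrix.mulVec, dotProduct, repr_cellFrame_inl, repr_cellFrame_inr]

theorem frameBot_act [DecidableEq M] (g : Γ) (z : M × Fin n → ℂ) :
    frameBot b (fun k => σ g (cellFrame b z k)) =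
      botM (LinearMap.toMatrix b b (σ g)) (Matrix.of fun μ k => z (μ, k)) := by
  ext i k
  rw [frameBot, Matrix.of_apply, ← LinearMap.toMatrix_mulVec_repr b b, botM_apply]
  simp [Matrix.mulVec, dotProduct, repr_cellFrame_inl, repr_cellFrame_inr]

theorem act_ofFrame (g : Γ) {w : Fin n → W} (hw : LinearIndependent ℂ w) :
    Gr.act σ g (Gr.ofFrame w hw) = Gr.ofFrame (fun k => σ g (w k))
      (hw.map' (σ g) (LinearMap.ker_eq_bot.mpr (σ.apply_bijective g).1)) := by
  apply Subtype.ext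
  change Submodule.map (σ g) (Submodule.span ℂ (Set.range w)) = Submodule.span ℂ _
  rw [Submodule.map_span, ← Set.range_comp]
  rfl

theorem act_cell [DecidableEq M] (g : Γ) {z z' : M × Fin n → ℂ}
    (h : (Matrix.of fun μ k => z' (μ, k)) * topM (LinearMap.toMatrix b b (σ g))
      (Matrix.of fun μ k => z (μ, k)) = botM (LinearMap.toMatrix b b (σ g))
        (Matrix.of fun μ k => z (μ, k))) :
    Gr.act σ g (cell b z) = cell b z' := by
  rw [cell, act_ofFrame]
  refine ofFrame_eq_cell b _ ?_
  rw [frameTop_act, frameBot_act, h]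

/-- Polynomial functions become polynomials after a polynomial substitution. -/
theorem exists_poly_comp {ι F : Type*} [AddCommGroup F] [Module ℂ F] {φ : (ι → ℂ) → F}
    (hφ : ∀ l : Module.Dual ℂ F, ∃ P : MvPolynomial ι ℂ, ∀ z, l (φ z) = MvPolynomial.eval z P)
    {p : F → ℂ} (hp : p ∈ polyFun F) :
    ∃ P : MvPolynomial ι ℂ, ∀ z, p (φ z) = MvPolynomial.eval z P := by
  induction hp using Algebra.adjoin_induction with
  | mem x hx =>
    obtain ⟨l, rfl⟩ := hx
    exact hφ l
  | algebraMap r => exact ⟨.C r, fun z => by simp⟩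
  | add x y _ _ hx hy =>
    obtain ⟨P, hP⟩ := hx
    obtain ⟨Q, hQ⟩ := hy
    exact ⟨P + Q, fun z => by simp [hP, hQ]⟩
  | mul x y _ _ hx hy =>
    obtain ⟨P, hP⟩ := hx
    obtain ⟨Q, hQ⟩ := hy
    exact ⟨P * Q, fun z => by simp [hP, hQ]⟩

theorem exists_poly_cellFrame {p : (Fin n → W) → ℂ} (hp : p ∈ polyFun (Fin n → W)) :
    ∃ P : MvPolynomial (M × Fin n) ℂ, ∀ z, p (cellFrame b z) = MvPolynomial.eval z P := by
  classical
  refine exists_poly_comp (fun l => ?_) hp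
  have hl (w : Fin n → W) : l w = ∑ k, l (Pi.single k (w k)) := by
    rw [← map_sum, Finset.univ_sum_single]
  refine ⟨∑ k, (.C (l (Pi.single k (b (.inl k)))) +
    ∑ μ, .X (μ, k) * .C (l (Pi.single k (b (.inr μ))))), fun z => ?_⟩
  rw [hl, map_sum]
  refine Finset.sum_congr rfl fun k _ => ?_
  have : l (Pi.single k (cellFrame b z k)) = (l ∘ₗ LinearMap.single ℂ (fun _ => W) k)
    (cellFrame b z k) := rfl
  rw [this, cellFrame, map_add, map_sum]
  simp

variable {H : Over (Spec (CommRingCat.of ℂ))}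

theorem exists_poly_prodFun_cellFrame {U : H.left.Opens} (hU : IsAffineOpen U)
    {p : Points H × (Fin n → W) → ℂ} (hp : p ∈ prodFun (H := H) (Fin n → W) U) :
    ∃ P : MvPolynomial (M × Fin n) Γ(H.left, U), ∀ (y : Γ(H.left, U) →ₐ[ℂ] ℂ) z,
      p (pointOf hU y, cellFrame b z) = MvPolynomial.eval₂ (y : Γ(H.left, U) →+* ℂ) z P := by
  induction hp using Algebra.adjoin_induction with
  | mem x hx =>
    rcases hx with ⟨f, rfl⟩ | ⟨q, rfl⟩
    · exact ⟨.C f, fun y z => by simp [evalAt_pointOf]⟩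
    · obtain ⟨P, hP⟩ := exists_poly_cellFrame b q.2
      refine ⟨MvPolynomial.map (algebraMap ℂ Γ(H.left, U)) P, fun y z => ?_⟩
      have : (y : Γ(H.left, U) →+* ℂ).comp (algebraMap ℂ Γ(H.left, U)) = RingHom.id ℂ := by
        ext r; exact y.commutes r
      rw [MvPolynomial.eval₂_map, this]
      exact hP z
  | algebraMap r => exact ⟨.C (algebraMap ℂ _ r), fun y z => by simp⟩
  | add x y _ _ hx hy =>
    obtain ⟨P, hP⟩ := hx
    obtain ⟨Q, hQ⟩ := hy
    exact ⟨P + Q, fun y z => by simp [hP, hQ]⟩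
  | mul x y _ _ hx hy =>
    obtain ⟨P, hP⟩ := hx
    obtain ⟨Q, hQ⟩ := hy
    exact ⟨P * Q, fun y z => by simp [hP, hQ]⟩

/-- A nonempty open subset of the Grassmannian contains a general point of the big cell. -/
theorem eventually_cell_mem [FiniteDimensional ℂ W] {U : Set (Gr n W)} (hU : Gr.IsOpen U)
    (hne : U.Nonempty) (hn : 0 < n) : ∀ᶠ z in generic (M × Fin n), cell b z ∈ U := by
  obtain ⟨S, hS, hUS⟩ := hU
  obtain ⟨P, hP⟩ := hne
  obtain ⟨w, hw, rfl⟩ := exists_frame hn P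
  have hwU : w ∈ {w : Fin n → W | ∃ hw : LinearIndependent ℂ w, Gr.ofFrame w hw ∈ U} := ⟨hw, hP⟩
  rw [hUS] at hwU
  obtain ⟨p, hp, hpw⟩ := hwU
  let D : (Fin n → W) → ℂ := fun w => (frameTop b w).det
  have hD : D ∈ polyFun (Fin n → W) := by
    have : D = ∑ s : Equiv.Perm (Fin n), (Equiv.Perm.sign s : ℤ) •
        ∏ i, fun w : Fin n → W => b.repr (w i) (.inl (s i)) := by
      ext w
      simp [D, Matrix.det_apply, frameTop, Units.smul_def]
    rw [this]
    have hc (i j) : (fun w : Fin n → W => b.repr (w i) (.inl j)) ∈ polyFun (Fin n → W) :=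
      Algebra.subset_adjoin ⟨(b.coord (.inl j)) ∘ₗ LinearMap.proj i, rfl⟩
    exact Subalgebra.sum_mem _ fun s _ => Subalgebra.zsmul_mem _ (Subalgebra.prod_mem _
      fun i _ => hc i (s i)) _
  have hne : (⟨p, hS hp⟩ : polyFun (Fin n → W)) * ⟨D, hD⟩ ≠ 0 := by
    refine mul_ne_zero (fun h => hpw (congrFun (congrArg Subtype.val h) w)) fun h => ?_
    have h1 : D (cellFrame b 0) = 0 := congrFun (congrArg Subtype.val h) _
    have h2 : frameTop b (cellFrame b 0) = 1 := by
      ext i k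
      simp [frameTop, repr_cellFrame_inl, Matrix.one_apply]
    simp [D, h2] at h1
  -- a frame in `U` with invertible upper block
  obtain ⟨w₁, hw₁⟩ : ∃ w, p w * D w ≠ 0 := by
    by_contra! h
    exact hne (Subtype.ext (funext h))
  have hw₁U : w₁ ∈ {w : Fin n → W | ∃ hw : LinearIndependent ℂ w, Gr.ofFrame w hw ∈ U} := by
    rw [hUS]
    exact ⟨p, hp, left_ne_zero_of_mul hw₁⟩
  obtain ⟨hw₁i, hw₁U⟩ := hw₁U
  let Z := frameBot b w₁ * (frameTop b w₁)⁻¹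
  have hcell : Gr.ofFrame w₁ hw₁i = cell b (fun i => Z i.1 i.2) := by
    refine ofFrame_eq_cell b _ ?_
    change Z * _ = _
    rw [Matrix.mul_assoc, Matrix.nonsing_inv_mul _ (isUnit_iff_ne_zero.mpr
      (right_ne_zero_of_mul hw₁)), Matrix.mul_one]
  have hz₁ : cellFrame b (fun i => Z i.1 i.2) ∈
      {w : Fin n → W | ∃ hw : LinearIndependent ℂ w, Gr.ofFrame w hw ∈ U} :=
    ⟨linearIndependent_cellFrame b _, by rw [hcell] at hw₁U; exact hw₁U⟩
  rw [hUS] at hz₁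
  obtain ⟨r, hr, hrz⟩ := hz₁
  obtain ⟨R, hR⟩ := exists_poly_cellFrame b (hS hr)
  refine ⟨R, fun h => hrz (by rw [hR, h, map_zero]), fun z hz => ?_⟩
  have : cellFrame b z ∈ {w : Fin n → W | ∃ hw : LinearIndependent ℂ w, Gr.ofFrame w hw ∈ U} := by
    rw [hUS]
    exact ⟨r, hr, by rwa [hR]⟩
  exact this.2

theorem isOpen_preimage_act {U : Set (Gr n W)} (hU : Gr.IsOpen U) (g : Γ) :
    Gr.IsOpen {P | Gr.act σ g P ∈ U} := by
  obtain ⟨S, hS, hUS⟩ := hU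
  let f : (Fin n → W) →ₗ[ℂ] (Fin n → W) := LinearMap.pi fun k => (σ g) ∘ₗ LinearMap.proj k
  refine ⟨(fun p => p ∘ f) '' S, ?_, ?_⟩
  · rintro _ ⟨p, hp, rfl⟩
    exact comp_mem_polyFun' f (hS hp)
  · ext w
    have key : (∃ hw : LinearIndependent ℂ w, Gr.act σ g (Gr.ofFrame w hw) ∈ U) ↔
        f w ∈ {w : Fin n → W | ∃ hw : LinearIndependent ℂ w, Gr.ofFrame w hw ∈ U} := by
      constructor
      · rintro ⟨hw, h⟩
        rw [act_ofFrame] at h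
        exact ⟨_, h⟩
      · rintro ⟨hw, h⟩
        have hw' : LinearIndependent ℂ w := LinearIndependent.of_comp (σ g) hw
        refine ⟨hw', ?_⟩
        rw [act_ofFrame]
        exact h
    refine key.trans ?_
    rw [hUS]
    simp

end Frame

/-! ### Linearized line bundles on the Grassmannian -/

section LineBundle

theorem tmul_ne_zero {A B : Type*} [AddCommGroup A] [Module ℂ A] [AddCommGroup B] [Module ℂ B]
    {x : A} {y : B} (hx : x ≠ 0) (hy : y ≠ 0) : x ⊗ₜ[ℂ] y ≠ 0 := by
  obtain ⟨f, hf⟩ : ∃ f : Module.Dual ℂ A, f x ≠ 0 := by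
    by_contra! h
    exact hx ((Module.forall_dual_apply_eq_zero_iff ℂ x).mp h)
  obtain ⟨g, hg⟩ : ∃ g : Module.Dual ℂ B, g y ≠ 0 := by
    by_contra! h
    exact hy ((Module.forall_dual_apply_eq_zero_iff ℂ y).mp h)
  intro h
  have := congrArg (fun z => LinearMap.mul' ℂ ℂ (TensorProduct.map f g z)) h
  simp [hf, hg] at this

variable {H : Over (Spec (CommRingCat.of ℂ))} [GrpObj H] {k : ℕ} {W : Type*} [AddCommGroup W]
  [Module ℂ W] {σ : Representation ℂ (Points H) W} (L : LinearizedLineBundle k σ)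
  {U : Set (Gr k W)} {s : ∀ P, L.fib P} {t : Points H → Gr k W → ℂ}

theorem eq_of_sigma_smul_eq {Q Q' : Gr k W} {a a' : ℂ} (hs : s Q ≠ 0)
    (h : (⟨Q, a • s Q⟩ : Σ P, L.fib P) = ⟨Q', a' • s Q'⟩) : a = a' := by
  obtain rfl : Q = Q' := congrArg Sigma.fst h
  exact smul_left_injective ℂ hs (eq_of_heq (Sigma.mk.inj h).2)

/-- The action on the line bundle in a trivialization is a cocycle. -/
theorem cocycle_mul (hs : ∀ P ∈ U, s P ≠ 0)
    (ht : ∀ h P, P ∈ U → Gr.act σ h P ∈ U → L.act h P (s P) = t h P • s (Gr.act σ h P))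
    {g h : Points H} {P : Gr k W} (hP : P ∈ U) (hhP : Gr.act σ h P ∈ U)
    (hghP : Gr.act σ (g * h) P ∈ U) : t (g * h) P = t g (Gr.act σ h P) * t h P := by
  have h1 := L.act_mul g h P (s P)
  rw [ht _ _ hP hghP, ht _ _ hP hhP, map_smul, ht g _ hhP (by rwa [← Gr.act_mul]), smul_smul] at h1
  rw [eq_of_sigma_smul_eq L (hs _ hghP) h1, mul_comm]

theorem cocycle_one (hs : ∀ P ∈ U, s P ≠ 0)
    (ht : ∀ h P, P ∈ U → Gr.act σ h P ∈ U → L.act h P (s P) = t h P • s (Gr.act σ h P))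
    {P : Gr k W} (hP : P ∈ U) : t 1 P = 1 := by
  have h1 := L.act_one P (s P)
  have h2 : Gr.act σ 1 P ∈ U := by rwa [Gr.act_one]
  rw [ht _ _ hP h2] at h1
  refine eq_of_sigma_smul_eq L (s := s) (Q' := P) (hs _ h2) ?_
  rw [h1, one_smul]

theorem mul_eq_one_of_sigma_tmul_eq {Q P : Gr k W} {x' : Q.1} {x : P.1} {a μ : ℂ}
    (h : (⟨Q, x' ⊗ₜ[ℂ] (a • s Q)⟩ : Σ P : Gr k W, P.1 ⊗[ℂ] L.fib P) = ⟨P, x ⊗ₜ[ℂ] s P⟩)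
    (hx : (x' : W) = μ • (x : W)) (hx0 : x ≠ 0) (hs : s P ≠ 0) : μ * a = 1 := by
  obtain rfl : Q = P := congrArg Sigma.fst h
  have h1 := eq_of_heq (Sigma.mk.inj h).2
  have h2 : x' = μ • x := Subtype.ext hx
  rw [h2, TensorProduct.tmul_smul, TensorProduct.smul_tmul', smul_smul] at h1
  have := smul_left_injective ℂ (tmul_ne_zero hx0 hs) (h1.trans (one_smul ℂ _).symm)
  rw [← this, mul_comm]

/-- Elements that act trivially on `ℰ ⊗ L` and by a scalar on `ℰ` act by the inverse scalar
on `L`. -/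
theorem mul_cocycle_eq_one (hk : 0 < k) {N : Subgroup (Points H)} (hL : L.TwistTrivialOn N)
    (hs : ∀ P ∈ U, s P ≠ 0)
    (ht : ∀ h P, P ∈ U → Gr.act σ h P ∈ U → L.act h P (s P) = t h P • s (Gr.act σ h P))
    {g : Points H} (hg : g ∈ N) {μ : ℂ} (hμ : σ g = μ • LinearMap.id) {P : Gr k W}
    (hP : P ∈ U) (hgP : Gr.act σ g P = P) : μ * t g P = 1 := by
  have : Nontrivial P.1 := Module.nontrivial_of_finrank_pos (R := ℂ) (P.2.symm ▸ hk)
  obtain ⟨x, hx⟩ := exists_ne (0 : P.1)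
  have h1 := hL g hg P (x ⊗ₜ s P)
  rw [TensorProduct.map_tmul, ht _ _ hP (by rwa [hgP])] at h1
  exact mul_eq_one_of_sigma_tmul_eq L h1 (by change σ g x = _; rw [hμ]; rfl) hx (hs _ hP)

end LineBundle

section Refinement

variable {O S ι : Type*} [CommRing O] [Algebra ℂ O] [Algebra.FiniteType ℂ O]

/-- A variety is covered by finitely many of the open subsets where the polynomials `Q s` with
regular coefficients do not vanish identically, as soon as these cover it. -/
theorem exists_finset_forall_map_ne_zero (Q : S → MvPolynomial ι O)
    (h : ∀ y : O →ₐ[ℂ] ℂ, ∃ s, MvPolynomial.map (y : O →+* ℂ) (Q s) ≠ 0) :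
    ∃ t : Finset S, ∀ y : O →ₐ[ℂ] ℂ, ∃ s ∈ t, MvPolynomial.map (y : O →+* ℂ) (Q s) ≠ 0 := by
  let I (s : S) : Ideal O := Ideal.span (Set.range fun m => (Q s).coeff m)
  have hI (s : S) (y : O →ₐ[ℂ] ℂ) (hy : I s ≤ RingHom.ker (y : O →+* ℂ)) :
      MvPolynomial.map (y : O →+* ℂ) (Q s) = 0 := by
    ext m
    rw [MvPolynomial.coeff_map, MvPolynomial.coeff_zero]
    exact hy (Ideal.subset_span ⟨m, rfl⟩)
  have hI' (s : S) (y : O →ₐ[ℂ] ℂ) (hy : MvPolynomial.map (y : O →+* ℂ) (Q s) = 0) :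
      I s ≤ RingHom.ker (y : O →+* ℂ) := by
    refine Ideal.span_le.mpr ?_
    rintro _ ⟨m, rfl⟩
    change (y : O →+* ℂ) _ = 0
    rw [← MvPolynomial.coeff_map, hy, MvPolynomial.coeff_zero]
  have htop : (1 : O) ∈ ⨆ s, I s := by
    have hnil : IsNilpotent (1 : O ⧸ ⨆ s, I s) := by
      apply isNilpotent_of_forall_algHom
      intro χ
      obtain ⟨s, hs⟩ := h (χ.comp (Ideal.Quotient.mkₐ ℂ _))
      refine absurd (hI s _ fun x hx => ?_) hs
      change χ (Ideal.Quotient.mk _ x) = 0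
      rw [Ideal.Quotient.eq_zero_iff_mem.mpr (le_iSup I s hx), map_zero]
    obtain ⟨n, hn⟩ := hnil
    rw [one_pow] at hn
    exact Ideal.Quotient.eq_zero_iff_mem.mp hn
  obtain ⟨t, ht⟩ := Submodule.mem_iSup_iff_exists_finset.mp htop
  refine ⟨t, fun y => ?_⟩
  by_contra! hall
  have : (⨆ s ∈ t, I s) ≤ RingHom.ker (y : O →+* ℂ) := iSup₂_le fun s hs => hI' s y (hall s hs)
  have h1 : (y : O →+* ℂ) 1 = 0 := this ht
  simp at h1

end Refinement

section PolyMatrix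

variable {n : ℕ} {M R R' : Type*} [Fintype M] [CommRing R] [CommRing R']

variable (n M R) in
/-- The generic matrix of coordinates on the big cell. -/
def genericZ : Matrix M (Fin n) (MvPolynomial (M × Fin n) R) := .of fun μ k => .X (μ, k)

/-- The upper block of the product of `S` and `(1; Z)` for the generic matrix `Z`. -/
def topPoly (S : Matrix (Fin n ⊕ M) (Fin n ⊕ M) R) :
    Matrix (Fin n) (Fin n) (MvPolynomial (M × Fin n) R) := topM (S.map .C) (genericZ n M R)

/-- The lower block of the product of `S` and `(1; Z)` for the generic matrix `Z`. -/
def botPoly (S : Matrix (Fin n ⊕ M) (Fin n ⊕ M) R) :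
    Matrix M (Fin n) (MvPolynomial (M × Fin n) R) := botM (S.map .C) (genericZ n M R)

variable (S : Matrix (Fin n ⊕ M) (Fin n ⊕ M) R)

theorem topPoly_map (f : R →+* R') : (topPoly S).map (MvPolynomial.map f) = topPoly (S.map f) := by
  rw [topPoly, topM_map, topPoly]
  congr 1 <;> · ext; simp [genericZ]

theorem botPoly_map (f : R →+* R') : (botPoly S).map (MvPolynomial.map f) = botPoly (S.map f) := by
  rw [botPoly, botM_map, botPoly]
  congr 1 <;> · ext; simp [genericZ]

theorem topPoly_eval (z : M × Fin n → R) :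
    (topPoly S).map (MvPolynomial.eval z) = topM S (.of fun μ k => z (μ, k)) := by
  rw [topPoly, topM_map]
  congr 1 <;> · ext; simp [genericZ]

theorem botPoly_eval (z : M × Fin n → R) :
    (botPoly S).map (MvPolynomial.eval z) = botM S (.of fun μ k => z (μ, k)) := by
  rw [botPoly, botM_map]
  congr 1 <;> · ext; simp [genericZ]

variable {K : Type*} [CommRing K] [Algebra R K] (Z : Matrix M (Fin n) K)

theorem topPoly_aeval : (topPoly S).map (MvPolynomial.aeval fun i : M × Fin n => Z i.1 i.2) =
    topM (S.map (algebraMap R K)) Z := by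
  have := topM_map (MvPolynomial.aeval (R := R) fun i : M × Fin n => Z i.1 i.2).toRingHom
    (S.map .C) (genericZ n M R)
  refine this.trans ?_
  congr 1 <;> · ext; simp [genericZ]

theorem botPoly_aeval : (botPoly S).map (MvPolynomial.aeval fun i : M × Fin n => Z i.1 i.2) =
    botM (S.map (algebraMap R K)) Z := by
  have := botM_map (MvPolynomial.aeval (R := R) fun i : M × Fin n => Z i.1 i.2).toRingHom
    (S.map .C) (genericZ n M R)
  refine this.trans ?_
  congr 1 <;> · ext; simp [genericZ]

end PolyMatrix

/-! ### The frame of the universal subbundle -/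

section Grassmannian

variable {n : ℕ} {M W : Type*} [Fintype M] [DecidableEq M] [AddCommGroup W] [Module ℂ W]
  (b : Module.Basis (Fin n ⊕ M) ℂ W) {H : Over (Spec (CommRingCat.of ℂ))} [GrpObj H]
  {σ : Representation ℂ (Points H) W}

/-- The matrix coefficients of the representation on an affine open subset of the group. -/
def coeffMatrix (f : Fin n ⊕ M → Fin n ⊕ M → Γ(H.left, ⊤)) (A : H.left.Opens) :
    Matrix (Fin n ⊕ M) (Fin n ⊕ M) Γ(H.left, A) :=
  .of fun i j => H.left.presheaf.map (homOfLE (le_top : A ≤ ⊤)).op (f i j)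

variable {f : Fin n ⊕ M → Fin n ⊕ M → Γ(H.left, ⊤)}

theorem coeffMatrix_map (hf : ∀ g i j, LinearMap.toMatrix b b (σ g) i j = evalAt ⊤ (f i j) g)
    {A : H.left.Opens} (hA : IsAffineOpen A) (y : Γ(H.left, A) →ₐ[ℂ] ℂ) :
    (coeffMatrix f A).map (y : Γ(H.left, A) →+* ℂ) = LinearMap.toMatrix b b (σ (pointOf hA y)) := by
  ext i j
  rw [hf, evalAt_top_pointOf]
  rfl

/-- A polynomial function of frames, evaluated at the translate of `(1; z)` by a group element, is
polynomial in `z` with regular coefficients. -/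
theorem exists_poly_act_cellFrame
    (hf : ∀ g i j, LinearMap.toMatrix b b (σ g) i j = evalAt ⊤ (f i j) g)
    {A : H.left.Opens} (hA : IsAffineOpen A) {r : (Fin n → W) → ℂ}
    (hr : r ∈ polyFun (Fin n → W)) :
    ∃ R : MvPolynomial (M × Fin n) Γ(H.left, A), ∀ (y : Γ(H.left, A) →ₐ[ℂ] ℂ) z,
      r (fun k => σ (pointOf hA y) (cellFrame b z k)) =
        MvPolynomial.eval z (.map (y : Γ(H.left, A) →+* ℂ) R) := by
  classical
  induction hr using Algebra.adjoin_induction with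
  | mem x hx =>
    obtain ⟨l, rfl⟩ := hx
    have hl (w : Fin n → W) : l w = ∑ k, (∑ i, frameTop b w i k * l (Pi.single k (b (.inl i))) +
        ∑ μ, frameBot b w μ k * l (Pi.single k (b (.inr μ)))) := by
      conv_lhs => rw [← Finset.univ_sum_single w, map_sum]
      refine Finset.sum_congr rfl fun k _ => ?_
      have h1 (v : W) : l (Pi.single k v) = (l ∘ₗ LinearMap.single ℂ (fun _ => W) k) v := rfl
      rw [h1]
      conv_lhs => rw [← b.sum_repr (w k), map_sum, Fintype.sum_sum_type]
      simp [frameTop, frameBot]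
    refine ⟨∑ k, (∑ i, topPoly (coeffMatrix f A) i k *
        .C (algebraMap ℂ _ (l (Pi.single k (b (.inl i))))) +
      ∑ μ, botPoly (coeffMatrix f A) μ k * .C (algebraMap ℂ _ (l (Pi.single k (b (.inr μ)))))),
      fun y z => ?_⟩
    have hy (c : ℂ) : (y : Γ(H.left, A) →+* ℂ) (algebraMap ℂ _ c) = c := y.commutes c
    have h1 (i k) : MvPolynomial.eval z (.map (y : Γ(H.left, A) →+* ℂ)
        (topPoly (coeffMatrix f A) i k)) =
          frameTop b (fun k => σ (pointOf hA y) (cellFrame b z k)) i k := by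
      rw [frameTop_act, ← coeffMatrix_map b hf, ← topPoly_eval, ← topPoly_map]
      rfl
    have h2 (i k) : MvPolynomial.eval z (.map (y : Γ(H.left, A) →+* ℂ)
        (botPoly (coeffMatrix f A) i k)) =
          frameBot b (fun k => σ (pointOf hA y) (cellFrame b z k)) i k := by
      rw [frameBot_act, ← coeffMatrix_map b hf, ← botPoly_eval, ← botPoly_map]
      rfl
    refine (hl _).trans ?_
    simp only [map_sum, map_add, map_mul, MvPolynomial.map_C, MvPolynomial.eval_C, hy, h1, h2]
  | algebraMap r => exact ⟨.C (algebraMap ℂ _ r), fun y z => by simp⟩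
  | add x y _ _ hx hy =>
    obtain ⟨P, hP⟩ := hx
    obtain ⟨Q, hQ⟩ := hy
    exact ⟨P + Q, fun y z => by simp [hP, hQ]⟩
  | mul x y _ _ hx hy =>
    obtain ⟨P, hP⟩ := hx
    obtain ⟨Q, hQ⟩ := hy
    exact ⟨P * Q, fun y z => by simp [hP, hQ]⟩

/-- Near a given point of the group, a regular function of group elements and subspaces is on the
big cell a quotient `p / q` of polynomials, and the nonvanishing of `r` keeps the translated
subspace in the domain `U` of the trivialization. -/
theorem exists_local_presentation [FiniteDimensional ℂ W] (hn : 0 < n)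
    (hf : ∀ g i j, LinearMap.toMatrix b b (σ g) i j = evalAt ⊤ (f i j) g)
    {A : H.left.Opens} (hA : IsAffineOpen A) {U : Set (Gr n W)} (hU : Gr.IsOpen U)
    (hne : U.Nonempty) {t : Points H → Gr n W → ℂ}
    (ht : IsRegularOnProd {x | x.2 ∈ U ∧ Gr.act σ x.1 x.2 ∈ U} t) (y : Γ(H.left, A) →ₐ[ℂ] ℂ) :
    ∃ p q r : MvPolynomial (M × Fin n) Γ(H.left, A),
      MvPolynomial.map (y : Γ(H.left, A) →+* ℂ) (q * r) ≠ 0 ∧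
      ∀ (y' : Γ(H.left, A) →ₐ[ℂ] ℂ) z,
        MvPolynomial.eval z (.map (y' : Γ(H.left, A) →+* ℂ) q) ≠ 0 →
        MvPolynomial.eval z (.map (y' : Γ(H.left, A) →+* ℂ) r) ≠ 0 → cell b z ∈ U →
        Gr.act σ (pointOf hA y') (cell b z) ∈ U ∧
          t (pointOf hA y') (cell b z) * MvPolynomial.eval z (.map (y' : Γ(H.left, A) →+* ℂ) q) =
            MvPolynomial.eval z (.map (y' : Γ(H.left, A) →+* ℂ) p) := by
  have hne' : {P | Gr.act σ (pointOf hA y) P ∈ U}.Nonempty := by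
    obtain ⟨P, hP⟩ := hne
    refine ⟨Gr.act σ (pointOf hA y)⁻¹ P, ?_⟩
    change Gr.act σ _ (Gr.act σ _ P) ∈ U
    rwa [← Gr.act_mul, mul_inv_cancel, Gr.act_one]
  -- a point of the big cell in `U` whose translate lies in `U` as well
  obtain ⟨z₀, hz₀, hz₀'⟩ := ((eventually_cell_mem b hU hne hn).and (eventually_cell_mem b
    (isOpen_preimage_act σ hU (pointOf hA y)) hne' hn)).exists
  obtain ⟨p, hp, q, hq, hq0, hpq⟩ := ht A hA (pointOf hA y) (cellFrame b z₀)
    (linearIndependent_cellFrame b z₀) (pointOf_pt_mem hA y) ⟨hz₀, hz₀'⟩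
  obtain ⟨P, hP⟩ := exists_poly_prodFun_cellFrame b hA hp
  obtain ⟨Q, hQ⟩ := exists_poly_prodFun_cellFrame b hA hq
  obtain ⟨S, hS, hUS⟩ := hU
  have hmem : (fun k => σ (pointOf hA y) (cellFrame b z₀ k)) ∈
      {w : Fin n → W | ∃ hw : LinearIndependent ℂ w, Gr.ofFrame w hw ∈ U} := by
    rw [Set.mem_ofPred_eq, cell, act_ofFrame] at hz₀'
    exact ⟨_, hz₀'⟩
  rw [hUS] at hmem
  -- `r` is one of the polynomials defining `U`, composed with the translation
  obtain ⟨r, hr, hr0⟩ := hmem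
  obtain ⟨R, hR⟩ := exists_poly_act_cellFrame b hf hA (hS hr)
  refine ⟨P, Q, R, fun h0 => ?_, fun y' z hQz hRz hz => ?_⟩
  · have := congrArg (MvPolynomial.eval z₀) h0
    rw [map_mul, map_mul, ← hR, MvPolynomial.eval_map, ← hQ, map_zero] at this
    exact mul_ne_zero hq0 hr0 this
  · rw [← hR] at hRz
    have hmem : (fun k => σ (pointOf hA y') (cellFrame b z k)) ∈
        {w : Fin n → W | ∃ hw : LinearIndependent ℂ w, Gr.ofFrame w hw ∈ U} := by
      rw [hUS]
      exact ⟨r, hr, hRz⟩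
    obtain ⟨hw, hwU⟩ := hmem
    have hact : Gr.act σ (pointOf hA y') (cell b z) ∈ U := by
      rw [cell, act_ofFrame]
      exact hwU
    refine ⟨hact, ?_⟩
    rw [MvPolynomial.eval_map, ← hQ] at hQz ⊢
    rw [MvPolynomial.eval_map, ← hP]
    have := hpq (pointOf hA y') (cellFrame b z) (linearIndependent_cellFrame b z)
      (pointOf_pt_mem hA y') ⟨hz, hact⟩ hQz
    rw [cell, this, div_mul_cancel₀ _ hQz]

variable {K : Type*} [Field K] [Algebra ℂ K]

/-- A generic frame of the universal subbundle of the Grassmannian, twisted by a line bundle,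
that is invariant under the group. In the coordinates `Z` of the big cell the subbundle has the
tautological frame `(1; Z)`, on which the group acts by the cocycle `topM`. -/
theorem exists_grassmannian_frame [LocallyOfFiniteType H.hom] [QuasiCompact H.hom]
    [FiniteDimensional ℂ W] (hσ : IsAlgebraicRep σ) (hn : 0 < n) (L : LinearizedLineBundle n σ)
    (hL : L.TwistTrivialOn (projKernel σ)) (hfree : ActsAlmostFreely σ n (projKernel σ))
    {Z : Matrix M (Fin n) K} (hind : AlgebraicIndependent ℂ (fun i : M × Fin n => Z i.1 i.2))
    (hgen : Generates (fun i : M × Fin n => Z i.1 i.2)) {τ : Points H → K →ₐ[ℂ] K}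
    (hτ1 : ∀ u, τ 1 u = u) (hτ : ∀ g h u, τ (g * h) u = τ h (τ g u))
    (hJ : ∀ h, IsUnit (topM ((LinearMap.toMatrix b b (σ h)).map (algebraMap ℂ K)) Z).det)
    (hτZ : ∀ h, Z.map (τ h) * topM ((LinearMap.toMatrix b b (σ h)).map (algebraMap ℂ K)) Z =
      botM ((LinearMap.toMatrix b b (σ h)).map (algebraMap ℂ K)) Z) :
    ∃ (T : Matrix (Fin n) (Fin n) K) (ℓ : Points H → K), IsUnit T.det ∧ (∀ h, ℓ h ≠ 0) ∧
      ∀ h, T.map (τ h) *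
        (ℓ h • topM ((LinearMap.toMatrix b b (σ h)).map (algebraMap ℂ K)) Z) = T := by
  classical
  let ι := M × Fin n
  let x : ι → K := fun i => Z i.1 i.2
  let S (h : Points H) : Matrix (Fin n ⊕ M) (Fin n ⊕ M) ℂ := LinearMap.toMatrix b b (σ h)
  let SK (h : Points H) : Matrix (Fin n ⊕ M) (Fin n ⊕ M) K := (S h).map (algebraMap ℂ K)
  let mz (z : ι → ℂ) : Matrix M (Fin n) ℂ := .of fun μ k => z (μ, k)
  obtain ⟨f, hf⟩ := exists_toMatrix_eq_evalAt hσ b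
  obtain ⟨As, hAs, hcov⟩ := exists_affine_cover H
  -- the action on points of the big cell
  let actz (h : Points H) (z : ι → ℂ) : ι → ℂ := fun i => (botM (S h) (mz z) *
    (topM (S h) (mz z))⁻¹) i.1 i.2
  have hdetK (h) : MvPolynomial.aeval x (topPoly (S h)).det = (topM (SK h) Z).det := by
    have := topPoly_aeval (S h) Z
    rw [AlgHom.map_det]
    exact congrArg Matrix.det this
  have hdet0 (h) : (topPoly (S h)).det ≠ 0 := by
    intro h0
    have := hdetK h
    rw [h0, map_zero] at this
    exact (hJ h).ne_zero this.symm
  have hdetz (h) (z : ι → ℂ) :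
      MvPolynomial.eval z (topPoly (S h)).det = (topM (S h) (mz z)).det := by
    rw [RingHom.map_det]
    exact congrArg Matrix.det (topPoly_eval (S h) z)
  have hactz (h) (z : ι → ℂ) (hz : (topM (S h) (mz z)).det ≠ 0) :
      Gr.act σ h (cell b z) = cell b (actz h z) := by
    apply act_cell
    change (botM (S h) (mz z) * (topM (S h) (mz z))⁻¹) * topM (S h) (mz z) = _
    rw [Matrix.mul_assoc, Matrix.nonsing_inv_mul _ (isUnit_iff_ne_zero.mpr hz), Matrix.mul_one]
  have hτdet (h) (i : ι) : τ h (x i) * (topM (SK h) Z).det =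
      (botM (SK h) Z * (topM (SK h) Z).adjugate) i.1 i.2 := by
    have h1 := congrArg (· * (topM (SK h) Z).adjugate) (hτZ h)
    simp only [Matrix.mul_assoc] at h1
    rw [Matrix.mul_adjugate, Matrix.mul_smul, Matrix.mul_one] at h1
    have h2 := congrFun (congrFun h1 i.1) i.2
    rw [Matrix.smul_apply, smul_eq_mul, mul_comm] at h2
    exact h2
  have hbotK (h) (i : ι) : MvPolynomial.aeval x
      ((botPoly (S h) * (topPoly (S h)).adjugate) i.1 i.2) =
        (botM (SK h) Z * (topM (SK h) Z).adjugate) i.1 i.2 := by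
    have h1 := botPoly_aeval (S h) Z
    have h2 := topPoly_aeval (S h) Z
    rw [← h1, ← h2, ← AlgHom.mapMatrix_apply, ← AlgHom.map_adjugate, AlgHom.mapMatrix_apply,
      ← Matrix.map_mul]
    rfl
  have hbotz (h) (i : ι) (z : ι → ℂ) : MvPolynomial.eval z
      ((botPoly (S h) * (topPoly (S h)).adjugate) i.1 i.2) =
        (botM (S h) (mz z) * (topM (S h) (mz z)).adjugate) i.1 i.2 := by
    have h1 := botPoly_eval (S h) z
    have h2 := topPoly_eval (S h) z
    change _ = (botM (S h) (.of fun μ k => z (μ, k)) *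
      (topM (S h) (.of fun μ k => z (μ, k))).adjugate) i.1 i.2
    rw [← h1, ← h2, ← RingHom.mapMatrix_apply, ← RingHom.map_adjugate, RingHom.mapMatrix_apply,
      ← Matrix.map_mul]
    rfl
  have hval (h) (i : ι) : HasVal x (τ h (x i)) (fun z => actz h z i) := by
    refine ⟨(botPoly (S h) * (topPoly (S h)).adjugate) i.1 i.2, (topPoly (S h)).det, hdet0 h,
      ?_, ?_⟩
    · rw [hdetK, hbotK, hτdet]
    · filter_upwards [eventually_eval_ne_zero (hdet0 h)] with z hz
      rw [hdetz] at hz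
      rw [hdetz, hbotz]
      simp only [actz]
      rw [Matrix.inv_def, Matrix.mul_smul, Matrix.smul_apply, Ring.inverse_eq_inv', smul_eq_mul,
        mul_comm, mul_inv_cancel_left₀ hz]
  have hdetEv (h) : ∀ᶠ z in generic ι, (topM (S h) (mz z)).det ≠ 0 := by
    filter_upwards [eventually_eval_ne_zero (hdet0 h)] with z hz
    rwa [hdetz] at hz
  -- a trivialization of the line bundle over an open set
  obtain ⟨c, hc, hPc⟩ := L.cover_atlas (cell b 0)
  have hU := L.isOpen_atlas c hc
  have hs := L.frame_ne_zero c hc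
  obtain ⟨t, htreg, ht⟩ := L.act_regular c hc c hc
  set U := c.1
  have hne : U.Nonempty := ⟨_, hPc⟩
  have hEvU := eventually_cell_mem b hU hne hn
  have hEvact (h) : ∀ᶠ z in generic ι, Gr.act σ h (cell b z) ∈ U := by
    refine eventually_cell_mem b (isOpen_preimage_act σ hU h) ⟨Gr.act σ h⁻¹ (cell b 0), ?_⟩ hn
    change Gr.act σ _ (Gr.act σ _ _) ∈ U
    rwa [← Gr.act_mul, mul_inv_cancel, Gr.act_one]
  let ev {A : H.left.Opens} (y : Γ(H.left, A) →ₐ[ℂ] ℂ) :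
      MvPolynomial ι Γ(H.left, A) →+* MvPolynomial ι ℂ := MvPolynomial.map (y : Γ(H.left, A) →+* ℂ)
  -- finitely many local presentations of the cocycle of the line bundle
  let Loc (A : {A // A ∈ As}) := {d : MvPolynomial ι Γ(H.left, A.1) × MvPolynomial ι Γ(H.left, A.1) ×
      MvPolynomial ι Γ(H.left, A.1) // ∀ (y : Γ(H.left, A.1) →ₐ[ℂ] ℂ) z,
    MvPolynomial.eval z (ev y d.2.1) ≠ 0 → MvPolynomial.eval z (ev y d.2.2) ≠ 0 → cell b z ∈ U →
        Gr.act σ (pointOf (hAs A.1 A.2) y) (cell b z) ∈ U ∧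
          t (pointOf (hAs A.1 A.2) y) (cell b z) * MvPolynomial.eval z (ev y d.2.1) =
            MvPolynomial.eval z (ev y d.1)}
  have hfin (A : {A // A ∈ As}) : ∃ F : Finset (Loc A), ∀ y : Γ(H.left, A.1) →ₐ[ℂ] ℂ,
      ∃ d ∈ F, ev y (d.1.2.1 * d.1.2.2) ≠ 0 := by
    have := finiteType_sections (hAs A.1 A.2)
    apply exists_finset_forall_map_ne_zero (fun d : Loc A => d.1.2.1 * d.1.2.2)
    intro y
    obtain ⟨p, q, r, h1, h2⟩ := exists_local_presentation b hn hf (hAs A.1 A.2) hU hne htreg y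
    exact ⟨⟨(p, q, r), h2⟩, h1⟩
  choose F hF using hfin
  -- the cocycle of the line bundle as a rational function on the big cell
  have hlocval (A : {A // A ∈ As}) (d : Loc A) (y : Γ(H.left, A.1) →ₐ[ℂ] ℂ)
      (hy : ev y (d.1.2.1 * d.1.2.2) ≠ 0) : ∀ᶠ z in generic ι,
        t (pointOf (hAs A.1 A.2) y) (cell b z) * MvPolynomial.eval z (ev y d.1.2.1) =
            MvPolynomial.eval z (ev y d.1.1) := by
    rw [map_mul] at hy
    filter_upwards [hEvU, eventually_eval_ne_zero (left_ne_zero_of_mul hy),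
      eventually_eval_ne_zero (right_ne_zero_of_mul hy)] with z h1 h2 h3
    exact (d.2 y z h2 h3 h1).2
  have haeval {q : MvPolynomial ι ℂ} (hq : q ≠ 0) : MvPolynomial.aeval x q ≠ 0 := fun h0 =>
    hq (hind (h0.trans (map_zero _).symm))
  have hℓ (h : Points H) : ∃ u, HasVal x u (fun z => t h (cell b z)) := by
    obtain ⟨A, hA, hhA⟩ := hcov h.pt
    obtain ⟨d, -, hd⟩ := hF ⟨A, hA⟩ (evalAlgHom A h hhA)
    have h1 := hlocval ⟨A, hA⟩ d _ hd
    rw [pointOf_evalAlgHom] at h1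
    rw [map_mul] at hd
    exact ⟨MvPolynomial.aeval x (ev (evalAlgHom A h hhA) d.1.1) /
      MvPolynomial.aeval x (ev (evalAlgHom A h hhA) d.1.2.1), _, _, left_ne_zero_of_mul hd,
      div_mul_cancel₀ _ (haeval (left_ne_zero_of_mul hd)), h1⟩
  choose ℓ hℓ using hℓ
  have hℓ1 : ℓ 1 = 1 := by
    have h1 : HasVal x (MvPolynomial.aeval x (1 : MvPolynomial ι ℂ)) (fun z => t 1 (cell b z)) := by
      refine (HasVal.poly 1).congr ?_
      filter_upwards [hEvU] with z hz
      rw [map_one, cocycle_one L hs ht hz]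
    rw [map_one] at h1
    exact (hℓ 1).unique hind h1
  have hℓmul (g h) : ℓ (g * h) = τ h (ℓ g) * ℓ h := by
    refine (hℓ (g * h)).unique hind ((((hℓ g).comp hind (hval h)).mul (hℓ h)).congr ?_)
    filter_upwards [hEvU, hEvact h, hEvact (g * h), hdetEv h] with z h1 h2 h3 h4
    rw [cocycle_mul L hs ht h1 h2 h3, hactz h z h4]
  have hℓ0 (h) : ℓ h ≠ 0 := by
    intro h0
    have := hℓmul h⁻¹ h
    rw [inv_mul_cancel, hℓ1, h0, mul_zero] at this
    exact one_ne_zero this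
  -- the cocycle of the twisted subbundle in its frame `(1; Z)`
  let cK (h : Points H) : Matrix (Fin n) (Fin n) K := ℓ h • topM (SK h) Z
  have hSK (g h) : (SK g).map (τ h) = SK g := by
    ext i j
    simp [SK]
  have hcK1 : cK 1 = 1 := by
    have : SK 1 = 1 := by
      simp only [SK, S, map_one, LinearMap.toMatrix_one]
      exact Matrix.map_one _ (map_zero _) (map_one _)
    simp only [cK]
    rw [this, topM_one, hℓ1, one_smul]
  have hcKmul (g h) : cK (g * h) = (cK g).map (τ h) * cK h := by
    have h1 : SK (g * h) = SK g * SK h := by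
      simp only [SK, S, map_mul, LinearMap.toMatrix_mul]
      exact Matrix.map_mul
    have h2 : (cK g).map (τ h) = τ h (ℓ g) • topM (SK g) (Z.map (τ h)) := by
      have h3 := topM_map (τ h : K →+* K) (SK g) Z
      have h4 : (SK g).map (τ h : K →+* K) = SK g := hSK g h
      rw [h4] at h3
      change _ = _ • topM (SK g) (Z.map (τ h : K →+* K))
      rw [← h3]
      ext i j
      simp [cK]
    rw [h2]
    simp only [cK]
    rw [h1, topM_mul _ _ _ _ (hτZ h), hℓmul, Matrix.smul_mul, Matrix.mul_smul, smul_smul]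
  -- the points `z` to consider: those where the trivialization exists and the stabilizer is trivial
  obtain ⟨Uf, hUfo, hUfne, hUf⟩ := hfree
  obtain ⟨d, hd0, hd⟩ := eventually_generic_iff.mp
    (hEvU.and (eventually_cell_mem b hUfo hUfne hn))
  let _ := (MvPolynomial.aeval (R := ℂ) x).toRingHom.toAlgebra
  have : IsFractionRing (MvPolynomial ι ℂ) K := isFractionRing_of_generates hind hgen
  have hX (i : ι) : algebraMap (MvPolynomial ι ℂ) K (.X i) = x i :=
    MvPolynomial.aeval_X _ _
  have hCc (r : ℂ) : algebraMap (MvPolynomial ι ℂ) K (.C r) = algebraMap ℂ K r :=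
    MvPolynomial.aeval_C _ _
  have : IsScalarTower ℂ (MvPolynomial ι ℂ) K := .of_algebraMap_eq fun r => (hCc r).symm
  -- the affine pieces of `H`, together with a local presentation on them
  let J := Σ A : {A // A ∈ As}, {d : Loc A // d ∈ F A}
  let O (j : J) : Type := Γ(H.left, j.1.1)
  let _ (j : J) : CommRing (O j) := inferInstanceAs (CommRing Γ(H.left, j.1.1))
  let _ (j : J) : Algebra ℂ (O j) := inferInstanceAs (Algebra ℂ Γ(H.left, j.1.1))
  have (j : J) : Algebra.FiniteType ℂ (O j) := finiteType_sections (hAs j.1.1 j.1.2)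
  let π (j : J) (y : O j →ₐ[ℂ] ℂ) : Points H := pointOf (hAs j.1.1 j.1.2) y
  let p (j : J) : MvPolynomial ι (O j) := j.2.1.1.1
  let q (j : J) : MvPolynomial ι (O j) := j.2.1.1.2.1
  let r (j : J) : MvPolynomial ι (O j) := j.2.1.1.2.2
  let To (j : J) : Matrix (Fin n) (Fin n) (MvPolynomial ι (O j)) :=
    topPoly (coeffMatrix f j.1.1)
  let Bo (j : J) : Matrix M (Fin n) (MvPolynomial ι (O j)) := botPoly (coeffMatrix f j.1.1)
  let E (j : J) (y : O j →ₐ[ℂ] ℂ) : MvPolynomial ι (O j) →+* MvPolynomial ι ℂ :=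
    MvPolynomial.map (y : O j →+* ℂ)
  have hTo (j : J) (y : O j →ₐ[ℂ] ℂ) : (To j).map (E j y) = topPoly (S (π j y)) := by
    refine (topPoly_map _ _).trans ?_
    rw [coeffMatrix_map b hf (hAs j.1.1 j.1.2)]
  have hBo (j : J) (y : O j →ₐ[ℂ] ℂ) : (Bo j).map (E j y) = botPoly (S (π j y)) := by
    refine (botPoly_map _ _).trans ?_
    rw [coeffMatrix_map b hf (hAs j.1.1 j.1.2)]
  have hTdet (j : J) (y : O j →ₐ[ℂ] ℂ) : E j y (To j).det = (topPoly (S (π j y))).det := by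
    rw [RingHom.map_det]
    exact congrArg Matrix.det (hTo j y)
  have hBadj (j : J) (y : O j →ₐ[ℂ] ℂ) (i : ι) : E j y ((Bo j * (To j).adjugate) i.1 i.2) =
      (botPoly (S (π j y)) * (topPoly (S (π j y))).adjugate) i.1 i.2 := by
    rw [← hTo, ← hBo, ← RingHom.mapMatrix_apply, ← RingHom.map_adjugate, RingHom.mapMatrix_apply,
      ← Matrix.map_mul]
    rfl
  have hTent (j : J) (y : O j →ₐ[ℂ] ℂ) (a a') :
      E j y (To j a a') = topPoly (S (π j y)) a a' := by rw [← hTo]; rfl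
  have hℓq (j : J) (y : O j →ₐ[ℂ] ℂ) (hy : E j y (q j * r j) ≠ 0) :
      ℓ (π j y) * MvPolynomial.aeval x (E j y (q j)) = MvPolynomial.aeval x (E j y (p j)) := by
    have h1 : E j y (q j) ≠ 0 := left_ne_zero_of_mul (by rwa [← map_mul])
    have h2 : HasVal x (MvPolynomial.aeval x (E j y (p j)) / MvPolynomial.aeval x (E j y (q j)))
        (fun z => t (π j y) (cell b z)) :=
      ⟨_, _, h1, div_mul_cancel₀ _ (haeval h1), hlocval j.1 j.2.1 y hy⟩
    rw [(hℓ (π j y)).unique hind h2, div_mul_cancel₀ _ (haeval h1)]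
  have key := exists_mem_orbitSpan (s := Fin n × Fin n) τ π
    (fun j i => q j * r j * (Bo j * (To j).adjugate) i.1 i.2) (fun j => (To j).det * (q j * r j))
    (fun i j => (To j).det * r j * p j * To j i.1 i.2) hd0 (fun i h => cK h i.1 i.2) ?_ ?_ ?_ ?_
  · obtain ⟨u, hu, hu0, hH⟩ := key
    obtain ⟨T, hT, hT'⟩ := exists_coboundary (τ := fun h => (τ h : K →+* K))
      hτ1 hτ hcK1 hcKmul hu hu0 fun i j => hH (i, j)
    exact ⟨T, ℓ, hT, hℓ0, hT'⟩
  · intro j y hy i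
    change _ * MvPolynomial.aeval x (E j y ((To j).det * (q j * r j))) =
      MvPolynomial.aeval x (E j y (q j * r j * (Bo j * (To j).adjugate) i.1 i.2))
    have h1 : E j y (q j * r j * (Bo j * (To j).adjugate) i.1 i.2) = E j y (q j * r j) *
        (botPoly (S (π j y)) * (topPoly (S (π j y))).adjugate) i.1 i.2 := by
      rw [← hBadj]
      exact map_mul _ _ _
    rw [hX, h1, map_mul (E j y) (To j).det, hTdet, map_mul (MvPolynomial.aeval x),
      map_mul (MvPolynomial.aeval x), hdetK, hbotK, ← hτdet]
    ring
  · intro j y hy i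
    have hy' : E j y (q j * r j) ≠ 0 := right_ne_zero_of_mul (a := E j y (To j).det) (by
      rw [← map_mul]; exact hy)
    change _ * MvPolynomial.aeval x (E j y ((To j).det * (q j * r j))) =
      MvPolynomial.aeval x (E j y ((To j).det * r j * p j * To j i.1 i.2))
    have h1 : MvPolynomial.aeval x (topPoly (S (π j y)) i.1 i.2) =
        topM (SK (π j y)) Z i.1 i.2 := by
      have := topPoly_aeval (S (π j y)) Z
      exact congrFun (congrFun this i.1) i.2
    simp only [map_mul, hTent, h1, ← hℓq j y hy', cK, Matrix.smul_apply, smul_eq_mul]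
    ring
  · intro g
    obtain ⟨A, hA, hgA⟩ := hcov g.pt
    obtain ⟨d, hdF, hd⟩ := hF ⟨A, hA⟩ (evalAlgHom A g hgA)
    refine ⟨⟨⟨A, hA⟩, d, hdF⟩, evalAlgHom A g hgA, pointOf_evalAlgHom _ g hgA, ?_⟩
    have h1 := hTdet ⟨⟨A, hA⟩, d, hdF⟩ (evalAlgHom A g hgA)
    refine (map_mul _ _ _).trans_ne (mul_ne_zero (h1.trans_ne (hdet0 _)) hd)
  · intro j j' y y' z hdz hD hD' hP i
    obtain ⟨hzU, hzUf⟩ := hd z hdz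
    have he {j : J} (y : O j →ₐ[ℂ] ℂ) (P : MvPolynomial ι (O j)) :
        MvPolynomial.eval₂ (y : O j →+* ℂ) z P = MvPolynomial.eval z (E j y P) :=
      (MvPolynomial.eval_map _ _ _).symm
    simp only [he, map_mul, hTdet, hBadj, hTent, hdetz, hbotz] at hD hD' hP ⊢
    have hdet := left_ne_zero_of_mul hD
    have hdet' := left_ne_zero_of_mul hD'
    have hq := left_ne_zero_of_mul (right_ne_zero_of_mul hD)
    have hq' := left_ne_zero_of_mul (right_ne_zero_of_mul hD')
    have hr := right_ne_zero_of_mul (right_ne_zero_of_mul hD)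
    have hr' := right_ne_zero_of_mul (right_ne_zero_of_mul hD')
    have hT1 (j : J) (y : O j →ₐ[ℂ] ℂ) : MvPolynomial.eval z (topPoly (S (π j y)) i.1 i.2) =
        topM (S (π j y)) (mz z) i.1 i.2 := by
      have := topPoly_eval (S (π j y)) z
      exact congrFun (congrFun this i.1) i.2
    rw [hT1, hT1]
    obtain ⟨hact, htq⟩ := j.2.1.2 y z hq hr hzU
    obtain ⟨hact', htq'⟩ := j'.2.1.2 y' z hq' hr' hzU
    change Gr.act σ (π j y) _ ∈ _ at hact
    change Gr.act σ (π j' y') _ ∈ _ at hact'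
    change t (π j y) _ * MvPolynomial.eval z (E j y (q j)) = MvPolynomial.eval z (E j y (p j)) at htq
    change t (π j' y') _ * MvPolynomial.eval z (E j' y' (q j')) =
      MvPolynomial.eval z (E j' y' (p j')) at htq'
    -- the two group elements map the subspace to the same subspace
    have hactz_eq (h) (hdet : (topM (S h) (mz z)).det ≠ 0) (i) : actz h z i =
        (botM (S h) (mz z) * (topM (S h) (mz z)).adjugate) i.1 i.2 /
          (topM (S h) (mz z)).det := by
      simp only [actz]
      rw [Matrix.inv_def, Matrix.mul_smul, Matrix.smul_apply, Ring.inverse_eq_inv', smul_eq_mul,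
        inv_mul_eq_div]
    have hsame : actz (π j y) z = actz (π j' y') z := by
      ext i
      have := hP i
      rw [hactz_eq _ hdet, hactz_eq _ hdet', div_eq_div_iff hdet hdet']
      rw [div_eq_div_iff hD hD'] at this
      apply mul_left_cancel₀ (mul_ne_zero (mul_ne_zero hq hr) (mul_ne_zero hq' hr'))
      linear_combination this
    let g := (π j' y')⁻¹ * π j y
    have hg : π j y = π j' y' * g := by simp [g]
    have hgP : Gr.act σ g (cell b z) = cell b z := by
      rw [Gr.act_mul, hactz _ z hdet, hsame, ← hactz _ z hdet', ← Gr.act_mul, inv_mul_cancel,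
        Gr.act_one]
    -- the stabilizer element `g` acts by a scalar `μ` on `ℰ` and by `μ⁻¹` on the line bundle
    have hgN := hUf _ hzUf g hgP
    obtain ⟨μ, hμ⟩ := exists_scalar_of_mem_projKernel hgN
    have h1 := mul_cocycle_eq_one L hn hL hs ht hgN hμ hzU hgP
    have h2 : t (π j y) (cell b z) = t (π j' y') (cell b z) * t g (cell b z) := by
      have := cocycle_mul L hs ht (g := π j' y') (h := g) hzU (by rwa [hgP]) (by rwa [← hg])
      rwa [← hg, hgP] at this
    have h3 : S (π j y) = μ • S (π j' y') := by
      have : σ (π j y) = μ • σ (π j' y') := by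
        rw [hg, map_mul, hμ]
        ext v
        simp
      simp only [S]
      rw [this, map_smul]
    have h4 : topM (S (π j y)) (mz z) i.1 i.2 = μ * topM (S (π j' y')) (mz z) i.1 i.2 := by
      rw [h3, topM_apply, topM_apply]
      simp only [Matrix.smul_apply, smul_eq_mul, mul_add, Finset.mul_sum, mul_assoc]
    rw [div_eq_div_iff hD hD', ← htq, ← htq', h2, h4]
    linear_combination (MvPolynomial.eval z (E j y (q j)) * MvPolynomial.eval z (E j y (r j)) *
      MvPolynomial.eval z (E j' y' (q j')) * MvPolynomial.eval z (E j' y' (r j')) *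
      (topM (S (π j y)) (mz z)).det * (topM (S (π j' y')) (mz z)).det *
      t (π j' y') (cell b z) * topM (S (π j' y')) (mz z) i.1 i.2) * h1

end Grassmannian

/-! ### Fields generated by coordinates -/

section Generates

variable {ι κ L K : Type*} [Field L] [Algebra ℂ L] [Field K] [Algebra ℂ K]

theorem aeval_mem_of_forall_mem {F : IntermediateField ℂ L} {x : ι → L} (h : ∀ i, x i ∈ F)
    (p : MvPolynomial ι ℂ) : MvPolynomial.aeval x p ∈ F := by
  have : MvPolynomial.aeval x p = F.val (MvPolynomial.aeval (fun i => (⟨x i, h i⟩ : F)) p) := by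
    rw [← AlgHom.comp_apply, MvPolynomial.comp_aeval]
    rfl
  rw [this]
  exact Subtype.prop _

theorem mem_of_generates {x : ι → K} (hx : Generates x) (j : K →ₐ[ℂ] L) {F : IntermediateField ℂ L}
    (h : ∀ i, j (x i) ∈ F) (u : K) : j u ∈ F := by
  obtain ⟨p, q, hq, e⟩ := hx u
  rw [(eq_mul_inv_iff_mul_eq₀ hq).mpr e, map_mul, map_inv₀, ← AlgHom.comp_apply,
    ← AlgHom.comp_apply, MvPolynomial.comp_aeval]
  exact mul_mem (aeval_mem_of_forall_mem h p) (inv_mem (aeval_mem_of_forall_mem h q))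

/-- Generators of a subfield, regarded as elements of it, generate it. -/
theorem generates_adjoin (x : ι → L) : Generates (fun i =>
    (⟨x i, IntermediateField.subset_adjoin ℂ _ ⟨i, rfl⟩⟩ :
      IntermediateField.adjoin ℂ (Set.range x))) := by
  rintro ⟨u, hu⟩
  obtain ⟨p, q, h⟩ := (IntermediateField.mem_adjoin_range_iff ℂ _ _).mp hu
  have e (p : MvPolynomial ι ℂ) : ((MvPolynomial.aeval (fun i =>
      (⟨x i, IntermediateField.subset_adjoin ℂ _ ⟨i, rfl⟩⟩ :
        IntermediateField.adjoin ℂ (Set.range x))) p : _) : L) = MvPolynomial.aeval x p := by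
    rw [← IntermediateField.coe_val, ← AlgHom.comp_apply, MvPolynomial.comp_aeval]
    rfl
  by_cases hq : MvPolynomial.aeval x q = 0
  · refine ⟨0, 1, by simp, Subtype.ext ?_⟩
    simp [h, hq]
  · refine ⟨p, q, fun h0 => hq ?_, Subtype.ext ?_⟩
    · rw [← e, h0]; rfl
    · rw [MulMemClass.coe_mul, e, e]
      exact (eq_div_iff hq).mp h

/-- A purely transcendental field embeds into any field containing as many algebraically
independent elements. -/
theorem exists_algHom_of_algebraicIndependent {x : ι → K} (hind : AlgebraicIndependent ℂ x)
    (hgen : Generates x) {y : ι → L} (hy : AlgebraicIndependent ℂ y) :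
    ∃ j : K →ₐ[ℂ] L, ∀ i, j (x i) = y i := by
  let _ := (MvPolynomial.aeval (R := ℂ) x).toRingHom.toAlgebra
  have : IsScalarTower ℂ (MvPolynomial ι ℂ) K :=
    .of_algebraMap_eq fun r => (MvPolynomial.aeval_C x r).symm
  have : IsFractionRing (MvPolynomial ι ℂ) K := isFractionRing_of_generates hind hgen
  refine ⟨IsFractionRing.liftAlgHom (K := K) (g := MvPolynomial.aeval y) hy, fun i => ?_⟩
  have : algebraMap (MvPolynomial ι ℂ) K (.X i) = x i := MvPolynomial.aeval_X _ _
  rw [← this]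
  exact (IsLocalization.lift_eq _ _).trans (MvPolynomial.aeval_X _ _)

/-- Endomorphisms that agree on generators agree. -/
theorem algHom_eq_of_generates {x : ι → K} (hgen : Generates x) {f g : K →ₐ[ℂ] L}
    (h : ∀ i, f (x i) = g (x i)) (u : K) : f u = g u := by
  obtain ⟨p, q, hq, e⟩ := hgen u
  have hp (p : MvPolynomial ι ℂ) : f (MvPolynomial.aeval x p) = g (MvPolynomial.aeval x p) := by
    rw [← AlgHom.comp_apply, ← AlgHom.comp_apply, MvPolynomial.comp_aeval, MvPolynomial.comp_aeval,
      funext h]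
  apply mul_right_cancel₀ ((map_ne_zero_iff f f.injective).mpr hq)
  rw [← map_mul, e, hp, hp, ← map_mul, e]

theorem exists_restrict_adjoin (x : ι → L) (f : L →ₐ[ℂ] L)
    (h : ∀ i, f (x i) ∈ IntermediateField.adjoin ℂ (Set.range x)) :
    ∃ g : IntermediateField.adjoin ℂ (Set.range x) →ₐ[ℂ] IntermediateField.adjoin ℂ (Set.range x),
      ∀ u, (g u : L) = f u := by
  have hF := mem_of_generates (generates_adjoin x)
    (f.comp (IntermediateField.adjoin ℂ (Set.range x)).val) h
  exact ⟨(f.comp (IntermediateField.adjoin ℂ (Set.range x)).val).codRestrict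
    (IntermediateField.adjoin ℂ (Set.range x)).toSubalgebra hF, fun u => rfl⟩

end Generates

/-! ### Fields of fractions -/

/-- The fraction field of a domain embedded in a field is the subfield of the fractions. -/
theorem nonempty_frac_equiv {A Ω : Type*} [CommRing A] [Algebra ℂ A] [Field Ω] [Algebra ℂ Ω]
    (φ : A →ₐ[ℂ] Ω) (hφ : Function.Injective φ) (S : Subalgebra ℂ Ω) (hS : ∀ a, φ a ∈ S)
    (hinv : ∀ u ∈ S, u⁻¹ ∈ S) (h : ∀ u ∈ S, ∃ p q, q ≠ 0 ∧ u * φ q = φ p) :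
    Nonempty (Frac A ≃ₐ[ℂ] S) := by
  have : IsDomain A := hφ.isDomain φ
  let f : Frac A →ₐ[ℂ] Ω := IsLocalization.liftAlgHom (M := nonZeroDivisors A) (f := φ)
    fun y => (isUnit_iff_ne_zero.mpr ((map_ne_zero_iff φ hφ).mpr (nonZeroDivisors.ne_zero y.2)))
  have hf (a : A) : f (algebraMap A (Frac A) a) = φ a := IsLocalization.lift_eq _ a
  have hne {q : A} (hq : q ≠ 0) : φ q ≠ 0 := (map_ne_zero_iff φ hφ).mpr hq
  have hmul (z : Frac A) : ∃ p q : A, q ≠ 0 ∧ z * algebraMap A (Frac A) q = algebraMap A (Frac A) p := by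
    obtain ⟨⟨p, q⟩, hpq⟩ := IsLocalization.surj (nonZeroDivisors A) z
    exact ⟨p, q, nonZeroDivisors.ne_zero q.2, hpq⟩
  have hfi : Function.Injective f := by
    rw [injective_iff_map_eq_zero]
    intro z hz
    obtain ⟨p, q, hq, hpq⟩ := hmul z
    have h1 := congrArg f hpq
    rw [map_mul, hz, zero_mul, hf, eq_comm, map_eq_zero_iff φ hφ] at h1
    rw [h1, map_zero] at hpq
    have := IsLocalization.map_units (Frac A) (⟨q, mem_nonZeroDivisors_of_ne_zero hq⟩ : nonZeroDivisors A)
    exact (this.mul_left_eq_zero).mp hpq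
  have hr : f.range = S := by
    apply le_antisymm
    · rintro _ ⟨z, rfl⟩
      obtain ⟨p, q, hq, hpq⟩ := hmul z
      have h1 := congrArg f hpq
      rw [map_mul, hf, hf] at h1
      change f z ∈ S
      rw [(eq_mul_inv_iff_mul_eq₀ (hne hq)).mpr h1]
      exact mul_mem (hS p) (hinv _ (hS q))
    · intro u hu
      obtain ⟨p, q, hq, hpq⟩ := h u hu
      have hu' := IsLocalization.mk'_spec (Frac A) p
        (⟨q, mem_nonZeroDivisors_of_ne_zero hq⟩ : nonZeroDivisors A)
      refine ⟨IsLocalization.mk' _ p ⟨q, mem_nonZeroDivisors_of_ne_zero hq⟩, ?_⟩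
      have h1 := congrArg f hu'
      rw [map_mul, hf, hf, ← hpq] at h1
      exact mul_right_cancel₀ (hne hq) h1
  exact ⟨(AlgEquiv.ofInjective f hfi).trans (Subalgebra.equivOfEq _ _ hr)⟩

/-- An algebra map on `(K ⊗ S)[T]` is determined on `K`, `S` and the variables. -/
theorem mvPolynomial_tensor_algHom_ext {T K S Ω : Type*} [CommRing K] [Algebra ℂ K] [CommRing S]
    [Algebra ℂ S] [CommRing Ω] [Algebra ℂ Ω] {f g : MvPolynomial T (K ⊗[ℂ] S) →ₐ[ℂ] Ω}
    (h₁ : ∀ x, f (.C (x ⊗ₜ 1)) = g (.C (x ⊗ₜ 1))) (h₂ : ∀ x, f (.C (1 ⊗ₜ x)) = g (.C (1 ⊗ₜ x)))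
    (h₃ : ∀ i, f (.X i) = g (.X i)) (p) : f p = g p := by
  induction p using MvPolynomial.induction_on with
  | C r =>
    induction r using TensorProduct.induction_on with
    | zero => simp
    | add x y hx hy => rw [map_add, map_add, map_add, hx, hy]
    | tmul x y =>
      have : x ⊗ₜ[ℂ] y = (x ⊗ₜ 1) * (1 ⊗ₜ y) := by simp
      rw [this, map_mul, map_mul, map_mul, h₁, h₂]
  | add p q hp hq => rw [map_add, map_add, hp, hq]
  | mul_X p i hp => rw [map_mul, map_mul, hp, h₃]

section PolyHom

variable {T A B A' B' Ω : Type*} [CommRing A] [Algebra ℂ A] [CommRing B] [Algebra ℂ B]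
  [CommRing A'] [Algebra ℂ A'] [CommRing B'] [Algebra ℂ B'] [CommRing Ω] [Algebra ℂ Ω]

/-- The map on `(A ⊗ B)[T]` with the given restrictions to `A` and `B` and the given values of the
variables. -/
def polyHom (f : A →ₐ[ℂ] Ω) (g : B →ₐ[ℂ] Ω) (t : T → Ω) : MvPolynomial T (A ⊗[ℂ] B) →ₐ[ℂ] Ω :=
  MvPolynomial.aevalTower (Algebra.TensorProduct.productMap f g) t

theorem polyHom_left (f : A →ₐ[ℂ] Ω) (g : B →ₐ[ℂ] Ω) (t : T → Ω) (x : A) :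
    polyHom f g t (.C (x ⊗ₜ 1)) = f x := by simp [polyHom]

theorem polyHom_right (f : A →ₐ[ℂ] Ω) (g : B →ₐ[ℂ] Ω) (t : T → Ω) (x : B) :
    polyHom f g t (.C (1 ⊗ₜ x)) = g x := by simp [polyHom]

theorem polyHom_X (f : A →ₐ[ℂ] Ω) (g : B →ₐ[ℂ] Ω) (t : T → Ω) (i : T) :
    polyHom f g t (.X i) = t i := by simp [polyHom]

theorem polyHom_unique {F : MvPolynomial T (A ⊗[ℂ] B) →ₐ[ℂ] Ω} {f : A →ₐ[ℂ] Ω} {g : B →ₐ[ℂ] Ω}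
    {t : T → Ω} (h₁ : ∀ x, F (.C (x ⊗ₜ 1)) = f x) (h₂ : ∀ x, F (.C (1 ⊗ₜ x)) = g x)
    (h₃ : ∀ i, F (.X i) = t i) (p) : F p = polyHom f g t p :=
  mvPolynomial_tensor_algHom_ext (fun x => (h₁ x).trans (polyHom_left f g t x).symm)
    (fun x => (h₂ x).trans (polyHom_right f g t x).symm)
    (fun x => (h₃ x).trans (polyHom_X f g t x).symm) p

/-- The map on polynomials with coefficients in a tensor product induced by maps of the factors. -/
def polyMap (f : A →ₐ[ℂ] A') (g : B →ₐ[ℂ] B') :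
    MvPolynomial T (A ⊗[ℂ] B) →ₐ[ℂ] MvPolynomial T (A' ⊗[ℂ] B') :=
  MvPolynomial.mapAlgHom (Algebra.TensorProduct.map f g)

theorem polyHom_polyMap (f : A →ₐ[ℂ] A') (g : B →ₐ[ℂ] B') (f' : A' →ₐ[ℂ] Ω) (g' : B' →ₐ[ℂ] Ω)
    (t : T → Ω) (p) : polyHom f' g' t (polyMap f g p) = polyHom (f'.comp f) (g'.comp g) t p :=
  polyHom_unique (F := (polyHom f' g' t).comp (polyMap f g))
    (fun x => by simp [polyMap, polyHom]) (fun x => by simp [polyMap, polyHom])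
    (fun x => by simp [polyMap, polyHom]) p

/-- The exchange of the factors of the ring of coefficients. -/
def polySwap (T A B : Type*) [CommRing A] [Algebra ℂ A] [CommRing B] [Algebra ℂ B] :
    MvPolynomial T (A ⊗[ℂ] B) ≃ₐ[ℂ] MvPolynomial T (B ⊗[ℂ] A) :=
  MvPolynomial.mapAlgEquiv T (Algebra.TensorProduct.comm ℂ A B)

theorem polyHom_polySwap (f : A →ₐ[ℂ] Ω) (g : B →ₐ[ℂ] Ω) (t : T → Ω) (p) :
    polyHom g f t (polySwap T A B p) = polyHom f g t p :=
  polyHom_unique (F := (polyHom g f t).comp (polySwap T A B).toAlgHom)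
    (fun x => by simp [polySwap, polyHom]) (fun x => by simp [polySwap, polyHom])
    (fun x => by simp [polySwap, polyHom]) p

theorem comp_polyHom_apply {Ω' : Type*} [CommRing Ω'] [Algebra ℂ Ω'] (w : Ω →ₐ[ℂ] Ω')
    (f : A →ₐ[ℂ] Ω) (g : B →ₐ[ℂ] Ω) (t : T → Ω) (p) :
    w (polyHom f g t p) = polyHom (w.comp f) (w.comp g) (fun i => w (t i)) p :=
  polyHom_unique (F := w.comp (polyHom f g t)) (fun x => by simp [polyHom])
    (fun x => by simp [polyHom]) (fun x => by simp [polyHom]) p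

end PolyHom

/-- Let `Ω` be generated by algebraically independent coordinates of two fields `K₁` and `K₂` and
further elements `t`. If one family of endomorphisms of `Ω` acts through `K₁` and fixes `K₂` and
`t`, and another one acts through `K₂` and fixes `t` and the invariants of `K₁`, then the common
invariants are the fractions of polynomials in `t` with invariant coefficients. -/
theorem nonempty_frac_equiv_invariants {ι₁ ι₂ T K₁ K₂ Ω Γ Δ : Type*} [Field K₁] [Field K₂]
    [Field Ω] [Algebra ℂ K₁] [Algebra ℂ K₂] [Algebra ℂ Ω] {x : ι₁ → K₁} {z : ι₂ → K₂}
    (hx : Generates x) (hz : Generates z) (j₁ : K₁ →ₐ[ℂ] Ω) (j₂ : K₂ →ₐ[ℂ] Ω) (t : T → Ω)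
    (h : AlgebraicIndependent ℂ (Sum.elim (fun i => j₁ (x i)) (Sum.elim (fun i => j₂ (z i)) t)))
    {γ : Γ → K₁ →ₐ[ℂ] K₁} {θ : Γ → Ω →ₐ[ℂ] Ω} {τ : Δ → K₂ →ₐ[ℂ] K₂} {η : Δ → Ω →ₐ[ℂ] Ω}
    {k₁ : Subalgebra ℂ K₁} (hk₁ : ∀ u, u ∈ k₁ ↔ ∀ g, γ g u = u)
    {k₂ : Subalgebra ℂ K₂} (hk₂ : ∀ u, u ∈ k₂ ↔ ∀ g, τ g u = u)
    (hθ₁ : ∀ g u, θ g (j₁ u) = j₁ (γ g u)) (hθ₂ : ∀ g u, θ g (j₂ u) = j₂ u)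
    (hθt : ∀ g i, θ g (t i) = t i) (hη₁ : ∀ g, ∀ u ∈ k₁, η g (j₁ u) = j₁ u)
    (hη₂ : ∀ g u, η g (j₂ u) = j₂ (τ g u)) (hηt : ∀ g i, η g (t i) = t i)
    {S : Subalgebra ℂ Ω} (hS : ∀ u, u ∈ S ↔ u ∈ IntermediateField.adjoin ℂ (Set.range
      (Sum.elim (fun i => j₁ (x i)) (Sum.elim (fun i => j₂ (z i)) t))) ∧
      (∀ g, θ g u = u) ∧ ∀ g, η g u = u) :
    IsDomain (MvPolynomial T (k₁ ⊗[ℂ] k₂)) ∧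
      Nonempty (Frac (MvPolynomial T (k₁ ⊗[ℂ] k₂)) ≃ₐ[ℂ] S) := by
  let fam := Sum.elim (fun i => j₁ (x i)) (Sum.elim (fun i => j₂ (z i)) t)
  let F := IntermediateField.adjoin ℂ (Set.range fam)
  have hfam (i) : fam i ∈ F := IntermediateField.subset_adjoin ℂ _ ⟨i, rfl⟩
  have hj : Function.Injective (polyHom j₁ j₂ t) := aevalTower_productMap_injective hx hz j₁ j₂ t h
  let Θ : MvPolynomial (ι₁ ⊕ (ι₂ ⊕ T)) ℂ →ₐ[ℂ] MvPolynomial T (K₁ ⊗[ℂ] K₂) :=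
    MvPolynomial.aeval (Sum.elim (fun i => MvPolynomial.C (x i ⊗ₜ 1))
      (Sum.elim (fun i => MvPolynomial.C (1 ⊗ₜ z i)) MvPolynomial.X))
  have hΘ (r) : polyHom j₁ j₂ t (Θ r) = MvPolynomial.aeval fam r := by
    have : (polyHom j₁ j₂ t).comp Θ = MvPolynomial.aeval fam := by
      apply MvPolynomial.algHom_ext
      rintro (i | i | i) <;> simp [Θ, polyHom, fam]
    exact DFunLike.congr_fun this r
  let i₁ := j₁.comp k₁.val
  let i₂ := j₂.comp k₂.val
  have hj₁ (p) : polyHom i₁ j₂ t p = polyHom j₁ j₂ t (inclPoly T K₂ k₁ p) :=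
    (polyHom_polyMap k₁.val (AlgHom.id ℂ K₂) j₁ j₂ t p).symm
  have hj₂ (p) : polyHom i₂ i₁ t p = polyHom j₂ i₁ t (inclPoly T k₁ k₂ p) :=
    (polyHom_polyMap k₂.val (AlgHom.id ℂ k₁) j₂ i₁ t p).symm
  have hji₁ : Function.Injective (polyHom i₁ j₂ t) := by
    rw [funext hj₁]
    exact hj.comp (inclPoly_injective k₁)
  have hji₁' : Function.Injective (polyHom j₂ i₁ t) := by
    rw [← funext (polyHom_polySwap i₁ j₂ t)] at hji₁
    exact (Function.Injective.of_comp_iff' _ (polySwap T k₁ K₂).bijective).mp hji₁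
  have hji₂' : Function.Injective (polyHom i₂ i₁ t) := by
    rw [funext hj₂]
    exact hji₁'.comp (inclPoly_injective k₂)
  have hji : Function.Injective (polyHom i₁ i₂ t) := by
    rw [← funext (polyHom_polySwap i₁ i₂ t)]
    exact hji₂'.comp (polySwap T k₁ k₂).injective
  have hFj (p) : polyHom j₁ j₂ t p ∈ F := by
    induction p using MvPolynomial.induction_on with
    | C r =>
      induction r using TensorProduct.induction_on with
      | zero => rw [map_zero, map_zero]; exact zero_mem F
      | add x y hx hy => rw [map_add, map_add]; exact add_mem hx hy
      | tmul u v =>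
        have : u ⊗ₜ[ℂ] v = (u ⊗ₜ 1) * (1 ⊗ₜ v) := by simp
        rw [this, map_mul, map_mul, polyHom_left, polyHom_right]
        exact mul_mem (mem_of_generates hx j₁ (fun i => hfam (.inl i)) u)
          (mem_of_generates hz j₂ (fun i => hfam (.inr (.inl i))) v)
    | add p q hp hq => rw [map_add]; exact add_mem hp hq
    | mul_X p i hp => rw [map_mul, polyHom_X]; exact mul_mem hp (hfam (.inr (.inr i)))
  refine ⟨hji.isDomain (polyHom i₁ i₂ t), nonempty_frac_equiv (polyHom i₁ i₂ t) hji S ?_ ?_ ?_⟩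
  · intro a
    rw [hS]
    refine ⟨?_, fun g => ?_, fun g => ?_⟩
    · rw [← polyHom_polyMap]
      exact hFj _
    · rw [comp_polyHom_apply]
      exact congrFun (congrArg DFunLike.coe (by
        congr 1
        · exact AlgHom.ext fun u => (hθ₁ g u).trans (congrArg j₁ ((hk₁ u).mp u.2 g))
        · exact AlgHom.ext fun u => hθ₂ g u
        · exact funext (hθt g))) a
    · rw [comp_polyHom_apply]
      exact congrFun (congrArg DFunLike.coe (by
        congr 1
        · exact AlgHom.ext fun u => hη₁ g u u.2
        · exact AlgHom.ext fun u => (hη₂ g u).trans (congrArg j₂ ((hk₂ u).mp u.2 g))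
        · exact funext (hηt g))) a
  · intro u hu
    rw [hS] at hu ⊢
    exact ⟨inv_mem hu.1, fun g => by rw [map_inv₀, hu.2.1], fun g => by rw [map_inv₀, hu.2.2]⟩
  · intro u hu
    obtain ⟨huF, huθ, huη⟩ := (hS u).mp hu
    obtain ⟨r, s, hrs⟩ := (IntermediateField.mem_adjoin_range_iff ℂ _ _).mp huF
    obtain ⟨u₀, v₀, hv₀, h₀⟩ : ∃ u₀ v₀, v₀ ≠ 0 ∧ u * polyHom j₁ j₂ t v₀ = polyHom j₁ j₂ t u₀ := by
      by_cases hs : MvPolynomial.aeval fam s = 0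
      · have hu0 : u = 0 := by rw [hrs]; exact (congrArg _ hs).trans (div_zero _)
        exact ⟨0, 1, one_ne_zero, by rw [hu0, zero_mul, map_zero]⟩
      · refine ⟨Θ r, Θ s, fun h0 => hs ?_, ?_⟩
        · rw [← hΘ, h0, map_zero]
        · rw [hΘ, hΘ, hrs]; exact div_mul_cancel₀ _ hs
    -- make the coefficients in `K₁` invariant first, and those in `K₂` afterwards
    obtain ⟨u₁, v₁, hv₁, h₁⟩ := exists_invariant_fraction (polyHom j₁ j₂ t) hj γ θ (by
      intro g p
      rw [comp_polyHom_apply]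
      refine Eq.trans ?_ (polyHom_polyMap (γ g) (AlgHom.id ℂ K₂) j₁ j₂ t p).symm
      exact congrFun (congrArg DFunLike.coe (by
        congr 1
        · exact AlgHom.ext (hθ₁ g)
        · exact AlgHom.ext (hθ₂ g)
        · exact funext (hθt g))) p) huθ hv₀ h₀ k₁ (fun x => (hk₁ x).mpr)
    rw [← hj₁, ← hj₁, ← polyHom_polySwap _ _ _ v₁, ← polyHom_polySwap _ _ _ u₁] at h₁
    obtain ⟨u₂, v₂, hv₂, h₂⟩ := exists_invariant_fraction (polyHom j₂ i₁ t) hji₁' τ η (by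
      intro g p
      rw [comp_polyHom_apply]
      refine Eq.trans ?_ (polyHom_polyMap (τ g) (AlgHom.id ℂ k₁) j₂ i₁ t p).symm
      exact congrFun (congrArg DFunLike.coe (by
        congr 1
        · exact AlgHom.ext (hη₂ g)
        · exact AlgHom.ext fun u => hη₁ g u u.2
        · exact funext (hηt g))) p) huη ((map_ne_zero_iff _ (polySwap T k₁ K₂).injective).mpr hv₁) h₁
        k₂ (fun x => (hk₂ x).mpr)
    rw [← hj₂, ← hj₂, ← polyHom_polySwap _ _ _ v₂, ← polyHom_polySwap _ _ _ u₂] at h₂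
    exact ⟨_, _, (map_ne_zero_iff _ (polySwap T k₂ k₁).injective).mpr hv₂, h₂⟩

/-! ### Matrices with entries in a subfield -/

section MatrixMem

variable {L : Type*} [Field L] [Algebra ℂ L] {F : IntermediateField ℂ L} {l m n : Type*}

theorem matrix_mul_mem [Fintype m] {M : Matrix l m L} {N : Matrix m n L} (hM : ∀ i j, M i j ∈ F)
    (hN : ∀ i j, N i j ∈ F) (i j) : (M * N) i j ∈ F :=
  sum_mem fun k _ => mul_mem (hM i k) (hN k j)

theorem matrix_inv_mem [Fintype m] [DecidableEq m] {M : Matrix m m L} (hM : ∀ i j, M i j ∈ F)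
    (i j) : M⁻¹ i j ∈ F := by
  have hdet {N : Matrix m m L} (hN : ∀ i j, N i j ∈ F) : N.det ∈ F := by
    rw [Matrix.det_apply]
    refine sum_mem fun σ _ => ?_
    rw [Units.smul_def, zsmul_eq_mul]
    exact mul_mem (intCast_mem F _) (prod_mem fun k _ => hN _ _)
  rw [Matrix.inv_def, Matrix.smul_apply, smul_eq_mul, Ring.inverse_eq_inv', Matrix.adjugate_apply]
  refine mul_mem (inv_mem (hdet hM)) (hdet fun a b => ?_)
  rw [Matrix.updateRow_apply]
  split_ifs
  · rw [Pi.single_apply]; split_ifs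
    exacts [one_mem F, zero_mem F]
  · exact hM a b

end MatrixMem

/-! ### Functions invariant under homotheties -/

section Homothety

variable {E ι Γ Ω : Type*} [AddCommGroup E] [Module ℂ E] [Group Γ] [FiniteDimensional ℂ E]
  [Finite ι] (ρ : Representation ℂ Γ E) (b : Module.Basis ι ℂ E) [Field Ω] [Algebra ℂ Ω]

/-- A map that multiplies the coordinates by a common factor fixes the functions on the projective
space. -/
theorem map_eq_of_invariant (j : RatFun E →ₐ[ℂ] Ω) (f : Ω →ₐ[ℂ] Ω) {s : Ω} (hs : s ≠ 0)
    (hf : ∀ i, f (j (ratCoord b i)) = s * j (ratCoord b i)) {u : RatFun E}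
    (hu : ∀ c, ratPullback (scaled ρ) (c, 1) u = u) : f (j u) = j u := by
  obtain ⟨n, p, q, hp, hq, hq0, h⟩ := exists_homogeneous_fraction_of_invariant ρ b hu
  have key {r : MvPolynomial ι ℂ} (hr : r.IsHomogeneous n) :
      f (j (MvPolynomial.aeval (ratCoord b) r)) =
        s ^ n * j (MvPolynomial.aeval (ratCoord b) r) := by
    rw [← AlgHom.comp_apply j, ← AlgHom.comp_apply f, MvPolynomial.comp_aeval,
      MvPolynomial.comp_aeval, ← aeval_smul_of_isHomogeneous hr]
    exact congrArg (fun x => MvPolynomial.aeval x r) (funext hf)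
  have hne : j (MvPolynomial.aeval (ratCoord b) q) ≠ 0 := by
    rw [map_ne_zero_iff j j.injective, ← map_zero (MvPolynomial.aeval (R := ℂ) (ratCoord b)), Ne,
      (algebraicIndependent_ratCoord b).eq_iff]
    exact hq0
  apply mul_right_cancel₀ (mul_ne_zero (pow_ne_zero n hs) hne)
  rw [← key hq, ← map_mul f, ← map_mul j, h, key hp, key hq, mul_left_comm, ← map_mul j, h]

/-- The same for a function of degree `-1`. -/
theorem map_eq_inv_mul_of_degree_neg_one [Nonempty ι] (j : RatFun E →ₐ[ℂ] Ω) (f : Ω →ₐ[ℂ] Ω) {s : Ω}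
    (hs : s ≠ 0) (hf : ∀ i, f (j (ratCoord b i)) = s * j (ratCoord b i)) {u : RatFun E}
    (hu : ∀ c : ℂˣ, ratPullback (scaled ρ) (c, 1) u * algebraMap ℂ _ (c : ℂ) = u) :
    f (j u) = s⁻¹ * j u := by
  cases nonempty_fintype ι
  obtain ⟨i⟩ := ‹Nonempty ι›
  have hx (c : ℂˣ) : ratPullback (scaled ρ) (c, 1) (ratCoord b i) =
      algebraMap ℂ _ (c : ℂ) * ratCoord b i := by
    rw [ratPullback_ratCoord_of_repr (κ := Unit) (scaled ρ) b (s := fun _ => (c : ℂ))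
      (f := fun _ => i) (fun v => by simp [scaled_apply])]
    simp
  have h := map_eq_of_invariant ρ b j f hs hf (u := u * ratCoord b i) fun c => by
    conv_rhs => rw [← hu c]
    rw [map_mul, hx, mul_assoc]
  have hi : j (ratCoord b i) ≠ 0 :=
    (map_ne_zero_iff j j.injective).mpr ((algebraicIndependent_ratCoord b).ne_zero i)
  rw [map_mul, map_mul, hf] at h
  apply mul_right_cancel₀ hi
  rw [← mul_right_inj' hs, mul_assoc, mul_inv_cancel_left₀ hs, ← h]
  ring

/-- On a projective space that is a point all functions are constant. -/
theorem projQuotientField_eq_bot {ι : Type*} [Unique ι] (b : Module.Basis ι ℂ E) : projQuotientField ρ = ⊥ := by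
  rw [eq_bot_iff]
  intro u hu
  rw [mem_projQuotientField_iff] at hu
  obtain ⟨n, p, q, hp, hq, hq0, h⟩ := exists_homogeneous_fraction_of_invariant ρ b
    (fun c => hu (c, 1))
  have key {r : MvPolynomial ι ℂ} (hr : r.IsHomogeneous n) :
      MvPolynomial.aeval (ratCoord b) r = ratCoord b default ^ n *
        algebraMap ℂ _ (MvPolynomial.eval 1 r) := by
    have h1 := aeval_smul_of_isHomogeneous hr (ratCoord b default) (1 : ι → RatFun E)
    have h2 : (fun i => ratCoord b default * (1 : ι → RatFun E) i) = ratCoord b := by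
      ext i
      rw [Pi.one_apply, mul_one, Unique.eq_default i]
    have h3 : MvPolynomial.aeval (1 : ι → RatFun E) r =
        algebraMap ℂ _ (MvPolynomial.eval 1 r) := by
      have := MvPolynomial.aeval_algebraMap_apply (RatFun E) (1 : ι → ℂ) r
      rw [MvPolynomial.aeval_eq_eval] at this
      convert this using 3
      ext i
      simp
    rw [← h3, ← h1, h2]
  have hne : MvPolynomial.aeval (ratCoord b) q ≠ 0 := by
    rw [← map_zero (MvPolynomial.aeval (R := ℂ) (ratCoord b)), Ne,
      (algebraicIndependent_ratCoord b).eq_iff]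
    exact hq0
  refine Algebra.mem_bot.mpr ⟨MvPolynomial.eval 1 p / MvPolynomial.eval 1 q, ?_⟩
  rw [key hq] at hne
  rw [key hq, key hp] at h
  rw [map_div₀, div_eq_iff (right_ne_zero_of_mul hne)]
  apply mul_left_cancel₀ (left_ne_zero_of_mul hne)
  rw [← h]
  ring

end Homothety

section Copies

variable {V κ Γ : Type*} [AddCommGroup V] [Module ℂ V] [Group Γ] (ρ : Representation ℂ Γ V)
  (b : Module.Basis κ ℂ V) (c : ℕ)

/-- The basis of the sum of copies of a vector space given by a basis of it. -/
def copiesBasis : Module.Basis (Fin c × κ) ℂ (DirectSum (Fin c) fun _ => V) :=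
  Module.Basis.reindex (DFinsupp.basis fun _ : Fin c => b) (Equiv.sigmaEquivProd (Fin c) κ)

theorem copiesBasis_repr (v : DirectSum (Fin c) fun _ => V) (i : Fin c × κ) :
    (copiesBasis b c).repr v i = b.repr (v i.1) i.2 := by
  rfl

variable [FiniteDimensional ℂ V] [Fintype κ] [DecidableEq κ]

theorem ratPullback_copies (x : ℂˣ × Γ) (i : Fin c) (k : κ) :
    ratPullback (scaled (copies ρ c)) x (ratCoord (copiesBasis b c) (i, k)) =
      ∑ l, algebraMap ℂ _ (LinearMap.toMatrix b b (scaled ρ x) k l) *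
        ratCoord (copiesBasis b c) (i, l) := by
  refine ratPullback_ratCoord_of_repr (scaled (copies ρ c)) _ (f := fun l => (i, l)) fun v => ?_
  have h : (scaled (copies ρ c) x v) i = scaled ρ x (v i) := by
    simp [scaled_apply, Representation.directSum, DirectSum.lmap]
    rfl
  simp only [copiesBasis_repr, h]
  rw [← LinearMap.toMatrix_mulVec_repr b b (scaled ρ x)]
  rfl

end Copies

/-! ### Invariants of a group acting on the rows of a matrix -/

/-- Let `Ω` be generated by a field `K₂` and the entries of a matrix `A`. A group `Γ` acts on the
rows of `A` as on `V`, and maps `η` act on `K₂` and multiply `A` by scalars. If a frame `T` turns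
the rows into invariant ones, then the first `c` rows of `A`, viewed as a point of `V^c`, and the
invariant coordinates of the other rows describe the invariants. -/
theorem nonempty_frac_equiv_of_frame {V κ Γ Δ : Type*} [AddCommGroup V] [Module ℂ V]
    [FiniteDimensional ℂ V] [Fintype κ] [DecidableEq κ] [Nonempty κ] [Group Γ]
    (ρ : Representation ℂ Γ V) (b : Module.Basis κ ℂ V) (c : ℕ) (hc : 0 < c) {N ι₂ : Type*}
    [Fintype N] [Fintype ι₂] {K₂ Ω : Type*} [Field K₂] [Algebra ℂ K₂] [Field Ω] [Algebra ℂ Ω]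
    {z : ι₂ → K₂} (hz : Generates z) (j₂ : K₂ →ₐ[ℂ] Ω) (A : Matrix (Fin c ⊕ N) κ Ω)
    (hind : AlgebraicIndependent ℂ
      (Sum.elim (fun i : (Fin c ⊕ N) × κ => A i.1 i.2) fun i => j₂ (z i)))
    {θ : ℂˣ × Γ → Ω →ₐ[ℂ] Ω} {η : Δ → Ω →ₐ[ℂ] Ω} {τ : Δ → K₂ →ₐ[ℂ] K₂}
    (hθA : ∀ x, A.map (θ x) =
      A * ((LinearMap.toMatrix b b (scaled ρ x)).map (algebraMap ℂ Ω)).transpose)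
    (hθ₂ : ∀ x u, θ x (j₂ u) = j₂ u) {s : Δ → Ω} (hs : ∀ h, s h ≠ 0)
    (hηA : ∀ h, A.map (η h) = s h • A) (hη₂ : ∀ h u, η h (j₂ u) = j₂ (τ h u))
    {T : Matrix κ κ (RatFun (DirectSum (Fin c) fun _ => V))} (hT : IsUnit T.det)
    (hTx : ∀ x : ℂˣ × Γ, T.map (ratPullback (scaled (copies ρ c)) x) *
      (LinearMap.toMatrix b b (scaled ρ x)).map (algebraMap ℂ _) = T)
    {k₂ : Subalgebra ℂ K₂} (hk₂ : ∀ u, u ∈ k₂ ↔ ∀ h, τ h u = u) {S : Subalgebra ℂ Ω}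
    (hS : ∀ u, u ∈ S ↔ u ∈ IntermediateField.adjoin ℂ (Set.range
      (Sum.elim (fun i : (Fin c ⊕ N) × κ => A i.1 i.2) fun i => j₂ (z i))) ∧
      (∀ x, θ x u = u) ∧ ∀ h, η h u = u) :
    IsDomain (MvPolynomial (N × κ) (projQuotientField (copies ρ c) ⊗[ℂ] k₂)) ∧
      Nonempty (Frac (MvPolynomial (N × κ) (projQuotientField (copies ρ c) ⊗[ℂ] k₂)) ≃ₐ[ℂ] S) := by
  classical
  let x := ratCoord (copiesBasis b c)
  -- the first `c` rows are the coordinates of a generic point of `V^c`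
  obtain ⟨j₁, hj₁⟩ := exists_algHom_of_algebraicIndependent
    (algebraicIndependent_ratCoord (copiesBasis b c)) (generates_ratCoord (copiesBasis b c))
    (y := fun i => A (.inl i.1) i.2)
    (hind.comp (fun i : Fin c × κ => .inl (.inl i.1, i.2)) (by
      rintro ⟨i, k⟩ ⟨i', k'⟩ h
      simpa using h))
  have hjx (i k) : j₁ (x (i, k)) = A (.inl i) k := hj₁ (i, k)
  let TΩ := T.map j₁
  have hTΩ : IsUnit TΩ.det := by
    have := hT.map j₁
    rwa [AlgHom.map_det] at this
  -- the coordinates of the remaining rows in the invariant frame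
  let t (i : N × κ) : Ω := (A * TΩ.transpose) (.inr i.1) i.2
  have hθA' (y i k) : θ y (A i k) =
      ∑ l, algebraMap ℂ Ω (LinearMap.toMatrix b b (scaled ρ y) k l) * A i l := by
    have := congrFun (congrFun (hθA y) i) k
    rw [Matrix.map_apply, Matrix.mul_apply] at this
    rw [this]
    exact Finset.sum_congr rfl fun l _ => mul_comm _ _
  have hηA' (h i k) : η h (A i k) = s h * A i k := congrFun (congrFun (hηA h) i) k
  have hθ₁ (y u) : θ y (j₁ u) = j₁ (ratPullback (scaled (copies ρ c)) y u) := by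
    refine algHom_eq_of_generates (generates_ratCoord (copiesBasis b c))
      (f := (θ y).comp j₁) (g := j₁.comp (ratPullback (scaled (copies ρ c)) y).toAlgHom) ?_ u
    rintro ⟨i, k⟩
    change θ y (j₁ (x (i, k))) = j₁ (ratPullback _ _ (x (i, k)))
    rw [ratPullback_copies, hjx, hθA', map_sum]
    exact Finset.sum_congr rfl fun l _ => by rw [map_mul, hj₁, AlgHom.commutes]
  have hηx (h) (i : Fin c × κ) : η h (j₁ (x i)) = s h * j₁ (x i) := by
    rw [hjx, hηA']
  have : Nonempty (Fin c × κ) := ⟨⟨0, hc⟩, Classical.arbitrary κ⟩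
  -- `T` has degree `-1` in the coordinates, so that the scalars cancel in `t`
  have hηT (h k l) : η h (TΩ k l) = (s h)⁻¹ * TΩ k l := by
    refine map_eq_inv_mul_of_degree_neg_one (copies ρ c) (copiesBasis b c) j₁ (η h) (hs h)
      (hηx h) fun a => ?_
    have h1 : LinearMap.toMatrix b b (scaled ρ (a, 1)) = (a : ℂ) • 1 := by
      rw [← LinearMap.toMatrix_one b, ← map_smul]
      congr 1
      ext v
      simp [scaled_apply]
    have h2 := congrFun (congrFun (hTx (a, 1)) k) l
    rw [h1, Matrix.mul_apply, Finset.sum_eq_single l (fun m _ hm => by simp [hm]) (by simp)] at h2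
    rw [Matrix.map_apply, Matrix.map_apply, Matrix.smul_apply, Matrix.one_apply_eq,
      smul_eq_mul, mul_one] at h2
    exact h2
  have ht (i) : t i = ∑ l, A (.inr i.1) l * TΩ i.2 l := rfl
  have hθt (y i) : θ y (t i) = t i := by
    have h1 (l) : TΩ i.2 l = ∑ m, θ y (TΩ i.2 m) *
        algebraMap ℂ Ω (LinearMap.toMatrix b b (scaled ρ y) m l) := by
      have h2 := congrArg j₁ (congrFun (congrFun (hTx y) i.2) l)
      rw [Matrix.mul_apply, map_sum] at h2
      rw [show TΩ i.2 l = j₁ (T i.2 l) from rfl, ← h2]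
      refine Finset.sum_congr rfl fun m _ => ?_
      rw [map_mul]
      exact congrArg₂ (· * ·) (hθ₁ y _).symm (j₁.commutes _)
    rw [ht, map_sum]
    simp only [map_mul, hθA']
    refine Eq.trans ?_ (Finset.sum_congr rfl fun l _ => congrArg (A (.inr i.1) l * ·) (h1 l).symm)
    simp only [Finset.sum_mul, Finset.mul_sum]
    rw [Finset.sum_comm]
    exact Finset.sum_congr rfl fun l _ => Finset.sum_congr rfl fun m _ => by ring
  have hηt (h i) : η h (t i) = t i := by
    rw [ht, map_sum]
    refine Finset.sum_congr rfl fun l _ => ?_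
    rw [map_mul, hηA', hηT]
    field_simp [hs h]
  let fam := Sum.elim (fun i => j₁ (x i)) (Sum.elim (fun i => j₂ (z i)) t)
  let F := IntermediateField.adjoin ℂ (Set.range fam)
  have hfam (i) : fam i ∈ F := IntermediateField.subset_adjoin ℂ _ ⟨i, rfl⟩
  have hj₁F : ∀ u, j₁ u ∈ F :=
    mem_of_generates (generates_ratCoord (copiesBasis b c)) j₁ fun i => hfam (.inl i)
  let fam' := Sum.elim (fun i : (Fin c ⊕ N) × κ => A i.1 i.2) fun i => j₂ (z i)
  have hF : ∀ i, fam' i ∈ F := by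
    rintro (⟨i | i, k⟩ | i)
    · change A (.inl i) k ∈ F
      rw [← hjx]
      exact hj₁F _
    · have hM : A = A * TΩ.transpose * (TΩ.transpose)⁻¹ :=
        (Matrix.mul_nonsing_inv_cancel_right _ _ (by rwa [Matrix.det_transpose])).symm
      change A (.inr i) k ∈ F
      rw [hM, Matrix.mul_apply]
      exact sum_mem fun l _ => mul_mem (hfam (.inr (.inr (i, l))))
        (matrix_inv_mem (fun _ _ => hj₁F _) _ _)
    · exact hfam (.inr (.inl i))
  let F' := IntermediateField.adjoin ℂ (Set.range fam')
  have hfam' (i) : fam' i ∈ F' := IntermediateField.subset_adjoin ℂ _ ⟨i, rfl⟩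
  have hj₁F' : ∀ u, j₁ u ∈ F' :=
    mem_of_generates (generates_ratCoord (copiesBasis b c)) j₁ fun i => by
      rw [hj₁]
      exact hfam' (.inl (.inl i.1, i.2))
  have hF' : ∀ i, fam i ∈ F' := by
    rintro (i | i | i)
    · exact hj₁F' _
    · exact hfam' (.inr i)
    · exact sum_mem fun l _ => mul_mem (hfam' (.inl (.inr i.1, l))) (hj₁F' _)
  have hFF : F = F' := le_antisymm
    (IntermediateField.adjoin_le_iff.mpr (by rintro _ ⟨i, rfl⟩; exact hF' i))
    (IntermediateField.adjoin_le_iff.mpr (by rintro _ ⟨i, rfl⟩; exact hF i))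
  have hind' : AlgebraicIndependent ℂ fam := algebraicIndependent_of_card hind (by
    simp only [Fintype.card_sum, Fintype.card_prod]
    ring) hF
  exact nonempty_frac_equiv_invariants (generates_ratCoord (copiesBasis b c)) hz j₁ j₂ t hind'
    (γ := fun y => (ratPullback (scaled (copies ρ c)) y).toAlgHom)
    (fun u => mem_projQuotientField_iff (copies ρ c) u) hk₂ hθ₁ hθ₂ hθt
    (fun h u hu => map_eq_of_invariant (copies ρ c) (copiesBasis b c) j₁ (η h) (hs h) (hηx h)
      fun a => (mem_projQuotientField_iff _ _).mp hu _) hη₂ hηt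
    (fun u => by rw [hS]; exact and_congr_left' (by change _ ∈ F' ↔ _ ∈ F; rw [hFF]))

/-! ### Coordinates on the space of matrices -/

/-- The elements fixed by a family of endomorphisms. -/
def fixedSubalgebra {Γ Ω : Type*} [CommRing Ω] [Algebra ℂ Ω] (f : Γ → Ω →ₐ[ℂ] Ω) :
    Subalgebra ℂ Ω where
  carrier := {u | ∀ g, f g u = u}
  mul_mem' hx hy g := by rw [map_mul, hx g, hy g]
  add_mem' hx hy g := by rw [map_add, hx g, hy g]
  algebraMap_mem' r g := (f g).commutes r

section Cell

variable {I M K : Type*} [Fintype I] [DecidableEq I] [Field K]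

/-- The coordinates on the big cell of the Grassmannian of the column space of a matrix. -/
def cellCoord (X : Matrix (I ⊕ M) I K) : Matrix M I K := X.toRows₂ * X.toRows₁⁻¹

theorem cellCoord_mul {X : Matrix (I ⊕ M) I K} (hX : IsUnit X.toRows₁.det) :
    cellCoord X * X.toRows₁ = X.toRows₂ :=
  Matrix.nonsing_inv_mul_cancel_right _ _ hX

variable [Algebra ℂ K]

/-- The field generated by the coordinates of the column space of a matrix. -/
def cellField (X : Matrix (I ⊕ M) I K) : IntermediateField ℂ K :=
  IntermediateField.adjoin ℂ (Set.range fun i : M × I => cellCoord X i.1 i.2)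

theorem cellCoord_mem (X : Matrix (I ⊕ M) I K) (i j) : cellCoord X i j ∈ cellField X :=
  IntermediateField.subset_adjoin ℂ _ ⟨(i, j), rfl⟩

/-- The coordinates of the column space, as elements of the field that they generate. -/
def cellMatrix (X : Matrix (I ⊕ M) I K) : Matrix M I (cellField X) :=
  .of fun i j => ⟨cellCoord X i j, cellCoord_mem X i j⟩

theorem generates_cellMatrix (X : Matrix (I ⊕ M) I K) :
    Generates (fun i : M × I => cellMatrix X i.1 i.2) :=
  generates_adjoin fun i : M × I => cellCoord X i.1 i.2

variable {X : Matrix (I ⊕ M) I K}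

theorem isUnit_det_toRows₁ (hind : AlgebraicIndependent ℂ fun i : (I ⊕ M) × I => X i.1 i.2) :
    IsUnit X.toRows₁.det := by
  rw [isUnit_iff_ne_zero]
  have h : MvPolynomial.aeval (fun i : I × I => X (.inl i.1) i.2)
      (Matrix.mvPolynomialX I I ℂ).det = X.toRows₁.det := by
    rw [AlgHom.map_det]
    congr 1
    ext i j
    simp [Matrix.mvPolynomialX]
  rw [← h, ← map_zero (MvPolynomial.aeval (R := ℂ) (fun i : I × I => X (.inl i.1) i.2))]
  exact fun h0 => Matrix.det_mvPolynomialX_ne_zero I ℂ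
    ((hind.comp (fun i : I × I => (.inl i.1, i.2)) (by
      rintro ⟨i, k⟩ ⟨i', k'⟩ h
      simpa using h)) h0)

/-- Column operations do not change the column space. -/
theorem cellCoord_map_of_mul_right (hX : IsUnit X.toRows₁.det) {f : K →ₐ[ℂ] K} {P : Matrix I I K}
    (h : X.map f = X * P) : (cellCoord X).map f = cellCoord X := by
  have h1 : X.toRows₁.map f = X.toRows₁ * P := by
    ext i j; exact congrFun (congrFun h (.inl i)) j
  have h2 : X.toRows₂.map f = X.toRows₂ * P := by
    ext i j; exact congrFun (congrFun h (.inr i)) j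
  have hu : IsUnit (X.toRows₁.map f).det := by
    have := hX.map f
    rwa [AlgHom.map_det] at this
  have h3 : (cellCoord X).map f * X.toRows₁.map f = cellCoord X * X.toRows₁.map f := by
    rw [← Matrix.map_mul, cellCoord_mul hX, h2, h1, ← Matrix.mul_assoc, cellCoord_mul hX]
  rw [← Matrix.mul_nonsing_inv_cancel_right _ ((cellCoord X).map f) hu, h3,
    Matrix.mul_nonsing_inv_cancel_right _ _ hu]

theorem mem_of_cellField_le (hX : IsUnit X.toRows₁.det) {T : Matrix I I K}
    (hT : IsUnit T.det) (hTX : ∀ i j, T i j ∈ cellField X) {F : IntermediateField ℂ K}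
    (hF : cellField X ≤ F) (h : ∀ i j, (T * X.toRows₁) i j ∈ F) (i j) : X i j ∈ F := by
  have h1 : ∀ i j, X.toRows₁ i j ∈ F := by
    rw [← Matrix.nonsing_inv_mul_cancel_left _ X.toRows₁ hT]
    exact matrix_mul_mem (matrix_inv_mem fun i j => hF (hTX i j)) h
  have h2 : ∀ i j, X.toRows₂ i j ∈ F := by
    rw [← cellCoord_mul hX]
    exact matrix_mul_mem (fun i j => hF (cellCoord_mem X i j)) h1
  rcases i with i | i
  · exact h1 i j
  · exact h2 i j

/-- The column space of a generic matrix and any frame of it are independent coordinates. -/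
theorem algebraicIndependent_frame_cellCoord [Fintype M]
    (hind : AlgebraicIndependent ℂ fun i : (I ⊕ M) × I => X i.1 i.2) {T : Matrix I I K}
    (hT : IsUnit T.det) (hTX : ∀ i j, T i j ∈ cellField X) :
    AlgebraicIndependent ℂ (Sum.elim (fun i : I × I => (T * X.toRows₁) i.1 i.2)
      fun i : M × I => cellCoord X i.1 i.2) := by
  refine algebraicIndependent_of_card hind (by simp [add_mul]) fun i => ?_
  refine mem_of_cellField_le (isUnit_det_toRows₁ hind) hT hTX ?_ (fun i j => ?_) _ _
  · exact IntermediateField.adjoin.mono _ _ _ (by rintro _ ⟨i, rfl⟩; exact ⟨.inr i, rfl⟩)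
  · exact IntermediateField.subset_adjoin ℂ _ ⟨.inl (i, j), rfl⟩

variable [Fintype M]

theorem toRows₁_map_of_mul_left (hX : IsUnit X.toRows₁.det) {f : K →ₐ[ℂ] K}
    {S : Matrix (I ⊕ M) (I ⊕ M) K} (h : X.map f = S * X) :
    X.toRows₁.map f = topM S (cellCoord X) * X.toRows₁ := by
  rw [topM, Matrix.add_mul, Matrix.mul_assoc, cellCoord_mul hX]
  ext i j
  refine (congrFun (congrFun h (.inl i)) j).trans ?_
  simp [Matrix.mul_apply, Matrix.toBlocks₁₁, Matrix.toBlocks₁₂]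

theorem toRows₂_map_of_mul_left (hX : IsUnit X.toRows₁.det) {f : K →ₐ[ℂ] K}
    {S : Matrix (I ⊕ M) (I ⊕ M) K} (h : X.map f = S * X) :
    X.toRows₂.map f = botM S (cellCoord X) * X.toRows₁ := by
  rw [botM, Matrix.add_mul, Matrix.mul_assoc, cellCoord_mul hX]
  ext i j
  refine (congrFun (congrFun h (.inr i)) j).trans ?_
  simp [Matrix.mul_apply, Matrix.toBlocks₂₁, Matrix.toBlocks₂₂]

theorem isUnit_det_topM (hX : IsUnit X.toRows₁.det) {f : K →ₐ[ℂ] K}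
    {S : Matrix (I ⊕ M) (I ⊕ M) K} (h : X.map f = S * X) :
    IsUnit (topM S (cellCoord X)).det := by
  have := hX.map f
  rw [AlgHom.map_det] at this
  change IsUnit (X.toRows₁.map f).det at this
  rw [toRows₁_map_of_mul_left hX h, Matrix.det_mul] at this
  exact isUnit_of_mul_isUnit_left this

/-- Row operations act on the column space by fractional linear transformations. -/
theorem cellCoord_map_mul_topM (hX : IsUnit X.toRows₁.det) {f : K →ₐ[ℂ] K}
    {S : Matrix (I ⊕ M) (I ⊕ M) K} (h : X.map f = S * X) :
    (cellCoord X).map f * topM S (cellCoord X) = botM S (cellCoord X) := by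
  have h1 : (cellCoord X).map f * topM S (cellCoord X) * X.toRows₁ =
      botM S (cellCoord X) * X.toRows₁ := by
    rw [Matrix.mul_assoc, ← toRows₁_map_of_mul_left hX h, ← toRows₂_map_of_mul_left hX h,
      ← Matrix.map_mul, cellCoord_mul hX]
  rw [← Matrix.mul_nonsing_inv_cancel_right _ (_ * topM S (cellCoord X)) hX, h1,
    Matrix.mul_nonsing_inv_cancel_right _ _ hX]

end Cell

section Frame

variable {H : Over (Spec (CommRingCat.of ℂ))} [GrpObj H] {n : ℕ} {M W K : Type*} [Fintype M]
  [DecidableEq M] [AddCommGroup W] [Module ℂ W] {σ : Representation ℂ (Points H) W}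
  (b : Module.Basis (Fin n ⊕ M) ℂ W) [Field K] [Algebra ℂ K]

/-- There is a frame of the column space of a generic matrix on which the group acts by scalars:
the twist of the universal subbundle by a line bundle descends to the quotient of the
Grassmannian. -/
theorem exists_frame_of_columns [LocallyOfFiniteType H.hom] [QuasiCompact H.hom]
    [FiniteDimensional ℂ W] (hσ : IsAlgebraicRep σ) (hn : 0 < n) (L : LinearizedLineBundle n σ)
    (hL : L.TwistTrivialOn (projKernel σ)) (hfree : ActsAlmostFreely σ n (projKernel σ))
    {X : Matrix (Fin n ⊕ M) (Fin n) K}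
    (hind : AlgebraicIndependent ℂ fun i : (Fin n ⊕ M) × Fin n => X i.1 i.2)
    {η : Points H → K →ₐ[ℂ] K} (hη1 : ∀ u, η 1 u = u) (hη : ∀ g h u, η (g * h) u = η h (η g u))
    (hX : ∀ h, X.map (η h) = (LinearMap.toMatrix b b (σ h)).map (algebraMap ℂ K) * X) :
    ∃ (τ : Points H → cellField X →ₐ[ℂ] cellField X) (T : Matrix (Fin n) (Fin n) K)
      (s : Points H → K), (∀ h u, (τ h u : K) = η h u) ∧ IsUnit T.det ∧
      (∀ i j, T i j ∈ cellField X) ∧ (∀ h, s h ≠ 0) ∧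
      ∀ h, (T * X.toRows₁).map (η h) = s h • (T * X.toRows₁) := by
  have hX1 := isUnit_det_toRows₁ hind
  let S (h : Points H) : Matrix (Fin n ⊕ M) (Fin n ⊕ M) ℂ := LinearMap.toMatrix b b (σ h)
  have htop (h i j) : topM ((S h).map (algebraMap ℂ K)) (cellCoord X) i j ∈ cellField X := by
    rw [topM_apply]
    exact add_mem ((cellField X).algebraMap_mem _) (sum_mem fun μ _ =>
      mul_mem ((cellField X).algebraMap_mem _) (cellCoord_mem X _ _))
  have hbot (h i j) : botM ((S h).map (algebraMap ℂ K)) (cellCoord X) i j ∈ cellField X := by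
    rw [botM_apply]
    exact add_mem ((cellField X).algebraMap_mem _) (sum_mem fun μ _ =>
      mul_mem ((cellField X).algebraMap_mem _) (cellCoord_mem X _ _))
  have hτ (h) : ∃ τ : cellField X →ₐ[ℂ] cellField X, ∀ u, (τ u : K) = η h u := by
    refine exists_restrict_adjoin _ (η h) ?_
    rintro ⟨i, j⟩
    change (cellCoord X).map (η h) i j ∈ cellField X
    have e := cellCoord_map_mul_topM hX1 (hX h)
    rw [← Matrix.mul_nonsing_inv_cancel_right _ ((cellCoord X).map (η h))
      (isUnit_det_topM hX1 (hX h)), e]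
    exact matrix_mul_mem (hbot h) (matrix_inv_mem (htop h)) i j
  choose τ hτ using hτ
  have hZ : (cellMatrix X).map (cellField X).val = cellCoord X := rfl
  have hSmap (h) : ((S h).map (algebraMap ℂ (cellField X))).map (cellField X).val =
      (S h).map (algebraMap ℂ K) := rfl
  have htop' (h) : (topM ((S h).map (algebraMap ℂ (cellField X))) (cellMatrix X)).map
      (cellField X).val = topM ((S h).map (algebraMap ℂ K)) (cellCoord X) :=
    topM_map (cellField X).val.toRingHom _ _
  have hbot' (h) : (botM ((S h).map (algebraMap ℂ (cellField X))) (cellMatrix X)).map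
      (cellField X).val = botM ((S h).map (algebraMap ℂ K)) (cellCoord X) :=
    botM_map (cellField X).val.toRingHom _ _
  have hinj : Function.Injective (cellField X).val := Subtype.val_injective
  have hτη (h) (N : Matrix (Fin n) (Fin n) (cellField X)) :
      (N.map (τ h)).map (cellField X).val = (N.map (cellField X).val).map (η h) := by
    ext i j; exact hτ h _
  obtain ⟨T, ℓ, hT, hℓ, hTℓ⟩ := exists_grassmannian_frame b hσ hn L hL hfree
    (Z := cellMatrix X) (τ := τ) (AlgebraicIndependent.of_comp (cellField X).val
      ((algebraicIndependent_frame_cellCoord hind (T := 1) (by simp) (fun i j => by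
        rw [Matrix.one_apply]; split_ifs
        exacts [one_mem _, zero_mem _])).comp Sum.inr Sum.inr_injective))
    (generates_cellMatrix X) (fun u => Subtype.ext (by rw [hτ, hη1]))
    (fun g h u => Subtype.ext (by rw [hτ, hτ, hτ, hη]))
    (fun h => by
      have := isUnit_det_topM hX1 (hX h)
      rw [← htop', isUnit_iff_ne_zero] at this
      rw [isUnit_iff_ne_zero]
      refine fun h0 => this ?_
      rw [← AlgHom.mapMatrix_apply, ← AlgHom.map_det, h0, map_zero])
    (fun h => by
      apply Matrix.map_injective hinj
      beta_reduce
      rw [Matrix.map_mul, htop', hbot', ← cellCoord_map_mul_topM hX1 (hX h)]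
      congr 1
      ext i j
      exact hτ h _)
  refine ⟨τ, T.map (cellField X).val, fun h => ((ℓ h : K))⁻¹, hτ, ?_, fun i j => (T i j).2,
    fun h => inv_ne_zero fun h0 => hℓ h (Subtype.ext h0), fun h => ?_⟩
  · have := hT.map (cellField X).val
    rwa [AlgHom.map_det] at this
  · have h1 := congrArg (fun N => Matrix.map N (cellField X).val) (hTℓ h)
    have h2 : (ℓ h • topM ((S h).map (algebraMap ℂ (cellField X))) (cellMatrix X)).map
        (cellField X).val = (ℓ h : K) • topM ((S h).map (algebraMap ℂ K)) (cellCoord X) := by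
      rw [← htop']
      ext i j
      rfl
    beta_reduce at h1
    rw [Matrix.map_mul, hτη, h2] at h1
    have hℓ' : (ℓ h : K) ≠ 0 := fun h0 => hℓ h (Subtype.ext h0)
    rw [Matrix.map_mul, toRows₁_map_of_mul_left hX1 (hX h), ← Matrix.mul_assoc]
    nth_rw 2 [← h1]
    rw [Matrix.mul_smul, Matrix.smul_mul, smul_smul, inv_mul_cancel₀ hℓ', one_smul]

end Frame

/-! ### Invariants of row and column operations -/

section RowsColumns

variable {n : ℕ} {M K Δ : Type*} [Field K] [Algebra ℂ K]
  {X : Matrix (Fin n ⊕ M) (Fin n) K}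

/-- The invariants of the field generated by the coordinates of the column space. -/
def cellInvariants (X : Matrix (Fin n ⊕ M) (Fin n) K) (η : Δ → K →ₐ[ℂ] K) :
    Subalgebra ℂ (cellField X) :=
  (fixedSubalgebra η).comap (cellField X).val

theorem map_eq_of_mem_cellField (hX : IsUnit X.toRows₁.det) {f : K →ₐ[ℂ] K}
    {P : Matrix (Fin n) (Fin n) K} (h : X.map f = X * P) (u : cellField X) : f u = u :=
  algHom_eq_of_generates (generates_cellMatrix X) (f := f.comp (cellField X).val)
    (g := (cellField X).val)
    (fun i => congrFun (congrFun (cellCoord_map_of_mul_right hX h) i.1) i.2) u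

/-- Invariants of row and column operations: after multiplication of the upper block of `X` by an
almost invariant frame `T`, the row operations act on it by scalars, so that only their action on
the column space matters. -/
theorem nonempty_frac_equiv_of_matrix [Fintype M]
    (hind : AlgebraicIndependent ℂ fun i : (Fin n ⊕ M) × Fin n => X i.1 i.2)
    {η : Δ → K →ₐ[ℂ] K} {τ : Δ → cellField X →ₐ[ℂ] cellField X}
    (hτ : ∀ h u, (τ h u : K) = η h u) {T : Matrix (Fin n) (Fin n) K} (hT : IsUnit T.det)
    (hTX : ∀ i j, T i j ∈ cellField X) {s : Δ → K} (hs : ∀ h, s h ≠ 0)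
    (hη : ∀ h, (T * X.toRows₁).map (η h) = s h • (T * X.toRows₁))
    {V Γ : Type*} [AddCommGroup V] [Module ℂ V]
    [FiniteDimensional ℂ V] [Group Γ] (ρ : Representation ℂ Γ V) (b : Module.Basis (Fin n) ℂ V)
    (hn : 0 < n) {c : ℕ} (hc : 0 < c) {N : Type*} [Fintype N] (e : Fin c ⊕ N ≃ Fin n)
    (hgen : Generates fun i : (Fin n ⊕ M) × Fin n => X i.1 i.2) {θ : ℂˣ × Γ → K →ₐ[ℂ] K}
    (hθ : ∀ x, X.map (θ x) =
      X * ((LinearMap.toMatrix b b (scaled ρ x)).map (algebraMap ℂ K)).transpose)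
    {T₁ : Matrix (Fin n) (Fin n) (RatFun (DirectSum (Fin c) fun _ => V))} (hT₁ : IsUnit T₁.det)
    (hT₁x : ∀ x : ℂˣ × Γ, T₁.map (ratPullback (scaled (copies ρ c)) x) *
      (LinearMap.toMatrix b b (scaled ρ x)).map (algebraMap ℂ _) = T₁)
    {S : Subalgebra ℂ K} (hS : ∀ u, u ∈ S ↔ (∀ x, θ x u = u) ∧ ∀ h, η h u = u) :
    IsDomain (MvPolynomial (N × Fin n)
      (projQuotientField (copies ρ c) ⊗[ℂ] cellInvariants X η)) ∧
    Nonempty (Frac (MvPolynomial (N × Fin n)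
      (projQuotientField (copies ρ c) ⊗[ℂ] cellInvariants X η)) ≃ₐ[ℂ] S) := by
  have hX := isUnit_det_toRows₁ hind
  have : Nonempty (Fin n) := ⟨⟨0, hn⟩⟩
  let A := (T * X.toRows₁).submatrix e id
  have hθ₂ (x) := map_eq_of_mem_cellField hX (hθ x)
  have hA : AlgebraicIndependent ℂ (Sum.elim (fun i : (Fin c ⊕ N) × Fin n => A i.1 i.2)
      fun i : M × Fin n => (cellField X).val (cellMatrix X i.1 i.2)) := by
    convert (algebraicIndependent_frame_cellCoord hind hT hTX).comp
      (Sum.map (Prod.map e id) id : _ → _)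
      ((e.injective.prodMap Function.injective_id).sumMap Function.injective_id) using 1
    ext (i | i) <;> rfl
  have hF : IntermediateField.adjoin ℂ (Set.range
      (Sum.elim (fun i : (Fin c ⊕ N) × Fin n => A i.1 i.2)
      fun i : M × Fin n => (cellField X).val (cellMatrix X i.1 i.2))) = ⊤ := by
    refine top_le_iff.mp fun u _ => mem_of_generates hgen (AlgHom.id ℂ K) (fun i => ?_) u
    refine mem_of_cellField_le hX hT hTX ?_ (fun i j => ?_) _ _
    · exact IntermediateField.adjoin.mono _ _ _ (by rintro _ ⟨i, rfl⟩; exact ⟨.inr i, rfl⟩)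
    · refine IntermediateField.subset_adjoin ℂ _ ⟨.inl (e.symm i, j), ?_⟩
      simp [A]
  refine nonempty_frac_equiv_of_frame ρ b c hc (generates_cellMatrix X) (cellField X).val A hA
    (θ := θ) (η := η) (τ := τ) (fun x => ?_) hθ₂ hs (fun h => ?_) (fun h u => (hτ h u).symm)
    hT₁ hT₁x (fun u => ?_) (fun u => ?_)
  · have hA₁ : X.toRows₁.map (θ x) = X.toRows₁ *
        ((LinearMap.toMatrix b b (scaled ρ x)).map (algebraMap ℂ K)).transpose := by
      ext i j; exact congrFun (congrFun (hθ x) (.inl i)) j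
    have hT' : T.map (θ x) = T := by
      ext i j; exact hθ₂ x ⟨T i j, hTX i j⟩
    have hTA : (T * X.toRows₁).map (θ x) = T * X.toRows₁ *
        ((LinearMap.toMatrix b b (scaled ρ x)).map (algebraMap ℂ K)).transpose := by
      rw [Matrix.map_mul, hA₁, hT', Matrix.mul_assoc]
    ext i j
    exact congrFun (congrFun hTA (e i)) j
  · ext i j
    exact congrFun (congrFun (hη h) (e i)) j
  · exact forall_congr' fun h => by rw [Subtype.ext_iff, hτ]; rfl
  · rw [hS, hF]
    simp

/-- The representation of the trivial group on the line. -/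
abbrev trivialLine : Representation ℂ Unit ℂ := Representation.trivial ℂ Unit ℂ

/-- The field generated by the column `i₀` of `X` and the coordinates of the column space of `X`:
the functions of a subspace and a vector in it. -/
def flagField (X : Matrix (Fin n ⊕ M) (Fin n) K) (i₀ : Fin n) : IntermediateField ℂ K :=
  IntermediateField.adjoin ℂ (Set.range
    (Sum.elim (fun i : Fin n => X (.inl i) i₀) fun i : M × Fin n => cellCoord X i.1 i.2))

theorem cellField_le_flagField (i₀ : Fin n) : cellField X ≤ flagField X i₀ :=
  IntermediateField.adjoin.mono _ _ _ (by rintro _ ⟨i, rfl⟩; exact ⟨.inr i, rfl⟩)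

/-- The flag variety of points in the column space is, after passing to quotients, a trivial
projective bundle over the Grassmannian. -/
theorem nonempty_frac_equiv_of_column [Fintype M]
    (hind : AlgebraicIndependent ℂ fun i : (Fin n ⊕ M) × Fin n => X i.1 i.2)
    {η : Δ → K →ₐ[ℂ] K} {τ : Δ → cellField X →ₐ[ℂ] cellField X}
    (hτ : ∀ h u, (τ h u : K) = η h u) {T : Matrix (Fin n) (Fin n) K} (hT : IsUnit T.det)
    (hTX : ∀ i j, T i j ∈ cellField X) {s : Δ → K} (hs : ∀ h, s h ≠ 0)
    (hη : ∀ h, (T * X.toRows₁).map (η h) = s h • (T * X.toRows₁))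
    {i₀ : Fin n} {N : Type*} [Fintype N] (e : Fin 1 ⊕ N ≃ Fin n) {θ : ℂˣ → K →ₐ[ℂ] K}
    (hθ : ∀ c, X.map (θ c) = algebraMap ℂ K (c : ℂ) • X)
    {S : Subalgebra ℂ K} (hS : ∀ u, u ∈ S ↔ u ∈ flagField X i₀ ∧ (∀ x, θ x u = u) ∧
      ∀ h, η h u = u) :
    Nonempty (Frac (MvPolynomial (N × Unit)
      ((⊥ : Subalgebra ℂ (RatFun (DirectSum (Fin 1) fun _ => ℂ))) ⊗[ℂ] cellInvariants X η)) ≃ₐ[ℂ]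
        S) := by
  have hX := isUnit_det_toRows₁ hind
  let A : Matrix (Fin 1 ⊕ N) Unit K := .of fun i _ => (T * X.toRows₁) (e i) i₀
  have hθ₂ (x : ℂˣ) := map_eq_of_mem_cellField hX (P := algebraMap ℂ K (x : ℂ) • 1)
    ((hθ x).trans (by rw [Matrix.mul_smul, Matrix.mul_one]))
  have hA : AlgebraicIndependent ℂ (Sum.elim (fun i : (Fin 1 ⊕ N) × Unit => A i.1 i.2)
      fun i : M × Fin n => (cellField X).val (cellMatrix X i.1 i.2)) := by
    convert (algebraicIndependent_frame_cellCoord hind hT hTX).comp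
      (Sum.map (fun i : (Fin 1 ⊕ N) × Unit => (e i.1, i₀)) id : _ → _)
      (Function.Injective.sumMap (fun i j h => Prod.ext (e.injective (Prod.ext_iff.mp h).1) rfl)
        Function.injective_id) using 1
    ext (i | i) <;> rfl
  let b := Module.Basis.singleton Unit ℂ
  -- a line has the invariant frame `x₀⁻¹`, as the group is that of the homotheties
  let x₀ := ratCoord (copiesBasis b 1) (0, ())
  have hx₀ : x₀ ≠ 0 := (algebraicIndependent_ratCoord _).ne_zero _
  have : Unique (Fin 1 × Unit) := ⟨⟨(0, ())⟩, fun _ => Subsingleton.elim _ _⟩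
  rw [← projQuotientField_eq_bot (copies trivialLine 1) (copiesBasis b 1)]
  have hmat (x : ℂˣ × Unit) : LinearMap.toMatrix b b (scaled trivialLine x) = (x.1 : ℂ) • 1 := by
    rw [← LinearMap.toMatrix_one b, ← map_smul]
    congr 1
  refine (nonempty_frac_equiv_of_frame trivialLine b 1 one_pos (generates_cellMatrix X)
    (cellField X).val A hA
    (θ := fun x => θ x.1) (η := η) (τ := τ) (fun x => ?_) (fun x => hθ₂ x.1) hs (fun h => ?_)
    (fun h u => (hτ h u).symm) (T := .of fun _ _ => x₀⁻¹) (by simpa) (fun x => ?_)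
    (fun u => ?_) (fun u => ?_)).2
  · have hT' : T.map (θ x.1) = T := by
      ext i j; exact hθ₂ x.1 ⟨T i j, hTX i j⟩
    have hTA : (T * X.toRows₁).map (θ x.1) = algebraMap ℂ K (x.1 : ℂ) • (T * X.toRows₁) := by
      rw [Matrix.map_mul, hT', ← Matrix.mul_smul]
      congr 1
      ext i j; exact congrFun (congrFun (hθ x.1) (.inl i)) j
    ext i j
    refine (congrFun (congrFun hTA (e i)) i₀).trans ?_
    rw [hmat, Matrix.mul_apply, Fintype.sum_unique, mul_comm]
    simp [A]
  · ext i j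
    exact congrFun (congrFun (hη h) (e i)) i₀
  · have h1 := ratPullback_copies trivialLine b 1 x 0 ()
    rw [hmat, Fintype.sum_unique] at h1
    ext i j
    rw [Matrix.mul_apply, Fintype.sum_unique, hmat, Matrix.map_apply, Matrix.map_apply,
      Matrix.of_apply, map_inv₀, h1]
    have hc : algebraMap ℂ (RatFun (DirectSum (Fin 1) fun _ => ℂ)) (x.1 : ℂ) ≠ 0 := by simp
    have h2 : ∀ i j : Unit, ((x.1 : ℂ) • (1 : Matrix Unit Unit ℂ)) i j = (x.1 : ℂ) := by simp
    rw [h2, mul_inv, mul_right_comm, inv_mul_cancel₀ hc, one_mul]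
  · exact forall_congr' fun h => by rw [Subtype.ext_iff, hτ]; rfl
  · rw [hS]
    refine and_congr ?_ (and_congr_left' ⟨fun h x => h x.1, fun h x => h (x, ())⟩)
    have hle : cellField X ≤ IntermediateField.adjoin ℂ (Set.range (Sum.elim
        (fun i : (Fin 1 ⊕ N) × Unit => A i.1 i.2)
        fun i : M × Fin n => (cellField X).val (cellMatrix X i.1 i.2))) :=
      IntermediateField.adjoin.mono _ _ _ (by rintro _ ⟨i, rfl⟩; exact ⟨.inr i, rfl⟩)
    have hA₀ (i : Fin n) : (T * X.toRows₁) i i₀ = A (e.symm i) () := by simp [A]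
    suffices flagField X i₀ = IntermediateField.adjoin ℂ (Set.range (Sum.elim
        (fun i : (Fin 1 ⊕ N) × Unit => A i.1 i.2)
        fun i : M × Fin n => (cellField X).val (cellMatrix X i.1 i.2))) by rw [this]
    apply le_antisymm
    · rw [flagField, IntermediateField.adjoin_le_iff]
      rintro _ ⟨i | i, rfl⟩
      · change X.toRows₁ i i₀ ∈ _
        rw [← Matrix.nonsing_inv_mul_cancel_left _ X.toRows₁ hT, Matrix.mul_apply]
        refine sum_mem fun k _ => mul_mem (matrix_inv_mem (fun i j => hle (hTX i j)) _ _) ?_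
        rw [hA₀]
        exact IntermediateField.subset_adjoin ℂ _ ⟨.inl (_, ()), rfl⟩
      · exact hle (cellCoord_mem X _ _)
    · rw [IntermediateField.adjoin_le_iff]
      rintro _ ⟨i | i, rfl⟩
      · change (T * X.toRows₁) (e i.1) i₀ ∈ flagField X i₀
        rw [Matrix.mul_apply]
        exact sum_mem fun k _ => mul_mem (cellField_le_flagField i₀ (hTX _ _))
          (IntermediateField.subset_adjoin ℂ _ ⟨.inl k, rfl⟩)
      · exact cellField_le_flagField i₀ (cellCoord_mem X _ _)

end RowsColumns

/-! ### Column spaces through a point -/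

/-- A matrix with a left inverse has an invertible upper block after a permutation of its rows. -/
theorem exists_perm_isUnit_det {n : ℕ} {M K : Type*} [Fintype M] [Field K]
    {N : Matrix (Fin n ⊕ M) (Fin n) K} {L : Matrix (Fin n) (Fin n ⊕ M) K} (h : L * N = 1) :
    ∃ π : Equiv.Perm (Fin n ⊕ M), IsUnit (N.submatrix π id).toRows₁.det := by
  have hspan : Submodule.span K (Set.range N) = ⊤ := by
    refine top_le_iff.mp fun v _ => ?_
    have hv : v = ∑ i, (Matrix.vecMul v L) i • N i := by
      rw [← Matrix.vecMul_eq_sum, Matrix.vecMul_vecMul, h, Matrix.vecMul_one]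
    rw [hv]
    exact sum_mem fun i _ => Submodule.smul_mem _ _ (Submodule.subset_span ⟨i, rfl⟩)
  have hd : Module.finrank K (Submodule.span K (Set.range N)) = n := by
    rw [hspan, finrank_top, Module.finrank_fin_fun]
  obtain ⟨f, hf, -, hind⟩ := Submodule.exists_fun_fin_finrank_span_eq K (Set.range N)
  choose g hg using fun i => hf (Fin.cast hd.symm i)
  have hgN : (fun i => N (g i)) = f ∘ Fin.cast hd.symm := funext hg
  have hli : LinearIndependent K fun i => N (g i) := by
    rw [hgN]
    exact hind.comp _ (Fin.cast_injective _)
  have hginj : Function.Injective g := fun i j hij => hli.injective (by simp only [hij])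
  obtain ⟨π, hπ⟩ := Equiv.Perm.exists_extending_pair Sum.inl g Sum.inl_injective hginj
  refine ⟨π, ?_⟩
  rw [← Matrix.isUnit_iff_isUnit_det, ← Matrix.linearIndependent_rows_iff_isUnit]
  convert hli using 2 with i
  ext j
  simp [Matrix.row, Matrix.toRows₁, hπ]

section Cell

variable {I M K : Type*} [Fintype I] [DecidableEq I] [Field K]

theorem cellCoord_mul_right (X : Matrix (I ⊕ M) I K) {P : Matrix I I K} (hP : IsUnit P.det) :
    cellCoord (X * P) = cellCoord X := by
  have h1 : (X * P).toRows₁ = X.toRows₁ * P := rfl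
  have h2 : (X * P).toRows₂ = X.toRows₂ * P := rfl
  rw [cellCoord, h1, h2, Matrix.mul_inv_rev, Matrix.mul_assoc,
    Matrix.mul_nonsing_inv_cancel_left _ _ hP, cellCoord]

/-- A matrix maps the points of the Grassmannian over a field of definition of it to points over
that field. -/
theorem cellCoord_mul_left_mem [Algebra ℂ K] [Fintype M] {X : Matrix (I ⊕ M) I K}
    (hX : IsUnit X.toRows₁.det) {F : IntermediateField ℂ K} (hF : ∀ i j, cellCoord X i j ∈ F)
    {P : Matrix (I ⊕ M) (I ⊕ M) K} (hP : ∀ i j, P i j ∈ F) (i j) : cellCoord (P * X) i j ∈ F := by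
  have h1 : ∀ i j, (X * X.toRows₁⁻¹) i j ∈ F := by
    rintro (i | i) j
    · change (X.toRows₁ * X.toRows₁⁻¹) i j ∈ F
      rw [Matrix.mul_nonsing_inv _ hX, Matrix.one_apply]
      split_ifs
      exacts [one_mem _, zero_mem _]
    · exact hF i j
  have h2 := matrix_mul_mem hP h1
  rw [← cellCoord_mul_right (P * X) (P := X.toRows₁⁻¹)
    (Matrix.isUnit_nonsing_inv_det _ hX), Matrix.mul_assoc]
  exact matrix_mul_mem (fun i j => h2 (.inr i) j) (matrix_inv_mem fun i j => h2 (.inl i) j) i j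

end Cell

/-- Column spaces through a given point: in the coordinates given by an invariant frame at the
point, they are described by invariant elements, which are linearly related by the condition that
they contain the point. -/
theorem nonempty_frac_equiv_of_point {n : ℕ} {M W K Γ : Type*} [Fintype M] [DecidableEq M]
    [AddCommGroup W] [Module ℂ W] [FiniteDimensional ℂ W] [Group Γ] (σ : Representation ℂ Γ W)
    (b : Module.Basis (Fin n ⊕ M) ℂ W) [Field K] [Algebra ℂ K] {X : Matrix (Fin n ⊕ M) (Fin n) K}
    (hind : AlgebraicIndependent ℂ fun i : (Fin n ⊕ M) × Fin n => X i.1 i.2)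
    {θ : ℂˣ → K →ₐ[ℂ] K} (hθ1 : ∀ u, θ 1 u = u)
    (hθ : ∀ c, X.map (θ c) = algebraMap ℂ K (c : ℂ) • X)
    {η : Γ → K →ₐ[ℂ] K} (hη1 : ∀ u, η 1 u = u)
    (hη : ∀ h, X.map (η h) = (LinearMap.toMatrix b b (σ h)).map (algebraMap ℂ K) * X)
    (i₀ : Fin n) {T : Matrix (Fin n ⊕ M) (Fin n ⊕ M) (RatFun W)} (hT : IsUnit T.det)
    (hTx : ∀ x : ℂˣ × Γ, T.map (ratPullback (scaled σ) x) *
      (LinearMap.toMatrix b b (scaled σ x)).map (algebraMap ℂ (RatFun W)) = T)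
    {S : Subalgebra ℂ K} (hS : ∀ u, u ∈ S ↔ u ∈ flagField X i₀ ∧ (∀ x, θ x u = u) ∧
      ∀ h, η h u = u) :
    ∃ i₁ : Fin n, Nonempty (Frac (MvPolynomial (M × {j : Fin n // j ≠ i₁})
      (projQuotientField σ ⊗[ℂ] (⊤ : Subalgebra ℂ ℂ))) ≃ₐ[ℂ] S) := by
  have hX := isUnit_det_toRows₁ hind
  obtain ⟨j, hj⟩ := exists_algHom_of_algebraicIndependent (algebraicIndependent_ratCoord b)
    (generates_ratCoord b) (y := fun i => X i i₀)
    (hind.comp (fun i => (i, i₀)) fun i i' h => (Prod.ext_iff.mp h).1)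
  -- homotheties and group elements act on the column `i₀`, as on a generic point of `W`
  let ω (x : ℂˣ × Γ) : K →ₐ[ℂ] K := (θ x.1).comp (η x.2)
  have hω (x) : X.map (ω x) = (LinearMap.toMatrix b b (scaled σ x)).map (algebraMap ℂ K) * X := by
    have h1 : X.map (ω x) = (X.map (η x.2)).map (θ x.1) := rfl
    have h2 : ((LinearMap.toMatrix b b (σ x.2)).map (algebraMap ℂ K)).map (θ x.1) =
        (LinearMap.toMatrix b b (σ x.2)).map (algebraMap ℂ K) := by
      ext i j; exact (θ x.1).commutes _
    have h3 : LinearMap.toMatrix b b (scaled σ x) =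
        (x.1 : ℂ) • LinearMap.toMatrix b b (σ x.2) := map_smul _ _ _
    rw [h1, hη, Matrix.map_mul, h2, hθ, h3, Matrix.mul_smul, ← Matrix.smul_mul]
    congr 1
    ext i j
    simp
  have hωj (x u) : ω x (j u) = j (ratPullback (scaled σ) x u) := by
    refine algHom_eq_of_generates (generates_ratCoord b) (f := (ω x).comp j)
      (g := j.comp (ratPullback (scaled σ) x).toAlgHom) (fun i => ?_) u
    change ω x (j (ratCoord b i)) = j (ratPullback (scaled σ) x (ratCoord b i))
    rw [ratPullback_ratCoord, hj, map_sum]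
    refine (congrFun (congrFun (hω x) i) i₀).trans ?_
    rw [Matrix.mul_apply]
    exact Finset.sum_congr rfl fun k _ => by rw [map_mul, hj, AlgHom.commutes]; rfl
  have hTj : IsUnit (T.map j).det := by
    have := hT.map j
    rwa [AlgHom.map_det] at this
  -- permute the rows of the frame, so that the column space lies in the big cell
  let L : Matrix (Fin n) (Fin n ⊕ M) K := Matrix.fromCols X.toRows₁⁻¹ 0
  obtain ⟨π, hπ⟩ := exists_perm_isUnit_det (N := T.map j * X) (L := L * (T.map j)⁻¹) (by
      rw [Matrix.mul_assoc, Matrix.nonsing_inv_mul_cancel_left _ _ hTj]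
      have hLX : L * X = L * Matrix.fromRows X.toRows₁ X.toRows₂ := by
        rw [Matrix.fromRows_toRows]
      rw [hLX, Matrix.fromCols_mul_fromRows, Matrix.nonsing_inv_mul _ hX, Matrix.zero_mul, add_zero])
  let T' := T.submatrix π id
  have hT'x (x) : T'.map (ratPullback (scaled σ) x) *
      (LinearMap.toMatrix b b (scaled σ x)).map (algebraMap ℂ (RatFun W)) = T' := by
    ext i k; exact congrFun (congrFun (hTx x) (π i)) k
  have hT'j : IsUnit (T'.map j).det := by
    have h1 : T'.map j = (T.map j).submatrix π id := rfl
    rw [h1, Matrix.det_permute]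
    exact ((Equiv.Perm.sign π).isUnit.map (Int.castRingHom K)).mul hTj
  let Y := T'.map j * X
  have hY : IsUnit Y.toRows₁.det := hπ
  have hωY (x) : Y.map (ω x) = Y := by
    have h1 : (T'.map j).map (ω x) = (T'.map (ratPullback (scaled σ) x)).map j := by
      ext i k; exact hωj x _
    have h2 := congrArg (fun N => Matrix.map N j) (hT'x x)
    have h3 : ((LinearMap.toMatrix b b (scaled σ x)).map (algebraMap ℂ (RatFun W))).map j =
        (LinearMap.toMatrix b b (scaled σ x)).map (algebraMap ℂ K) := by
      ext i k; exact j.commutes _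
    beta_reduce at h2
    rw [Matrix.map_mul, h3] at h2
    rw [Matrix.map_mul, h1, hω, ← Matrix.mul_assoc, h2]
  have hωZ (x i k) : ω x (cellCoord Y i k) = cellCoord Y i k :=
    congrFun (congrFun (cellCoord_map_of_mul_right hY (f := ω x) (P := 1)
      ((hωY x).trans (Matrix.mul_one Y).symm)) i) k
  obtain ⟨i₁, hi₁⟩ : ∃ i₁, Y (.inl i₁) i₀ ≠ 0 := by
    by_contra! h0
    exact hY.ne_zero (Matrix.det_eq_zero_of_column_eq_zero i₀ h0)
  -- the entries in the column `i₁` are determined by the others, as the point `Y i i₀` lies in the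
  -- column space and has a nonzero coordinate at `i₁`
  let t (i : M × {k : Fin n // k ≠ i₁}) : K := cellCoord Y i.1 i.2
  -- no second field is involved: take `ℂ` with no coordinates
  let z : Empty → ℂ := Empty.elim
  have hz : Generates z := fun k => ⟨.C k, 1, by simp, by simp⟩
  let fam := Sum.elim (fun i => j (ratCoord b i))
    (Sum.elim (fun i => Algebra.ofId ℂ K (z i)) t)
  let F := IntermediateField.adjoin ℂ (Set.range fam)
  have hfam (i) : fam i ∈ F := IntermediateField.subset_adjoin ℂ _ ⟨i, rfl⟩
  have hjF : ∀ u, j u ∈ F := mem_of_generates (generates_ratCoord b) j fun i => hfam (.inl i)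
  have hYi (i) : Y i i₀ ∈ F := by
    refine sum_mem fun k _ => mul_mem (hjF _) ?_
    change X k i₀ ∈ F
    rw [← hj]
    exact hjF _
  have hYZ : ∀ i k, cellCoord Y i k ∈ F := by
    intro i k
    by_cases hk : k = i₁
    · subst hk
      have h1 := congrFun (congrFun (cellCoord_mul hY) i) i₀
      rw [Matrix.mul_apply, ← Finset.add_sum_erase _ _ (Finset.mem_univ k)] at h1
      rw [(eq_mul_inv_iff_mul_eq₀ hi₁).mpr (eq_sub_of_add_eq h1)]
      refine mul_mem (sub_mem (hYi _) (sum_mem fun l hl => mul_mem ?_ (hYi _))) (inv_mem (hYi _))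
      exact hfam (.inr (.inr (i, ⟨l, Finset.ne_of_mem_erase hl⟩)))
    · exact hfam (.inr (.inr (i, ⟨k, hk⟩)))
  have hXF : ∀ i k, cellCoord X i k ∈ F := by
    have hXY : X = (T'.map j)⁻¹ * Y := (Matrix.nonsing_inv_mul_cancel_left _ _ hT'j).symm
    rw [hXY]
    exact cellCoord_mul_left_mem hY hYZ (matrix_inv_mem fun i k => hjF _)
  have hgens : ∀ i, Sum.elim (fun i : Fin n => X (.inl i) i₀)
      (fun i : M × Fin n => cellCoord X i.1 i.2) i ∈ F := by
    rintro (i | i)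
    · change X (.inl i) i₀ ∈ F
      rw [← hj]
      exact hjF _
    · exact hXF _ _
  have hXflag : ∀ i, X i i₀ ∈ flagField X i₀ := by
    have h1 (i) : X (.inl i) i₀ ∈ flagField X i₀ :=
      IntermediateField.subset_adjoin ℂ _ ⟨.inl i, rfl⟩
    rintro (i | i)
    · exact h1 i
    · change X.toRows₂ i i₀ ∈ _
      rw [← cellCoord_mul hX, Matrix.mul_apply]
      exact sum_mem fun k _ => mul_mem (cellField_le_flagField i₀ (cellCoord_mem X _ _)) (h1 k)
  have hjflag : ∀ u, j u ∈ flagField X i₀ := mem_of_generates (generates_ratCoord b) j fun i => by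
    rw [hj]
    exact hXflag i
  have hflag : flagField X i₀ = F := by
    refine le_antisymm (IntermediateField.adjoin_le_iff.mpr ?_)
      (IntermediateField.adjoin_le_iff.mpr ?_)
    · rintro _ ⟨i, rfl⟩
      exact hgens i
    · rintro _ ⟨i | i | i, rfl⟩
      · exact hjflag _
      · exact i.elim
      · exact cellCoord_mul_left_mem hX
          (fun _ _ => cellField_le_flagField i₀ (cellCoord_mem X _ _)) (fun _ _ => hjflag _) _ _
  have hfi : AlgebraicIndependent ℂ fam := by
    refine algebraicIndependent_of_card (x := Sum.elim (fun i : Fin n => X (.inl i) i₀)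
      (fun i : M × Fin n => cellCoord X i.1 i.2)) ?_ ?_ hgens
    · convert (algebraicIndependent_frame_cellCoord hind (T := 1) (by simp) (fun i j => by
        rw [Matrix.one_apply]; split_ifs
        exacts [one_mem _, zero_mem _])).comp
        (Sum.map (fun i : Fin n => (i, i₀)) id : _ → _)
        (Function.Injective.sumMap (fun i j h => (Prod.ext_iff.mp h).1)
          Function.injective_id) using 1
      ext (i | i)
      · simp
      · rfl
    · have hn : 0 < n := i₀.pos
      obtain ⟨n', rfl⟩ : ∃ n', n = n' + 1 := ⟨n - 1, by omega⟩
      simp only [Fintype.card_sum, Fintype.card_prod, Fintype.card_fin, Fintype.card_empty,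
        Fintype.card_subtype_compl, Fintype.card_subtype_eq, Nat.add_sub_cancel, ne_eq]
      ring
  refine ⟨i₁, (nonempty_frac_equiv_invariants (generates_ratCoord b) hz j (Algebra.ofId ℂ K) t hfi
    (γ := fun x => (ratPullback (scaled σ) x).toAlgHom) (θ := ω)
    (τ := fun e : Empty => e.elim) (η := fun e : Empty => e.elim)
    (mem_projQuotientField_iff σ) (k₂ := ⊤) (fun u => ⟨fun _ e => e.elim, fun _ => trivial⟩)
    hωj (fun x u => (ω x).commutes u) (fun x i => hωZ x _ _) (fun e => e.elim) (fun e => e.elim)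
    (fun e => e.elim) (fun u => ?_)).2⟩
  rw [hS, hflag]
  refine and_congr_right' ⟨fun h => ⟨fun x => ?_, fun e => e.elim⟩, fun h => ⟨fun c => ?_, fun g => ?_⟩⟩
  · change θ x.1 (η x.2 u) = u
    rw [h.2, h.1]
  · have := h.1 (c, 1)
    change θ c (η 1 u) = u at this
    rwa [hη1] at this
  · have := h.1 (1, g)
    change θ 1 (η g u) = u at this
    rwa [hθ1] at this

/-! ### Products with affine spaces -/

section FracEquiv

variable {A B : Type*} [CommRing A] [Algebra ℂ A] [CommRing B] [Algebra ℂ B]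

/-- Isomorphic rings have isomorphic fraction fields. -/
def fracCongr (e : A ≃ₐ[ℂ] B) : Frac A ≃ₐ[ℂ] Frac B :=
  IsFractionRing.algEquivOfAlgEquiv e

/-- Inverting elements of a domain changes neither the property of being a domain nor the fraction
field. -/
theorem isDomain_and_nonempty_frac_equiv [IsDomain A] (φ : A →ₐ[ℂ] B)
    (hφ : Function.Injective φ) (h : ∀ b, ∃ q p, IsUnit (φ q) ∧ φ q * b = φ p) :
    IsDomain B ∧ Nonempty (Frac A ≃ₐ[ℂ] Frac B) := by
  have : Nontrivial B := hφ.nontrivial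
  have hB : IsDomain B := by
    have : NoZeroDivisors B := ⟨fun {b b'} hbb => by
      obtain ⟨q, p, hq, hp⟩ := h b
      obtain ⟨q', p', hq', hp'⟩ := h b'
      have h0 : φ (p * p') = 0 := by
        rw [map_mul, ← hp, ← hp', mul_mul_mul_comm, hbb, mul_zero]
      rw [map_eq_zero_iff φ hφ, mul_eq_zero] at h0
      rcases h0 with h0 | h0
      · rw [h0, map_zero, hq.mul_right_eq_zero] at hp
        exact .inl hp
      · rw [h0, map_zero, hq'.mul_right_eq_zero] at hp'
        exact .inr hp'⟩
    exact NoZeroDivisors.to_isDomain B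
  refine ⟨hB, ?_⟩
  let _ : Field (Frac B) := IsFractionRing.toField B
  have hinj : Function.Injective (algebraMap B (Frac B)) := IsFractionRing.injective _ _
  let j : A →ₐ[ℂ] Frac B := (IsScalarTower.toAlgHom ℂ B (Frac B)).comp φ
  have hj (a) : j a = algebraMap B (Frac B) (φ a) := rfl
  obtain ⟨e⟩ := nonempty_frac_equiv j (hinj.comp hφ) ⊤ (fun _ => trivial) (fun _ _ => trivial) (by
    intro u _
    obtain ⟨⟨b, d⟩, hbd⟩ := IsLocalization.surj (nonZeroDivisors B) u
    obtain ⟨q, p, hq, hp⟩ := h b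
    obtain ⟨q', p', hq', hp'⟩ := h d
    refine ⟨q' * p, q * p', ?_, ?_⟩
    · have h1 : φ (q * p') ≠ 0 := by
        rw [map_mul, ← hp']
        exact mul_ne_zero hq.ne_zero (mul_ne_zero hq'.ne_zero (nonZeroDivisors.ne_zero d.2))
      exact fun h0 => h1 (by rw [h0, map_zero])
    · rw [hj, hj, map_mul φ, map_mul φ, ← hp, ← hp', map_mul, map_mul, map_mul, map_mul]
      dsimp only at hbd
      rw [← hbd]
      ring)
  exact ⟨e.trans Subalgebra.topEquiv⟩

end FracEquiv

section ChangeFactor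

variable {R S S' T T' : Type*} [CommRing R] [Algebra ℂ R] [CommRing S] [Algebra ℂ S]
  [CommRing S'] [Algebra ℂ S']

/-- Variables adjoined to a factor of a tensor product. -/
def sumPolyEquiv (T T' R S : Type*) [CommRing R] [Algebra ℂ R] [CommRing S] [Algebra ℂ S] :
    MvPolynomial (T ⊕ T') (R ⊗[ℂ] S) ≃ₐ[ℂ] MvPolynomial T (R ⊗[ℂ] MvPolynomial T' S) :=
  ((MvPolynomial.sumAlgEquiv (R ⊗[ℂ] S) T T').restrictScalars ℂ).trans
    (MvPolynomial.mapAlgEquiv T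
      ((MvPolynomial.rTensorAlgEquiv (R := ℂ) (S := R) (N := S) (σ := T')).symm.restrictScalars ℂ))

/-- If `S'` is the fraction field of `S[T']`, then `(R ⊗ S')[T]` has the same fraction field
as `(R ⊗ S)[T, T']`. -/
theorem isDomain_and_nonempty_frac_equiv_sum [IsDomain (R ⊗[ℂ] S)]
    (e : Frac (MvPolynomial T' S) ≃ₐ[ℂ] S') :
    IsDomain (MvPolynomial T (R ⊗[ℂ] S')) ∧ Nonempty (Frac (MvPolynomial (T ⊕ T') (R ⊗[ℂ] S)) ≃ₐ[ℂ]
      Frac (MvPolynomial T (R ⊗[ℂ] S'))) := by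
  let f : MvPolynomial T' S →ₐ[ℂ] S' := e.toAlgHom.comp (IsScalarTower.toAlgHom ℂ _ _)
  have hf : Function.Injective f := e.injective.comp (IsFractionRing.injective _ _)
  have hfs (s : S') : ∃ q p, IsUnit (f q) ∧ f q * s = f p := by
    obtain ⟨⟨p, q⟩, hpq⟩ := IsLocalization.surj (nonZeroDivisors (MvPolynomial T' S)) (e.symm s)
    refine ⟨q, p, (IsLocalization.map_units _ q).map e, ?_⟩
    have := congrArg e hpq
    rw [map_mul, e.apply_symm_apply, mul_comm] at this
    exact this
  let φ : MvPolynomial T (R ⊗[ℂ] MvPolynomial T' S) →ₐ[ℂ] MvPolynomial T (R ⊗[ℂ] S') :=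
    polyMap (AlgHom.id ℂ R) f
  have hφ : Function.Injective φ := MvPolynomial.map_injective _
    (Module.Flat.lTensor_preserves_injective_linearMap (M := R) f.toLinearMap hf)
  have hφ₁ (q) : φ (.C (1 ⊗ₜ q)) = .C (1 ⊗ₜ f q) := by simp [φ, polyMap]
  have : IsDomain (MvPolynomial T (R ⊗[ℂ] MvPolynomial T' S)) :=
    (sumPolyEquiv T T' R S).symm.toMulEquiv.isDomain _
  -- elements of `(R ⊗ S')[T]` have denominators in `S[T']`
  have key (x : MvPolynomial T (R ⊗[ℂ] S')) :
      ∃ q p, IsUnit (f q) ∧ .C (1 ⊗ₜ f q) * x = φ p := by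
    have hadd {x y} (hx : ∃ q p, IsUnit (f q) ∧ .C (1 ⊗ₜ f q) * x = φ p)
        (hy : ∃ q p, IsUnit (f q) ∧ .C (1 ⊗ₜ f q) * y = φ p) :
        ∃ q p, IsUnit (f q) ∧ .C (1 ⊗ₜ f q) * (x + y) = φ p := by
      obtain ⟨q, p, hq, hp⟩ := hx
      obtain ⟨q', p', hq', hp'⟩ := hy
      refine ⟨q * q', .C (1 ⊗ₜ q') * p + .C (1 ⊗ₜ q) * p', ?_, ?_⟩
      · rw [map_mul]
        exact hq.mul hq'
      · have h1 : (1 : R) ⊗ₜ[ℂ] (f q * f q') = (1 ⊗ₜ f q) * (1 ⊗ₜ f q') := by simp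
        rw [map_add, map_mul φ, map_mul φ, hφ₁, hφ₁, ← hp, ← hp', map_mul, h1, map_mul]
        ring
    induction x using MvPolynomial.induction_on with
    | C a =>
      induction a using TensorProduct.induction_on with
      | zero => exact ⟨1, 0, by simp, by simp⟩
      | add a a' ha ha' => rw [map_add]; exact hadd ha ha'
      | tmul r s =>
        obtain ⟨q, p, hq, hp⟩ := hfs s
        refine ⟨q, .C (r ⊗ₜ p), hq, ?_⟩
        rw [← map_mul, Algebra.TensorProduct.tmul_mul_tmul, one_mul, hp]
        simp [φ, polyMap]
    | add x y hx hy => exact hadd hx hy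
    | mul_X x i hx =>
      obtain ⟨q, p, hq, hp⟩ := hx
      refine ⟨q, p * .X i, hq, ?_⟩
      rw [← mul_assoc, hp, map_mul]
      congr 1
      simp [φ, polyMap]
  have hloc (x : MvPolynomial T (R ⊗[ℂ] S')) : ∃ q p, IsUnit (φ q) ∧ φ q * x = φ p := by
    obtain ⟨q, p, hq, hp⟩ := key x
    refine ⟨.C (1 ⊗ₜ q), p, ?_, ?_⟩
    · rw [hφ₁]
      exact (hq.map (Algebra.TensorProduct.includeRight : S' →ₐ[ℂ] R ⊗[ℂ] S')).map MvPolynomial.C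
    · rw [hφ₁, hp]
  obtain ⟨h1, ⟨e'⟩⟩ := isDomain_and_nonempty_frac_equiv
    (A := MvPolynomial T (R ⊗[ℂ] MvPolynomial T' S)) (B := MvPolynomial T (R ⊗[ℂ] S')) φ hφ hloc
  exact ⟨h1, ⟨(fracCongr (sumPolyEquiv T T' R S)).trans e'⟩⟩

/-- If `k₂` and `k₃` become isomorphic after adjoining variables, so do their products with a
third field, provided there are enough variables. -/
theorem nonempty_frac_equiv_of_stably_equiv {k₁ k₂ k₃ k T T' T'' : Type*} [CommRing k₁]
    [Algebra ℂ k₁] [CommRing k₂] [Algebra ℂ k₂] [CommRing k₃] [Algebra ℂ k₃] [CommRing k]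
    [Algebra ℂ k] [IsDomain (k₁ ⊗[ℂ] k₂)] (e : Frac (MvPolynomial T' k₂) ≃ₐ[ℂ] k)
    (e' : Frac (MvPolynomial T'' k₃) ≃ₐ[ℂ] k) :
    Nonempty (Frac (MvPolynomial (T ⊕ T') (k₁ ⊗[ℂ] k₂)) ≃ₐ[ℂ]
      Frac (MvPolynomial (T ⊕ T'') (k₁ ⊗[ℂ] k₃))) := by
  obtain ⟨hk, ⟨e₁⟩⟩ := isDomain_and_nonempty_frac_equiv_sum (R := k₁) (T := T) e
  let f : k₃ →ₐ[ℂ] k := (e'.toAlgHom.comp (IsScalarTower.toAlgHom ℂ _ _)).comp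
    (IsScalarTower.toAlgHom ℂ k₃ (MvPolynomial T'' k₃))
  have hf : Function.Injective f := (e'.injective.comp (IsFractionRing.injective _ _)).comp
    (MvPolynomial.C_injective T'' k₃)
  have h₃ : Function.Injective ((MvPolynomial.C (σ := T)).comp
      (Algebra.TensorProduct.map (AlgHom.id ℂ k₁) f : k₁ ⊗[ℂ] k₃ →+* k₁ ⊗[ℂ] k)) :=
    (MvPolynomial.C_injective _ _).comp
      (Module.Flat.lTensor_preserves_injective_linearMap (M := k₁) f.toLinearMap hf)
  have : IsDomain (k₁ ⊗[ℂ] k₃) := h₃.isDomain _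
  obtain ⟨-, ⟨e₂⟩⟩ := isDomain_and_nonempty_frac_equiv_sum (R := k₁) (T := T) e'
  exact ⟨e₁.trans e₂.symm⟩

end ChangeFactor

/-! ### Generic matrices -/

section OuterTensor

variable {Γ Δ V W κ ι : Type*} [Group Γ] [Group Δ] [AddCommGroup V] [Module ℂ V]
  [AddCommGroup W] [Module ℂ W] [Fintype κ] [Fintype ι] (ρ : Representation ℂ Γ V)
  (σ : Representation ℂ Δ W) (b : Module.Basis κ ℂ V) (b' : Module.Basis ι ℂ W)

/-- The coordinates on `V ⊗ W`, written as a matrix whose rows are indexed by the basis of `W`. -/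
def genericMatrix : Matrix ι κ (RatFun (V ⊗[ℂ] W)) :=
  .of fun i k => ratCoord (b.tensorProduct b') (k, i)

theorem algebraicIndependent_genericMatrix :
    AlgebraicIndependent ℂ fun i : ι × κ => genericMatrix b b' i.1 i.2 :=
  (algebraicIndependent_ratCoord (b.tensorProduct b')).comp _ Prod.swap_injective

variable [FiniteDimensional ℂ V] [FiniteDimensional ℂ W]

theorem generates_genericMatrix : Generates fun i : ι × κ => genericMatrix b b' i.1 i.2 := by
  intro u
  obtain ⟨p, q, hq, h⟩ := generates_ratCoord (b.tensorProduct b') u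
  have e (r : MvPolynomial (κ × ι) ℂ) :
      MvPolynomial.aeval (fun i : ι × κ => genericMatrix b b' i.1 i.2)
        (MvPolynomial.rename Prod.swap r) = MvPolynomial.aeval (ratCoord (b.tensorProduct b')) r := by
    rw [MvPolynomial.aeval_rename]
    rfl
  exact ⟨MvPolynomial.rename Prod.swap p, MvPolynomial.rename Prod.swap q, by rwa [e],
    by rw [e, e, h]⟩

/-- The group acts on the generic matrix by row and column operations. -/
theorem genericMatrix_map [DecidableEq κ] [DecidableEq ι] (c : ℂˣ) (g : Γ) (h : Δ) :
    (genericMatrix b b').map (ratPullback (scaled (outerTensor ρ σ)) (c, (g, h))) =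
      (LinearMap.toMatrix b' b' (σ h)).map (algebraMap ℂ (RatFun (V ⊗[ℂ] W))) * (genericMatrix b b' *
        ((LinearMap.toMatrix b b (scaled ρ (c, g))).map (algebraMap ℂ (RatFun (V ⊗[ℂ] W)))).transpose) := by
  have h1 : scaled (outerTensor ρ σ) (c, (g, h)) = TensorProduct.map (scaled ρ (c, g)) (σ h) := by
    apply TensorProduct.ext'
    intro v w
    simp only [scaled_apply, TensorProduct.map_tmul]
    rfl
  ext i k
  rw [Matrix.map_apply, genericMatrix, Matrix.of_apply, ratPullback_ratCoord, h1,
    TensorProduct.toMatrix_map, Fintype.sum_prod_type, Finset.sum_comm, Matrix.mul_apply]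
  refine Finset.sum_congr rfl fun m _ => ?_
  rw [Matrix.mul_apply, Finset.mul_sum]
  refine Finset.sum_congr rfl fun l _ => ?_
  rw [Matrix.kroneckerMap_apply, map_mul, Matrix.map_apply, Matrix.transpose_apply,
    Matrix.map_apply, Matrix.of_apply]
  ring

end OuterTensor

theorem isAlgebraicRep_copies {G : Over (Spec (CommRingCat.of ℂ))} [GrpObj G] {V : Type*}
    [AddCommGroup V] [Module ℂ V] {ρ : Representation ℂ (Points G) V} (hρ : IsAlgebraicRep ρ)
    (c : ℕ) : IsAlgebraicRep (copies ρ c) := by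
  classical
  intro v φ
  choose f hf using fun i => hρ (v i) (φ.comp (DirectSum.lof ℂ (Fin c) (fun _ => V) i))
  refine ⟨∑ i, f i, fun g => ?_⟩
  have h1 : copies ρ c g v = ∑ i, DirectSum.lof ℂ (Fin c) (fun _ => V) i (ρ g (v i)) := by
    have h2 (w : DirectSum (Fin c) fun _ => V) :
        w = ∑ i, DirectSum.lof ℂ (Fin c) (fun _ => V) i (w i) := by
      conv_lhs => rw [← DirectSum.sum_univ_of w]
      rfl
    conv_lhs => rw [h2 (copies ρ c g v)]
    refine Finset.sum_congr rfl fun i _ => ?_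
    congr 1
  have h3 (f : Γ(G.left, ⊤)) : evalAt ⊤ f g = evalHom ⊤ g trivial f := dif_pos trivial
  rw [h1, map_sum, h3, map_sum]
  refine Finset.sum_congr rfl fun i _ => ?_
  rw [← h3, ← hf]
  rfl

end NoName

end

set_option maxHeartbeats 400000 in
theorem mainTheorem2
    (G H : Over (Spec (CommRingCat.of ℂ)))
    [GrpObj G] [LocallyOfFiniteType G.hom] [QuasiCompact G.hom]
    [GrpObj H] [LocallyOfFiniteType H.hom] [QuasiCompact H.hom]
    {V W : Type*}
    [AddCommGroup V] [Module ℂ V] [FiniteDimensional ℂ V]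
    [AddCommGroup W] [Module ℂ W] [FiniteDimensional ℂ W]
    (ρ : Representation ℂ (InvTheory.Points G) V) (hρ : InvTheory.IsAlgebraicRep ρ)
    (σ : Representation ℂ (InvTheory.Points H) W) (hσ : InvTheory.IsAlgebraicRep σ)
    (a b : ℕ) (ha : Module.finrank ℂ V = a + 1) (hb : Module.finrank ℂ W = b + 1) (hab : a < b)
    (hL : ∃ L : InvTheory.LinearizedLineBundle (a + 1) σ,
      L.TwistTrivialOn (InvTheory.projKernel σ))
    (a' : ℕ) (ha'₁ : 1 ≤ a') (ha' : a' ≤ a)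
    (hV : InvTheory.ActsAlmostFreely (InvTheory.copies ρ a') 1 (InvTheory.projKernel ρ))
    (hW : InvTheory.ActsAlmostFreely σ 1 (InvTheory.projKernel σ))
    (hGr : InvTheory.ActsAlmostFreely σ (a + 1) (InvTheory.projKernel σ)) :
    Nonempty
      (InvTheory.projQuotientField (InvTheory.outerTensor ρ σ) ≃ₐ[ℂ]
        InvTheory.AffineProdField ((a + 1) * (a - a') + 1 + a * (b - a))
          (InvTheory.projQuotientField (InvTheory.copies ρ a'))
          (InvTheory.projQuotientField σ)) := by
  open NoName InvTheory in
  classical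
  have hW' : Module.finrank ℂ W = (a + 1) + (b - a) := by omega
  let bV := Module.finBasisOfFinrankEq ℂ V ha
  let bW := (Module.finBasisOfFinrankEq ℂ W hW').reindex finSumFinEquiv.symm
  let X := genericMatrix bV bW
  let act := ratPullback (scaled (outerTensor ρ σ))
  let θ (x : ℂˣ × Points G) : RatFun (V ⊗[ℂ] W) →ₐ[ℂ] RatFun (V ⊗[ℂ] W) :=
    (act (x.1, (x.2, 1))).toAlgHom
  let η (h : Points H) : RatFun (V ⊗[ℂ] W) →ₐ[ℂ] RatFun (V ⊗[ℂ] W) :=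
    (act (1, (1, h))).toAlgHom
  have hact (x y u) : act (x * y) u = act y (act x u) := ratPullback_mul _ x y u
  have hind := algebraicIndependent_genericMatrix bV bW
  have hθ (x) : X.map (θ x) =
      X * ((LinearMap.toMatrix bV bV (scaled ρ x)).map
        (algebraMap ℂ (RatFun (V ⊗[ℂ] W)))).transpose := by
    refine (genericMatrix_map ρ σ bV bW x.1 x.2 1).trans ?_
    rw [map_one, LinearMap.toMatrix_one, Matrix.map_one _ (map_zero _) (map_one _), Matrix.one_mul]
  have hη (h) : X.map (η h) = (LinearMap.toMatrix bW bW (σ h)).map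
      (algebraMap ℂ (RatFun (V ⊗[ℂ] W))) * X := by
    refine (genericMatrix_map ρ σ bV bW 1 1 h).trans ?_
    have h1 : scaled ρ (1, 1) = 1 := map_one (scaled ρ)
    rw [h1, LinearMap.toMatrix_one, Matrix.map_one _ (map_zero _) (map_one _),
      Matrix.transpose_one, Matrix.mul_one]
  have hη1 (u) : η 1 u = u := ratPullback_one _ u
  have hηmul (g h u) : η (g * h) u = η h (η g u) := by
    have h1 : ((1, (1, g * h)) : ℂˣ × (Points G × Points H)) = (1, (1, g)) * (1, (1, h)) := by simp
    change act (1, (1, g * h)) u = _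
    rw [h1, hact]
    rfl
  have hθ' (c : ℂˣ) : X.map (θ (c, 1)) = algebraMap ℂ (RatFun (V ⊗[ℂ] W)) (c : ℂ) • X := by
    have h1 : LinearMap.toMatrix bV bV (scaled ρ (c, 1)) = (c : ℂ) • 1 := by
      rw [← LinearMap.toMatrix_one bV, ← map_smul]
      congr 1
      ext v
      simp [scaled_apply]
    rw [hθ, h1]
    refine Matrix.ext fun i k => ?_
    rw [Matrix.mul_apply, Finset.sum_eq_single k (fun l _ hl => by simp [hl.symm]) (by simp)]
    simp [mul_comm]
  obtain ⟨L, hL⟩ := hL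
  obtain ⟨τ, T, s, hτ, hT, hTX, hs, hTη⟩ := exists_frame_of_columns bW hσ a.succ_pos L hL hGr hind
    hη1 hηmul hη
  obtain ⟨T₁, hT₁, hT₁x⟩ := exists_linear_frame (isAlgebraicRep_copies hρ a') hρ hV (fun g hg => by
    obtain ⟨μ, hμ⟩ := exists_scalar_of_mem_projKernel hg
    refine ⟨μ, LinearMap.ext fun v => ?_, hμ⟩
    ext i
    change ρ g (v i) = μ • v i
    rw [hμ]
    rfl) (copiesBasis bV a') bV
  obtain ⟨T₃, hT₃, hT₃x⟩ := exists_linear_frame hσ hσ hW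
    (fun g hg => (exists_scalar_of_mem_projKernel hg).imp fun μ h => ⟨h, h⟩) bW bW
  -- the quotient of the projectivization of `V ⊗ W`, over the quotient of the Grassmannian
  obtain ⟨hdom, ⟨e₁⟩⟩ := nonempty_frac_equiv_of_matrix hind hτ hT hTX hs hTη ρ bV a.succ_pos ha'₁
    (finSumFinEquiv.trans (finCongr (by omega)) : Fin a' ⊕ Fin (a + 1 - a') ≃ Fin (a + 1))
    (generates_genericMatrix bV bW) hθ hT₁ hT₁x (S := projQuotientField (outerTensor ρ σ))
    (fun u => by
      rw [mem_projQuotientField_iff]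
      refine ⟨fun h => ⟨fun x => h _, fun x => h _⟩, fun h x => ?_⟩
      have hx : x = (x.1, (x.2.1, 1)) * (1, (1, x.2.2)) := by simp
      rw [hx]
      refine (hact _ _ u).trans ?_
      exact (congrArg _ (h.1 (x.1, x.2.1))).trans (h.2 x.2.2))
  -- the quotient of the flag variety, over the quotient of the Grassmannian
  let S := (flagField X 0).toSubalgebra ⊓
    (fixedSubalgebra (fun c : ℂˣ => θ (c, 1)) ⊓ fixedSubalgebra η)
  obtain ⟨e₂⟩ := nonempty_frac_equiv_of_column hind hτ hT hTX hs hTη (i₀ := 0)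
    (finSumFinEquiv.trans (finCongr (add_comm 1 a)) : Fin 1 ⊕ Fin a ≃ Fin (a + 1)) hθ' (S := S)
    (fun u => Iff.rfl)
  -- the quotient of the flag variety, over the quotient of the projectivization of `W`
  obtain ⟨i₁, ⟨e₃⟩⟩ := nonempty_frac_equiv_of_point σ bW hind (θ := fun c => θ (c, 1))
    (fun u => ratPullback_one _ u) hθ' hη1 hη 0 hT₃ hT₃x (S := S) (fun u => Iff.rfl)
  have : IsDomain (projQuotientField (copies ρ a') ⊗[ℂ] cellInvariants X η) :=
    (MvPolynomial.C_injective _ _).isDomain (MvPolynomial.C (σ := Fin (a + 1 - a') × Fin (a + 1)))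
  obtain ⟨e₄⟩ := nonempty_frac_equiv_of_stably_equiv (T := Fin ((a + 1) * (a - a') + 1))
    (k₁ := projQuotientField (copies ρ a')) (k₂ := cellInvariants X η) (k₃ := projQuotientField σ)
    ((fracCongr (MvPolynomial.mapAlgEquiv _ ((Algebra.TensorProduct.congr
      (Algebra.botEquiv ℂ _) AlgEquiv.refl).trans
      (Algebra.TensorProduct.lid ℂ (cellInvariants X η))))).symm.trans e₂)
    ((fracCongr (MvPolynomial.mapAlgEquiv _ ((Algebra.TensorProduct.congr AlgEquiv.refl
      (Subalgebra.topEquiv (R := ℂ) (A := ℂ))).trans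
      (Algebra.TensorProduct.rid ℂ ℂ (projQuotientField σ))))).symm.trans e₃)
  -- of the `(a + 1) * (a + 1 - a')` variables, `a` are traded for `a * (b - a)` others
  obtain ⟨d, rfl⟩ : ∃ d, a = a' + d := ⟨a - a', by omega⟩
  have f₁ : Fin (a' + d + 1 - a') × Fin (a' + d + 1) ≃
      Fin ((a' + d + 1) * (a' + d - a') + 1) ⊕ Fin (a' + d) × Unit := Fintype.equivOfCardEq (by
    have h1 : a' + d + 1 - a' = d + 1 := by omega
    have h2 : a' + d - a' = d := by omega
    simp only [Fintype.card_prod, Fintype.card_sum, Fintype.card_fin, Fintype.card_unit, h1, h2]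
    ring)
  have f₂ : Fin ((a' + d + 1) * (a' + d - a') + 1) ⊕ Fin (b - (a' + d)) × {j // j ≠ i₁} ≃
      Fin ((a' + d + 1) * (a' + d - a') + 1 + (a' + d) * (b - (a' + d))) :=
    Fintype.equivOfCardEq (by
      simp only [Fintype.card_prod, Fintype.card_sum, Fintype.card_fin, ne_eq,
        Fintype.card_subtype_compl, Fintype.card_subtype_eq, Nat.add_sub_cancel]
      ring)
  exact ⟨e₁.symm.trans ((fracCongr ((MvPolynomial.renameEquiv _ f₁).restrictScalars ℂ)).trans
    (e₄.trans (fracCongr ((MvPolynomial.renameEquiv _ f₂).restrictScalars ℂ))))⟩
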